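/- Graphs are finite, simple and undirected. A graph is equimatchable if all its maximal matchings have the same number of edges, and claw-free if it has no induced $K_{1,3}$. A cut set of a connected graph $G$ is a set $S$ of vertices such that $G\setminus S$ is not connected; it is minimal if no proper subset of it is a cut set; a minimal cut set with $k$ vertices is called a $k$-cut, and the vertex of a $1$-cut is a cut vertex. $N(v)$ is the set of neighbours of $v$, $N_X(v)=N(v)\cap X$, $\alpha(G)$ is the independence number, and a graph or vertex set is odd (even) if it has an odd (even) number of vertices. **Theorem.** A graph $G$ is connected, claw-free and equimatchable if and only if one of the following holds: (i) $G\cong C_4$; (ii) $G\cong K_{2p}$ for some $p\ge 1$; (iii) $G$ is connected and odd, and $\alpha(G)\le 2$; (iv) $G\in\mathcal G_1$; (v) $G\in\mathcal G_{21}\cup\mathcal G_{22}\cup\mathcal G_{23}$ or $G\cong C_7$; (vi) $G\in\mathcal G_3$. Here the families are as follows (in $\mathcal G_1,\mathcal G_{22},\mathcal G_{23},\mathcal G_3$ the graph $G$ is connected, since it has a cut set as described). * $G\in\mathcal G_1$ if $G$ has a cut vertex $v$ such that $G-v$ consists of two connected components $G_1,G_2$, each of them an even clique or a $C_4$; whenever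 $G_i$ is a $C_4$, $N_{G_i}(v)$ consists of two adjacent vertices; and if both $G_1$ and $G_2$ are cliques, then $v$ has at least one non-neighbour in each of $G_1$ and $G_2$. * $G\in\mathcal G_{21}$ if $V(G)$ can be partitioned into $V_1,V_2$ such that $V_1$ induces a $K_{2q+1}$ for some $q\ge1$, $V_2$ induces a $4$-cycle $v_1v_2v_3v_4$, $N_{V_1}(v_1)=N_{V_1}(v_2)$, $2\le |N_{V_1}(v_1)|<|V_1|$, and $N_{V_1}(v_3)=N_{V_1}(v_4)=\emptyset$. * $G\in\mathcal G_{22}$ if $G$ has a $2$-cut $S=\{s_1,s_2\}$ with $s_1s_2\notin E(G)$ such that $G\setminus S$ has exactly two components $A$ and $B$, where $A$ is a $K_{2p}$ for some $p\ge1$, $B$ is a $K_{2q+1}$ for some $q\ge0$, $N_B(s_1)=N_B(s_2)=B$, $N_A(s_1)\cup N_A(s_2)\subsetneq A$ and $N_A(s_1)\cap N_A(s_2)=\emptyset$. * $G\in\mathcal G_{23}$ if $G$ has a $2$-cut $S=\{s_1,s_2\}$ with $s_1s_2\notin E(G)$ such that $G\setminus S$ has exactly two components $A$ and $B$, where $A$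 is a $K_2$, $G[S\cup A]$ is a $P_4$ (the path on four vertices), $B$ is a $K_{2q+1}$ for some $q\ge1$, and $N_B(s_1)\cup N_B(s_2)=B$. * $G\in\mathcal G_3$ if $G$ has an independent $3$-cut $S=\{s_1,s_2,s_3\}$ such that $G\setminus S$ consists of two connected components $A$ and $A'$, each an odd clique, and there are $a\in A$, $a'\in A'$ with $N(s_1)=A\cup\{a'\}$, $N(s_2)=A'\cup\{a\}$ and $N(s_3)=(A\cup A')\setminus\{a,a'\}$. -/

import Mathlib

namespace SimpleGraph

variable {V : Type*}

/-- `G` has no induced subgraph isomorphic to the claw `K_{1,3}`. -/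
def IsClawFree (G : SimpleGraph V) : Prop :=
  ¬ (completeBipartiteGraph (Fin 1) (Fin 3)).IsIndContained G

/-- All maximal matchings of `G` have the same number of edges.  (A subgraph that is a matching in
the sense of `Subgraph.IsMatching` is determined by its edges, and the subgraph order on matchings
is inclusion of edge sets.) -/
def IsEquimatchable (G : SimpleGraph V) : Prop :=
  ∀ M N : G.Subgraph, Maximal Subgraph.IsMatching M → Maximal Subgraph.IsMatching N →
    M.edgeSet.ncard = N.edgeSet.ncard

/-- `G` is connected and `G \ S` is not. (The graph without vertices counts as connected here, so
that the set of all vertices is not a cut set.) -/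
def IsCutSet (G : SimpleGraph V) (S : Set V) : Prop :=
  G.Connected ∧ ¬ (G.induce Sᶜ).Preconnected

/-- A cut set of `G` none of whose proper subsets is a cut set of `G`. -/
def IsMinimalCutSet (G : SimpleGraph V) (S : Set V) : Prop :=
  Minimal G.IsCutSet S

/-- `G \ S` has exactly two connected components, and their vertex sets are `A` and `B`. -/
structure HasTwoComponents (G : SimpleGraph V) (S A B : Set V) : Prop where
  union_eq : A ∪ B = Sᶜ
  disjoint : Disjoint A B
  left_connected : (G.induce A).Connected
  right_connected : (G.induce B).Connected
  not_adj : ∀ a ∈ A, ∀ b ∈ B, ¬ G.Adj a b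

/-- The set `A` induces a complete graph on `k` vertices (used for `k ≥ 1` only). -/
def InducesComplete (G : SimpleGraph V) (A : Set V) (k : ℕ) : Prop :=
  G.IsClique A ∧ A.ncard = k

/-- The set `A` induces a cycle on four vertices. -/
def InducesC4 (G : SimpleGraph V) (A : Set V) : Prop :=
  Nonempty (G.induce A ≃g cycleGraph 4)

/-- The neighbourhood of the vertex `v` inside the set `A`. -/
def neighborsIn (G : SimpleGraph V) (A : Set V) (v : V) : Set V :=
  G.neighborSet v ∩ A

/-- The family `𝒢₁`: there is a cut vertex `v` such that `G - v` has exactly two components, each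
an even clique or a `C₄`, with the stated conditions on the neighbourhood of `v`. -/
def MemG1 (G : SimpleGraph V) : Prop :=
  ∃ (v : V) (A B : Set V),
    G.IsMinimalCutSet {v} ∧ G.HasTwoComponents {v} A B ∧
    (∀ C : Set V, C = A ∨ C = B →
      ((∃ p : ℕ, 1 ≤ p ∧ G.InducesComplete C (2 * p)) ∨ G.InducesC4 C) ∧
      (G.InducesC4 C → ∃ x y : V, G.Adj x y ∧ G.neighborsIn C v = {x, y})) ∧
    (G.IsClique A → G.IsClique B →
      (∃ a ∈ A, ¬ G.Adj v a) ∧ (∃ b ∈ B, ¬ G.Adj v b))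

/-- The family `𝒢₂₁`: the vertices are partitioned into a clique `V₁` on `2 q + 1 ≥ 3` vertices and
the vertex set of an induced 4-cycle `c 0, c 1, c 2, c 3`. -/
def MemG21 (G : SimpleGraph V) : Prop :=
  ∃ (V₁ : Set V) (c : cycleGraph 4 ↪g G) (q : ℕ),
    Set.range c = V₁ᶜ ∧
    1 ≤ q ∧ G.InducesComplete V₁ (2 * q + 1) ∧
    G.neighborsIn V₁ (c 0) = G.neighborsIn V₁ (c 1) ∧
    2 ≤ (G.neighborsIn V₁ (c 0)).ncard ∧ (G.neighborsIn V₁ (c 0)).ncard < V₁.ncard ∧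
    G.neighborsIn V₁ (c 2) = ∅ ∧ G.neighborsIn V₁ (c 3) = ∅

/-- The family `𝒢₂₂`: `S = {s₁, s₂}` is an independent minimal cut set, and `G \ S` has exactly two
components, the even one `A` and the odd one `B`. -/
def MemG22 (G : SimpleGraph V) : Prop :=
  ∃ (s₁ s₂ : V) (A B : Set V) (p q : ℕ),
    s₁ ≠ s₂ ∧ ¬ G.Adj s₁ s₂ ∧
    G.IsMinimalCutSet {s₁, s₂} ∧ G.HasTwoComponents {s₁, s₂} A B ∧
    1 ≤ p ∧ G.InducesComplete A (2 * p) ∧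
    G.InducesComplete B (2 * q + 1) ∧
    G.neighborsIn B s₁ = B ∧ G.neighborsIn B s₂ = B ∧
    G.neighborsIn A s₁ ∪ G.neighborsIn A s₂ ⊂ A ∧
    G.neighborsIn A s₁ ∩ G.neighborsIn A s₂ = ∅

/-- The family `𝒢₂₃`: `S = {s₁, s₂}` is an independent minimal cut set, and `G \ S` has exactly two
components, the even one `A` and the odd one `B`. -/
def MemG23 (G : SimpleGraph V) : Prop :=
  ∃ (s₁ s₂ : V) (A B : Set V) (q : ℕ),
    s₁ ≠ s₂ ∧ ¬ G.Adj s₁ s₂ ∧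
    G.IsMinimalCutSet {s₁, s₂} ∧ G.HasTwoComponents {s₁, s₂} A B ∧
    G.InducesComplete A 2 ∧
    Nonempty (G.induce ({s₁, s₂} ∪ A) ≃g pathGraph 4) ∧
    1 ≤ q ∧ G.InducesComplete B (2 * q + 1) ∧
    G.neighborsIn B s₁ ∪ G.neighborsIn B s₂ = B

/-- The family `𝒢₃`: `S = {s₁, s₂, s₃}` is an independent minimal cut set, `G \ S` has exactly two
components `A` and `A'`, both odd cliques, and the neighbourhoods of the `sᵢ` are as stated. -/
def MemG3 (G : SimpleGraph V) : Prop :=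
  ∃ (s₁ s₂ s₃ : V) (A A' : Set V) (p q : ℕ),
    s₁ ≠ s₂ ∧ s₁ ≠ s₃ ∧ s₂ ≠ s₃ ∧
    ¬ G.Adj s₁ s₂ ∧ ¬ G.Adj s₁ s₃ ∧ ¬ G.Adj s₂ s₃ ∧
    G.IsMinimalCutSet {s₁, s₂, s₃} ∧ G.HasTwoComponents {s₁, s₂, s₃} A A' ∧
    G.InducesComplete A (2 * p + 1) ∧ G.InducesComplete A' (2 * q + 1) ∧
    ∃ a ∈ A, ∃ a' ∈ A',
      G.neighborSet s₁ = A ∪ {a'} ∧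
      G.neighborSet s₂ = A' ∪ {a} ∧
      G.neighborSet s₃ = (A ∪ A') \ {a, a'}

end SimpleGraph

/-!
The proof replaces equimatchability by a statement about matchings with independent complement. A
connected claw-free graph has a matching covering all vertices but at most one
(`ConnectedOn.matchable`), so it is equimatchable if and only if every maximal matching leaves at
most one vertex uncovered (`LeavesAtMostOne`). A set of vertices is called randomly matchable if
every maximal matching of the subgraph it induces is perfect, and a connected claw-free randomly
matchable set is a clique or a four-cycle (`RandomlyMatchable.isClique_or_isFourCycle`). For graphs
of even order this settles the matter. In a graph of odd order the tool is
`LeavesAtMostOne.randomlyMatchable`: if a matching covers everything except a set `R` and a vertex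
`v` without neighbours in `R`, then `R` is randomly matchable, hence, if connected, a clique or a
four-cycle.

Let the order be odd, and let there be three pairwise nonadjacent vertices. If there is a cut
vertex, then isolating suitable vertices shows that both sides are even and randomly matchable
(`memG1_of_separates`). Otherwise, a triple of pairwise nonadjacent vertices leaves at least two
odd components, since its complement has no perfect matching. If one vertex of the triple has no
neighbour in one of them, then the other two vertices form a cut set with an even component `A` and
an odd component `B` (`IsTwoCut`). If `B` has more than one vertex, then `A` is a clique, and the
graph is in `𝒢₂₂`. If `B` is a single vertex, then a common neighbour in `A` of the two vertices of
the cut leads to `𝒢₂₁`; if there is none, then `A` becomes randomly matchable when all edges between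
the two neighbourhoods are added, and the two outcomes for `A` lead to `𝒢₂₃` and to `C₇`
(`IsTwoCut.memG2`). If no such two-vertex cut exists, then every independent triple is a cut
set with two odd components, each touched by all three vertices. For a smallest component arising
in this way, minimality forces each of its vertices to be adjacent to exactly two vertices of the
triple, and the structure of `𝒢₃` follows (`IsTripleCut.memG3_of_minimal`).

For the converse, each family is claw-free because every neighbourhood is covered by two cliques.
A matching with independent complement that leaves three vertices uncovered would isolate a
covered vertex, or cover an odd set without edges to the rest of the covered vertices; neither is
possible.
-/

namespace SimpleGraph

set_option linter.unusedSectionVars false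

variable {V : Type*} [DecidableEq V] {G : SimpleGraph V} {X Y S T : Finset V}

/-- The vertex set `X` has a partition into pairs of adjacent vertices, that is, the subgraph
induced by `X` has a perfect matching. -/
inductive Matchable (G : SimpleGraph V) : Finset V → Prop
  | empty : Matchable G ∅
  | pair {X : Finset V} {u v : V} : u ∈ X → v ∈ X → G.Adj u v → Matchable G (X \ {u, v}) →
      Matchable G X

/-- `S` is a union of vertex sets of connected components of the subgraph induced by `X`. -/
def IsClosedPart (G : SimpleGraph V) (X S : Finset V) : Prop :=
  S ⊆ X ∧ ∀ a ∈ S, ∀ b ∈ X, G.Adj a b → b ∈ S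

/-- The subgraph induced by `X` is connected or empty: `X` has no proper nonempty part without
edges to the rest. -/
def ConnectedOn (G : SimpleGraph V) (X : Finset V) : Prop :=
  ∀ S, G.IsClosedPart X S → S.Nonempty → S = X

/-- The subgraph induced by `X` has no induced claw. -/
def ClawFreeOn (G : SimpleGraph V) (X : Finset V) : Prop :=
  ∀ x ∈ X, ∀ a ∈ X, ∀ b ∈ X, ∀ c ∈ X, G.Adj x a → G.Adj x b → G.Adj x c →
    a ≠ b → a ≠ c → b ≠ c → G.Adj a b ∨ G.Adj a c ∨ G.Adj b c

/-- Every maximal matching of the subgraph induced by `X` is perfect. -/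
def RandomlyMatchable (G : SimpleGraph V) (X : Finset V) : Prop :=
  ∀ F ⊆ X, G.Matchable F → (∀ x ∈ X \ F, ∀ y ∈ X \ F, ¬ G.Adj x y) → F = X

/-- Every maximal matching of `G` leaves at most one vertex uncovered. -/
def LeavesAtMostOne (G : SimpleGraph V) : Prop :=
  ∀ F, G.Matchable F → (∀ x ∉ F, ∀ y ∉ F, ¬ G.Adj x y) → ∀ x ∉ F, ∀ y ∉ F, x = y

/-- The set `X` induces a cycle on four vertices. -/
def IsFourCycle (G : SimpleGraph V) (X : Finset V) : Prop :=
  ∃ a b c d, X = {a, b, c, d} ∧ a ≠ c ∧ b ≠ d ∧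
    G.Adj a b ∧ G.Adj b c ∧ G.Adj c d ∧ G.Adj d a ∧ ¬ G.Adj a c ∧ ¬ G.Adj b d

lemma ClawFreeOn.mono (h : G.ClawFreeOn Y) (hXY : X ⊆ Y) : G.ClawFreeOn X :=
  fun x hx a ha b hb c hc ↦ h x (hXY hx) a (hXY ha) b (hXY hb) c (hXY hc)

/-! ### Matchable sets -/

lemma Matchable.even_card (h : G.Matchable X) : Even X.card := by
  induction h with
  | empty => simp
  | @pair X u v hu hv huv _ ih =>
    have h1 : ({u, v} : Finset V).card = 2 := Finset.card_pair huv.ne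
    have h2 : ({u, v} : Finset V) ⊆ X := by grind
    have h3 := Finset.card_sdiff_add_card_eq_card h2
    rw [← h3, h1]
    exact ih.add even_two

lemma Matchable.union (hX : G.Matchable X) (hY : G.Matchable Y) (hd : Disjoint X Y) :
    G.Matchable (X ∪ Y) := by
  induction hX with
  | empty => simpa using hY
  | @pair X u v hu hv huv _ ih =>
    rw [Finset.disjoint_left] at hd
    refine .pair (u := u) (v := v) (by grind) (by grind) huv ?_
    have : (X ∪ Y) \ {u, v} = (X \ {u, v}) ∪ Y := by
      ext w; have := @hd w; have := @hd u; have := @hd v; grind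
    rw [this]
    exact ih (by rw [Finset.disjoint_left]; grind)

/-- An edge and a disjoint matchable set together form a matchable set. -/
lemma Matchable.insert_edge {u v : V} (h : G.Matchable Y) (huv : G.Adj u v) (hu : u ∉ Y)
    (hv : v ∉ Y) : G.Matchable (insert u (insert v Y)) := by
  refine .pair (u := u) (v := v) (by simp) (by simp) huv ?_
  have : insert u (insert v Y) \ {u, v} = Y := by grind
  rwa [this]

lemma matchable_edge {u v : V} (huv : G.Adj u v) : G.Matchable {u, v} :=
  .pair (u := u) (v := v) (by simp) (by simp) huv (by simpa using Matchable.empty)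

lemma Matchable.exists_mate {x : V} (h : G.Matchable X) (hx : x ∈ X) :
    ∃ y ∈ X, G.Adj x y ∧ G.Matchable (X \ {x, y}) := by
  induction h with
  | empty => simp at hx
  | @pair X u v hu hv huv h ih =>
    by_cases hxu : x = u
    · subst hxu; exact ⟨v, hv, huv, h⟩
    by_cases hxv : x = v
    · subst hxv; exact ⟨u, hu, huv.symm, by rwa [Finset.pair_comm]⟩
    obtain ⟨y, hy, hxy, hm⟩ := ih (by grind)
    refine ⟨y, by grind, hxy, .pair (u := u) (v := v) (by grind) (by grind) huv ?_⟩
    have : (X \ {x, y}) \ {u, v} = (X \ {u, v}) \ {x, y} := by grind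
    rwa [this]

lemma Matchable.of_closedPart (h : G.Matchable X) (hS : G.IsClosedPart X S) :
    G.Matchable S := by
  induction h generalizing S with
  | empty => rw [Finset.subset_empty.mp hS.1]; exact .empty
  | @pair X u v hu hv huv h ih =>
    have h1 : G.IsClosedPart (X \ {u, v}) (S \ {u, v}) :=
      ⟨Finset.sdiff_subset_sdiff hS.1 le_rfl, fun a ha b hb hab ↦ by
        have := hS.2 a (by grind) b (by grind) hab
        grind⟩
    have h2 := ih h1
    by_cases huS : u ∈ S
    · exact .pair huS (hS.2 u huS v hv huv) huv h2
    · have hvS : v ∉ S := fun hvS ↦ huS (hS.2 v hvS u hu huv.symm)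
      have : S \ {u, v} = S := by grind
      rwa [this] at h2

/-- A maximal matching inside `X`. -/
lemma exists_matchable_subset (G : SimpleGraph V) (X : Finset V) :
    ∃ F ⊆ X, G.Matchable F ∧ ∀ x ∈ X \ F, ∀ y ∈ X \ F, ¬ G.Adj x y := by
  induction X using Finset.strongInduction with
  | H X ih =>
    by_cases h : ∃ x ∈ X, ∃ y ∈ X, G.Adj x y
    · obtain ⟨x, hx, y, hy, hxy⟩ := h
      obtain ⟨F, hF, hm, hI⟩ := ih (X \ {x, y}) (by
        rw [Finset.ssubset_iff_of_subset (by grind)]; exact ⟨x, hx, by grind⟩)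
      refine ⟨insert x (insert y F), by grind, hm.insert_edge hxy (by grind) (by grind), ?_⟩
      intro a ha b hb
      exact hI a (by grind) b (by grind)
    · push Not at h
      exact ⟨∅, by simp, .empty, by simpa using h⟩

/-! ### Connected vertex sets -/

lemma ConnectedOn.subset_of_closedPart {C : Finset V} (hT : G.ConnectedOn T) (hTX : T ⊆ X)
    (hC : G.IsClosedPart X C) {x : V} (hxT : x ∈ T) (hxC : x ∈ C) : T ⊆ C := by
  have := hT (T ∩ C) ⟨by grind, fun a ha b hb hab ↦ by
    have := hC.2 a (by grind) b (hTX hb) hab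
    grind⟩ ⟨x, by grind⟩
  grind

lemma connectedOn_singleton (x : V) : G.ConnectedOn {x} := by
  intro S hS hne
  rcases Finset.subset_singleton_iff.mp hS.1 with h | h
  · simp [h] at hne
  · exact h

/-- Two overlapping or adjacent connected sets have a connected union. -/
lemma ConnectedOn.union {x y : V} (hX : G.ConnectedOn X) (hY : G.ConnectedOn Y) (hx : x ∈ X)
    (hy : y ∈ Y) (hxy : x = y ∨ G.Adj x y) : G.ConnectedOn (X ∪ Y) := by
  intro S hS ⟨s, hs⟩
  have key : X ⊆ S ∧ Y ⊆ S := by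
    have hXS : ∀ z ∈ X, z ∈ S → X ⊆ S := fun z hz hzS ↦
      hX.subset_of_closedPart Finset.subset_union_left hS hz hzS
    have hYS : ∀ z ∈ Y, z ∈ S → Y ⊆ S := fun z hz hzS ↦
      hY.subset_of_closedPart Finset.subset_union_right hS hz hzS
    have hxyS : x ∈ S ↔ y ∈ S := by
      rcases hxy with rfl | hxy
      · rfl
      · exact ⟨fun h ↦ hS.2 x h y (by grind) hxy, fun h ↦ hS.2 y h x (by grind) hxy.symm⟩
    rcases Finset.mem_union.mp (hS.1 hs) with h | h
    · have h1 := hXS s h hs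
      exact ⟨h1, hYS y hy (hxyS.mp (h1 hx))⟩
    · have h1 := hYS s h hs
      exact ⟨hXS x hx (hxyS.mpr (h1 hy)), h1⟩
  exact Finset.Subset.antisymm hS.1 (Finset.union_subset key.1 key.2)

lemma ConnectedOn.insert_vertex {x y : V} (hX : G.ConnectedOn X) (hx : x ∈ X) (hxy : G.Adj y x) :
    G.ConnectedOn (insert y X) := by
  have := (connectedOn_singleton (G := G) y).union hX (Finset.mem_singleton_self y) hx (.inr hxy)
  rwa [← Finset.insert_eq] at this

lemma connectedOn_of_isClique (h : G.IsClique (X : Set V)) : G.ConnectedOn X := by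
  intro S hS ⟨s, hs⟩
  refine Finset.Subset.antisymm hS.1 fun x hx ↦ ?_
  by_cases hsx : s = x
  · exact hsx ▸ hs
  · exact hS.2 s hs x hx (h (hS.1 hs) hx hsx)

/-- In a connected set, every proper nonempty subset has an edge to the rest. -/
lemma ConnectedOn.exists_adj (hX : G.ConnectedOn X) (hS : S ⊆ X) {a b : V} (ha : a ∈ S)
    (hb : b ∈ X) (hbS : b ∉ S) : ∃ u ∈ S, ∃ w ∈ X, w ∉ S ∧ G.Adj u w := by
  by_contra! h
  have := hX S ⟨hS, fun u hu w hw huw ↦ by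
    by_contra hwS; exact h u hu w hw hwS huw⟩ ⟨a, ha⟩
  exact hbS (this ▸ hb)

lemma not_connectedOn_iff : ¬ G.ConnectedOn X ↔ ∃ C D : Finset V, C.Nonempty ∧ D.Nonempty ∧
    Disjoint C D ∧ C ∪ D = X ∧ (∀ c ∈ C, ∀ d ∈ D, ¬ G.Adj c d) := by
  constructor
  · intro h
    simp only [ConnectedOn, not_forall] at h
    obtain ⟨S, hS, hne, hSX⟩ := h
    refine ⟨S, X \ S, hne, ?_, Finset.disjoint_sdiff, ?_, ?_⟩
    · rw [Finset.sdiff_nonempty]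
      exact fun h ↦ hSX (Finset.Subset.antisymm hS.1 h)
    · exact Finset.union_sdiff_of_subset hS.1
    · intro c hc d hd hcd
      have := hS.2 c hc d (by grind) hcd
      grind
  · rintro ⟨C, D, ⟨c, hc⟩, ⟨d, hd⟩, hdis, rfl, hno⟩ h
    rw [Finset.disjoint_left] at hdis
    have := h C ⟨Finset.subset_union_left, fun a ha b hb hab ↦ by
      have := hno a ha b
      grind⟩ ⟨c, hc⟩
    exact hdis (this ▸ Finset.mem_union_right C hd) hd

/-- A connected set with a vertex `s` and at least one more vertex has a vertex other than `s`
that does not cut it. -/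
lemma ConnectedOn.exists_noncut {s t : V} (hX : G.ConnectedOn X) (hs : s ∈ X) (ht : t ∈ X)
    (hts : t ≠ s) : ∃ w ∈ X, w ≠ s ∧ G.ConnectedOn (X \ {w}) := by
  classical
  -- a largest proper connected subset containing `s` misses just one vertex
  obtain ⟨T, hT, hmax⟩ := Finset.exists_max_image
    (X.powerset.filter fun T ↦ s ∈ T ∧ T ≠ X ∧ G.ConnectedOn T) Finset.card
    ⟨{s}, by
      simp only [Finset.mem_filter, Finset.mem_powerset, Finset.singleton_subset_iff,
        Finset.mem_singleton, true_and]
      exact ⟨hs, by grind, connectedOn_singleton s⟩⟩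
  simp only [Finset.mem_filter, Finset.mem_powerset] at hT hmax
  obtain ⟨hTX, hsT, hTne, hTc⟩ := hT
  obtain ⟨b, hb, hbT⟩ : ∃ b ∈ X, b ∉ T := by
    by_contra! h
    exact hTne (Finset.Subset.antisymm hTX h)
  obtain ⟨u, hu, w, hw, hwT, huw⟩ := hX.exists_adj hTX hsT hb hbT
  have h1 : insert w T = X := by
    by_contra hne
    have := hmax (insert w T) ⟨by grind, by grind, hne, hTc.insert_vertex hu huw.symm⟩
    rw [Finset.card_insert_of_notMem hwT] at this
    omega
  refine ⟨w, hw, by grind, ?_⟩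
  have : X \ {w} = T := by rw [← h1]; grind
  rwa [this]

lemma ConnectedOn.exists_noncut' (hX : G.ConnectedOn X) (hne : X.Nonempty) :
    ∃ w ∈ X, G.ConnectedOn (X \ {w}) := by
  obtain ⟨s, hs⟩ := hne
  by_cases h : ∃ t ∈ X, t ≠ s
  · obtain ⟨t, ht, hts⟩ := h
    obtain ⟨w, hw, -, h⟩ := hX.exists_noncut hs ht hts
    exact ⟨w, hw, h⟩
  · push Not at h
    have : X \ {s} = ∅ := by grind
    exact ⟨s, hs, this ▸ fun S hS _ ↦ Finset.subset_empty.mp hS.1⟩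

lemma ConnectedOn.exists_adj_of_closedPart {C : Finset V} {y : V} (hY : G.ConnectedOn Y)
    (hy : y ∈ Y) (hC : G.IsClosedPart (Y \ {y}) C) (hne : C.Nonempty) : ∃ c ∈ C, G.Adj y c := by
  obtain ⟨c, hc⟩ := hne
  have h1 := hC.1
  obtain ⟨u, hu, w, hw, hwC, huw⟩ := hY.exists_adj (S := C) (by grind) hc hy (by grind)
  by_cases hwy : w = y
  · exact ⟨u, hu, hwy ▸ huw.symm⟩
  · exact absurd (hC.2 u hu w (by grind) huw) hwC

/-- Deleting a vertex of a connected claw-free graph leaves at most two components. -/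
lemma ConnectedOn.connectedOn_part {C D : Finset V} {y : V} (hY : G.ConnectedOn Y)
    (hcf : G.ClawFreeOn Y) (hy : y ∈ Y) (hCD : C ∪ D = Y \ {y}) (hdis : Disjoint C D)
    (hD : D.Nonempty) (hno : ∀ c ∈ C, ∀ d ∈ D, ¬ G.Adj c d) : G.ConnectedOn C := by
  by_contra h
  obtain ⟨C₁, C₂, h₁, h₂, hdis', rfl, hno'⟩ := not_connectedOn_iff.mp h
  rw [Finset.disjoint_left] at hdis hdis'
  have hmem : ∀ w, (w ∈ C₁ ∨ w ∈ C₂ ∨ w ∈ D) ↔ w ∈ Y ∧ w ≠ y := fun w ↦ by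
    simpa using Finset.ext_iff.mp hCD w
  obtain ⟨a, ha, hya⟩ := hY.exists_adj_of_closedPart (C := C₁) hy ⟨by grind, fun a ha b hb hab ↦ by
    have := hno a (by grind) b
    have := hno' a ha b
    grind⟩ h₁
  obtain ⟨b, hb, hyb⟩ := hY.exists_adj_of_closedPart (C := C₂) hy ⟨by grind, fun a ha b hb hab ↦ by
    have := hno a (by grind) b
    have := fun h ↦ hno' b h a ha hab.symm
    grind⟩ h₂
  obtain ⟨c, hc, hyc⟩ := hY.exists_adj_of_closedPart (C := D) hy ⟨by grind, fun a ha b hb hab ↦ by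
    have := fun h ↦ hno b h a ha hab.symm
    grind⟩ hD
  have := hcf y hy a (by grind) b (by grind) c (by grind) hya hyb hyc (by grind) (by grind)
    (by grind)
  have := hno' a ha b hb
  have := hno a (by grind) c hc
  have := hno b (by grind) c hc
  grind

lemma card_sdiff_pair {x y : V} (hx : x ∈ X) (hy : y ∈ X) (hxy : x ≠ y) :
    (X \ {x, y}).card + 2 = X.card := by
  have h1 : ({x, y} : Finset V).card = 2 := Finset.card_pair hxy
  have h2 : ({x, y} : Finset V) ⊆ X := by grind
  rw [← Finset.card_sdiff_add_card_eq_card h2, h1]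

lemma card_sdiff_single {x : V} (hx : x ∈ X) : (X \ {x}).card + 1 = X.card := by
  rw [Finset.sdiff_singleton_eq_erase, Finset.card_erase_add_one hx]

/-- A connected claw-free graph of even order has a perfect matching. Delete a vertex `x` that is
not a cut vertex, and a neighbour `y` of `x`. If two odd components `C₁` and `C₂` remain, then `x`
is adjacent to one of them, say `C₁`, because there is no claw at `y`, and `C₁ ∪ {x}`, `C₂ ∪ {y}`
are connected and even. -/
theorem ConnectedOn.matchable (hX : G.ConnectedOn X) (hcf : G.ClawFreeOn X)
    (hev : Even X.card) : G.Matchable X := by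
  induction X using Finset.strongInduction with
  | H X ih =>
    rcases X.eq_empty_or_nonempty with rfl | hne
    · exact .empty
    obtain ⟨x, hx, hxc⟩ := hX.exists_noncut' hne
    obtain ⟨t, ht, htx⟩ : ∃ t ∈ X, t ≠ x := by
      by_contra! h
      have : X = {x} := by grind
      rw [this] at hev
      simp at hev
    obtain ⟨u, hu, y, hy, hyx, hxy⟩ := hX.exists_adj (S := {x}) (by simpa) (a := x) (by simp) ht
      (by simpa)
    obtain rfl := Finset.mem_singleton.mp hu
    have hcard := card_sdiff_pair hx hy hxy.ne
    have hsub : X \ {u, y} ⊂ X := by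
      rw [Finset.ssubset_iff_of_subset (by grind)]; exact ⟨u, hx, by grind⟩
    have hev' : Even (X \ {u, y}).card := by grind
    by_cases hc : G.ConnectedOn (X \ {u, y})
    · exact .pair hx hy hxy (ih _ hsub hc (hcf.mono hsub.subset) hev')
    obtain ⟨C, D, hC, hD, hdis, hCD, hno⟩ := not_connectedOn_iff.mp hc
    have hdis' := Finset.disjoint_left.mp hdis
    have hmem : ∀ w, (w ∈ C ∨ w ∈ D) ↔ w ∈ X ∧ w ≠ u ∧ w ≠ y := fun w ↦ by
      simpa using Finset.ext_iff.mp hCD w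
    have hCD' : C ∪ D = (X \ {u}) \ {y} := by rw [hCD]; grind
    have hcf' : G.ClawFreeOn (X \ {u}) := hcf.mono Finset.sdiff_subset
    have hy' : y ∈ X \ {u} := by grind
    have hno' : ∀ d ∈ D, ∀ c ∈ C, ¬ G.Adj d c := fun d hd c hc h ↦ hno c hc d hd h.symm
    have hCc := hxc.connectedOn_part hcf' hy' hCD' hdis hD hno
    have hDc := hxc.connectedOn_part hcf' hy' (by rw [Finset.union_comm, hCD']) hdis.symm hC hno'
    obtain ⟨c, hcC, hyc⟩ := hxc.exists_adj_of_closedPart (C := C) hy' ⟨by grind,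
      fun a ha b hb hab ↦ by
        have := hno a ha b
        grind⟩ hC
    obtain ⟨d, hdD, hyd⟩ := hxc.exists_adj_of_closedPart (C := D) hy' ⟨by grind,
      fun a ha b hb hab ↦ by
        have := hno' a ha b
        grind⟩ hD
    have hcX : c ∈ X \ {u, y} := hCD ▸ Finset.mem_union_left _ hcC
    have hdX : d ∈ X \ {u, y} := hCD ▸ Finset.mem_union_right _ hdD
    have hCX : C ⊆ X \ {u, y} := by grind
    have hDX : D ⊆ X \ {u, y} := by grind
    have hXeq : X = insert u (insert y (C ∪ D)) := by
      ext w
      have := hmem w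
      simp only [Finset.mem_insert, Finset.mem_union]
      grind -ext only
    have hsum : C.card + D.card = (X \ {u, y}).card := by
      rw [← hCD, Finset.card_union_of_disjoint hdis]
    rcases Nat.even_or_odd C.card with hCe | hCo
    · have hDe : Even D.card := by grind
      have h1 := ih C (Finset.ssubset_of_subset_of_ssubset hCX hsub) hCc
        (hcf.mono (hCX.trans hsub.subset)) hCe
      have h2 := ih D (Finset.ssubset_of_subset_of_ssubset hDX hsub) hDc
        (hcf.mono (hDX.trans hsub.subset)) hDe
      exact .pair hx hy hxy (hCD ▸ h1.union h2 hdis)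
    have hDo : Odd D.card := by grind
    -- `u` and `y` are distributed over the two odd components
    have key : ∀ {a b c d : V} {C D : Finset V}, C ⊆ X \ {u, y} → D ⊆ X \ {u, y} → Disjoint C D →
        G.ConnectedOn C → G.ConnectedOn D → Odd C.card → Odd D.card → c ∈ C → d ∈ D →
        G.Adj a c → G.Adj b d → ({a, b} : Finset V) = {u, y} → a ≠ b →
        G.Matchable (insert a C ∪ insert b D) := by
      intro a b c d C D hCX hDX hdis hCc hDc hCo hDo hc hd hac hbd hab hne
      have hdis' := Finset.disjoint_left.mp hdis
      have ha : a = u ∨ a = y := by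
        have : a ∈ ({u, y} : Finset V) := hab ▸ (by simp)
        grind
      have hb : b = u ∨ b = y := by
        have : b ∈ ({u, y} : Finset V) := hab ▸ (by simp)
        grind
      have haC : a ∉ C := fun h ↦ by have := hCX h; grind
      have hbD : b ∉ D := fun h ↦ by have := hDX h; grind
      have haD : a ∉ D := fun h ↦ by have := hDX h; grind
      have hbC : b ∉ C := fun h ↦ by have := hCX h; grind
      refine Matchable.union (ih _ ?_ (hCc.insert_vertex hc hac) (hcf.mono (by grind)) ?_)
        (ih _ ?_ (hDc.insert_vertex hd hbd) (hcf.mono (by grind)) ?_) ?_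
      · rw [Finset.ssubset_iff_of_subset (by grind)]; exact ⟨b, by grind, by grind⟩
      · rw [Finset.card_insert_of_notMem haC]; exact hCo.add_one
      · rw [Finset.ssubset_iff_of_subset (by grind)]; exact ⟨a, by grind, by grind⟩
      · rw [Finset.card_insert_of_notMem hbD]; exact hDo.add_one
      · rw [Finset.disjoint_left]; grind
    have hclaw := hcf y hy u hx c (by grind) d (by grind) hxy.symm hyc hyd (by grind) (by grind)
      (by grind)
    rcases hclaw with h | h | h
    · have := key hCX hDX hdis hCc hDc hCo hDo hcC hdD h hyd rfl hxy.ne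
      convert this using 1
      rw [hXeq]; grind
    · have := key hCX hDX hdis hCc hDc hCo hDo hcC hdD hyc h (Finset.pair_comm _ _) hxy.ne'
      convert this using 1
      rw [hXeq]; grind
    · exact absurd h (hno c hcC d hdD)

/-- A claw-free set without perfect matching has an odd component. -/
lemma exists_odd_part (hcf : G.ClawFreeOn X) (hX : ¬ G.Matchable X) :
    ∃ C, G.IsClosedPart X C ∧ G.ConnectedOn C ∧ Odd C.card := by
  induction X using Finset.strongInduction with
  | H X ih =>
    by_cases hc : G.ConnectedOn X
    · refine ⟨X, ⟨le_rfl, fun a _ b hb _ ↦ hb⟩, hc, ?_⟩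
      rw [← Nat.not_even_iff_odd]
      exact fun h ↦ hX (hc.matchable hcf h)
    obtain ⟨C, D, ⟨c, hC⟩, ⟨d, hD⟩, hdis, rfl, hno⟩ := not_connectedOn_iff.mp hc
    have hdis' := Finset.disjoint_left.mp hdis
    have h : ¬ G.Matchable C ∨ ¬ G.Matchable D := by
      by_contra! h
      exact hX (h.1.union h.2 hdis)
    rcases h with h | h
    · obtain ⟨E, hE, hEc, hEo⟩ := ih C (by
        rw [Finset.ssubset_iff_of_subset (by grind)]; exact ⟨d, by grind, by grind⟩)
        (hcf.mono (by grind)) h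
      refine ⟨E, ⟨by have := hE.1; grind, fun a ha b hb hab ↦ ?_⟩, hEc, hEo⟩
      have := hno a (hE.1 ha) b
      exact hE.2 a ha b (by grind) hab
    · obtain ⟨E, hE, hEc, hEo⟩ := ih D (by
        rw [Finset.ssubset_iff_of_subset (by grind)]; exact ⟨c, by grind, by grind⟩)
        (hcf.mono (by grind)) h
      refine ⟨E, ⟨by have := hE.1; grind, fun a ha b hb hab ↦ ?_⟩, hEc, hEo⟩
      have := fun h ↦ hno b h a (hE.1 ha) hab.symm
      exact hE.2 a ha b (by grind) hab

lemma matchable_of_isClique (h : G.IsClique (X : Set V)) (hev : Even X.card) :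
    G.Matchable X := by
  refine (connectedOn_of_isClique h).matchable ?_ hev
  intro x _ a ha b hb c _ _ _ _ hab _ _
  exact .inl (h ha hb hab)

/-! ### Randomly matchable sets -/

lemma RandomlyMatchable.matchable (h : G.RandomlyMatchable X) : G.Matchable X := by
  obtain ⟨F, hF, hm, hI⟩ := exists_matchable_subset G X
  exact h F hF hm hI ▸ hm

lemma RandomlyMatchable.sdiff (h : G.RandomlyMatchable X) (hY : Y ⊆ X) (hm : G.Matchable Y) :
    G.RandomlyMatchable (X \ Y) := by
  intro F hF hFm hI
  have h1 := h (F ∪ Y) (by grind) (hFm.union hm (by rw [Finset.disjoint_left]; grind))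
    (fun x hx y hy ↦ hI x (by grind) y (by grind))
  rw [← h1]
  ext v
  have := @hF v
  grind

lemma RandomlyMatchable.sdiff_edge {u v : V} (h : G.RandomlyMatchable X) (hu : u ∈ X)
    (hv : v ∈ X) (huv : G.Adj u v) : G.RandomlyMatchable (X \ {u, v}) :=
  h.sdiff (by grind) (matchable_edge huv)

/-- In a randomly matchable set, a matching that leaves two vertices uncovered leaves two adjacent
vertices. -/
lemma RandomlyMatchable.adj {p q : V} (h : G.RandomlyMatchable X) (hp : p ∈ X) (hq : q ∈ X)
    (hpq : p ≠ q) (hm : G.Matchable (X \ {p, q})) : G.Adj p q := by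
  by_contra hn
  have := h _ Finset.sdiff_subset hm (fun x hx y hy hxy ↦ by
    have hx : x = p ∨ x = q := by grind
    have hy : y = p ∨ y = q := by grind
    rcases hx with rfl | rfl <;> rcases hy with rfl | rfl
    · exact hxy.ne rfl
    · exact hn hxy
    · exact hn hxy.symm
    · exact hxy.ne rfl)
  have : p ∈ X \ {p, q} := by rw [this]; exact hp
  simp at this

/-- Let `xy` be an edge of the randomly matchable set `X`, let `ya` be an edge, and suppose that the
rest of `X` apart from `a'` is matchable. Then `x` and `a'` are adjacent. -/
lemma RandomlyMatchable.adj_of_path {x y a a' : V} (h : G.RandomlyMatchable X) (hx : x ∈ X)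
    (hy : y ∈ X) (hxy : x ≠ y) (ha : a ∈ X \ {x, y}) (ha' : a' ∈ X \ {x, y}) (haa' : a ≠ a')
    (hm : G.Matchable ((X \ {x, y}) \ {a, a'})) (hya : G.Adj y a) : G.Adj x a' := by
  simp only [Finset.mem_sdiff, Finset.mem_insert, Finset.mem_singleton] at ha ha'
  refine h.adj hx ha'.1 (by grind only) (.pair (u := y) (v := a) ?_ ?_ hya ?_)
  · simp; grind only
  · simp; grind only
  · have : (X \ {x, a'}) \ {y, a} = (X \ {x, y}) \ {a, a'} := by
      ext w
      simp only [Finset.mem_sdiff, Finset.mem_insert, Finset.mem_singleton]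
      tauto
    rwa [this]

/-- After deleting the ends of an edge `xy`, where `x` is not a cut vertex, a connected randomly
matchable claw-free set stays connected. -/
lemma RandomlyMatchable.connectedOn_sdiff {x y : V} (h : G.RandomlyMatchable X)
    (hcf : G.ClawFreeOn X) (hx : x ∈ X) (hy : y ∈ X) (hxy : G.Adj x y)
    (hc : G.ConnectedOn (X \ {x})) : G.ConnectedOn (X \ {x, y}) := by
  by_contra hn
  obtain ⟨C, D, hC, hD, hdis, hCD, hno⟩ := not_connectedOn_iff.mp hn
  have hm := (h.sdiff_edge hx hy hxy).matchable
  rw [Finset.disjoint_left] at hdis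
  have hmem : ∀ w, (w ∈ C ∨ w ∈ D) ↔ w ∈ X ∧ w ≠ x ∧ w ≠ y := fun w ↦ by
    simpa using Finset.ext_iff.mp hCD w
  clear hCD
  -- a matching containing two edges `uc` and `vd` can be completed leaving two vertices, one in
  -- each part
  have key : ∀ {u v c d : V} {C D : Finset V}, C ⊆ X → D ⊆ X → (∀ w ∈ C, w ∉ D) →
      (∀ c ∈ C, ∀ d ∈ D, ¬ G.Adj c d) → (∀ w, w ∈ C ∨ w ∈ D ↔ w ∈ X ∧ w ≠ u ∧ w ≠ v) → u ∈ X →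
      v ∈ X → u ≠ v → G.Matchable C → G.Matchable D → c ∈ C → d ∈ D → G.Adj u c → G.Adj v d →
      False := by
    intro u v c d C D hCX hDX hdis hno hmem hu hv huv hC hD hc hd huc hvd
    obtain ⟨p, hp, hcp, hCp⟩ := hC.exists_mate hc
    obtain ⟨q, hq, hdq, hDq⟩ := hD.exists_mate hd
    refine hno p hp q hq (h.adj (hCX hp) (hDX hq) (fun hpq ↦ hdis p hp (hpq ▸ hq)) ?_)
    have hcp := hcp.ne
    have hdq := hdq.ne
    have huC := hmem u
    have hvC := hmem v
    have hcD := hdis c hc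
    have hpD := hdis p hp
    have hdC := fun h ↦ hdis d h hd
    have hqC := fun h ↦ hdis q h hq
    have h1 : G.Matchable ((C \ {c, p}) ∪ (D \ {d, q})) :=
      hCp.union hDq (by rw [Finset.disjoint_left]; grind only [= Finset.mem_sdiff])
    have h2 := (h1.insert_edge huc (by simp; grind only) (by simp; grind only)).insert_edge hvd
      (by simp; grind only) (by simp; grind only)
    convert h2 using 1
    ext w
    have h3 := hmem w
    have h4 := hdis w
    simp only [Finset.mem_sdiff, Finset.mem_insert, Finset.mem_singleton, Finset.mem_union]
    grind only
  have hy' : y ∈ X \ {x} := by grind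
  have hCX : C ⊆ X := fun w hw ↦ ((hmem w).mp (.inl hw)).1
  have hDX : D ⊆ X := fun w hw ↦ ((hmem w).mp (.inr hw)).1
  have hpC : G.IsClosedPart (X \ {x, y}) C := ⟨fun w hw ↦ by
      have := hmem w
      simp only [Finset.mem_sdiff, Finset.mem_insert, Finset.mem_singleton]
      grind only, fun a ha b hb hab ↦ by
      have := hno a ha b
      have := hmem b
      simp only [Finset.mem_sdiff, Finset.mem_insert, Finset.mem_singleton] at hb
      grind only⟩
  have hpD : G.IsClosedPart (X \ {x, y}) D := ⟨fun w hw ↦ by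
      have := hmem w
      simp only [Finset.mem_sdiff, Finset.mem_insert, Finset.mem_singleton]
      grind only, fun a ha b hb hab ↦ by
      have := fun h ↦ hno b h a ha hab.symm
      have := hmem b
      simp only [Finset.mem_sdiff, Finset.mem_insert, Finset.mem_singleton] at hb
      grind only⟩
  have hsd : (X \ {x}) \ {y} = X \ {x, y} := by ext w; simp; tauto
  obtain ⟨c, hcC, hyc⟩ := hc.exists_adj_of_closedPart hy' (hsd ▸ hpC) hC
  obtain ⟨d, hdD, hyd⟩ := hc.exists_adj_of_closedPart hy' (hsd ▸ hpD) hD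
  have hclaw := hcf y hy x hx c (hCX hcC) d (hDX hdD) hxy.symm hyc hyd
    ((hmem c).mp (.inl hcC)).2.1.symm ((hmem d).mp (.inr hdD)).2.1.symm
    (fun h ↦ hdis hcC (h ▸ hdD))
  have hCm := hm.of_closedPart hpC
  have hDm := hm.of_closedPart hpD
  rcases hclaw with h | h | h
  · exact key hCX hDX (fun w hw ↦ hdis hw) hno hmem hx hy hxy.ne hCm hDm hcC hdD h hyd
  · exact key hDX hCX (fun w hw hw' ↦ hdis hw' hw) (fun d hd c hc h ↦ hno c hc d hd h.symm)
      (fun w ↦ by rw [or_comm, hmem]) hx hy hxy.ne hDm hCm hdD hcC h hyc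
  · exact hno c hcC d hdD h

/-- Sumner's theorem for claw-free graphs: a connected claw-free graph in which every maximal
matching is perfect is a complete graph or a cycle on four vertices. -/
theorem RandomlyMatchable.isClique_or_isFourCycle (h : G.RandomlyMatchable X)
    (hX : G.ConnectedOn X) (hcf : G.ClawFreeOn X) :
    G.IsClique (X : Set V) ∨ G.IsFourCycle X := by
  induction X using Finset.strongInduction with
  | H X ih =>
    rcases X.eq_empty_or_nonempty with rfl | hne
    · left; simp
    obtain ⟨x, hx, hxc⟩ := hX.exists_noncut' hne
    obtain ⟨y, hy, hxy, -⟩ := h.matchable.exists_mate hx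
    have hsub : X \ {x, y} ⊂ X := by
      rw [Finset.ssubset_iff_of_subset Finset.sdiff_subset]; exact ⟨x, hx, by simp⟩
    have hYc := h.connectedOn_sdiff hcf hx hy hxy hxc
    have hYr := h.sdiff_edge hx hy hxy
    have hYm := hYr.matchable
    have hmem : ∀ w, w ∈ X \ {x, y} ↔ w ∈ X ∧ w ≠ x ∧ w ≠ y := fun w ↦ by simp
    have hyx : X \ {y, x} = X \ {x, y} := by rw [Finset.pair_comm]
    rcases (X \ {x, y}).eq_empty_or_nonempty with hY | hY
    · left
      intro u hu v hv huv
      have h1 := hmem u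
      have h2 := hmem v
      simp only [hY, Finset.notMem_empty, false_iff] at h1 h2
      have h3 := hxy.symm
      simp only [Finset.mem_coe] at hu hv
      grind only
    obtain ⟨a, ha, hya⟩ : ∃ a ∈ X \ {x, y}, G.Adj y a := by
      refine hxc.exists_adj_of_closedPart (by simp [hy, hxy.ne']) ?_ hY
      have hsd : (X \ {x}) \ {y} = X \ {x, y} := by ext w; simp; tauto
      rw [hsd]
      exact ⟨le_rfl, fun a _ b hb _ ↦ hb⟩
    have key₁ : ∀ {b c}, b ∈ X \ {x, y} → c ∈ X \ {x, y} → b ≠ c →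
        G.Matchable ((X \ {x, y}) \ {b, c}) → G.Adj y b → G.Adj x c := fun hb hc hbc hm ↦
      h.adj_of_path hx hy hxy.ne hb hc hbc hm
    have key₂ : ∀ {b c}, b ∈ X \ {x, y} → c ∈ X \ {x, y} → b ≠ c →
        G.Matchable ((X \ {x, y}) \ {b, c}) → G.Adj x b → G.Adj y c := fun hb hc hbc hm ↦
      h.adj_of_path hy hx hxy.ne' (hyx ▸ hb) (hyx ▸ hc) hbc (hyx ▸ hm)
    rcases ih _ hsub hYr hYc (hcf.mono hsub.subset) with hcl | hfc
    · have hpair : ∀ {b c}, b ∈ X \ {x, y} → c ∈ X \ {x, y} → b ≠ c →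
          G.Matchable ((X \ {x, y}) \ {b, c}) := fun {b c} hb hc hbc ↦ by
        have h1 := card_sdiff_pair hb hc hbc
        have h2 := hYm.even_card
        refine matchable_of_isClique (hcl.subset (by simp)) ?_
        rw [← h1, Nat.even_add] at h2
        exact h2.mpr even_two
      have hclique : (∀ w ∈ X \ {x, y}, G.Adj x w ∧ G.Adj y w) → G.IsClique (X : Set V) := by
        intro hall u hu v hv huv
        have h1 := hmem u
        have h2 := hmem v
        simp only [Finset.mem_coe] at hu hv
        by_cases hu' : u ∈ X \ {x, y} <;> by_cases hv' : v ∈ X \ {x, y}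
        · exact hcl hu' hv' huv
        · have := hall u hu'
          have : v = x ∨ v = y := by grind only
          rcases this with rfl | rfl
          · exact (hall u hu').1.symm
          · exact (hall u hu').2.symm
        · have : u = x ∨ u = y := by grind only
          rcases this with rfl | rfl
          · exact (hall v hv').1
          · exact (hall v hv').2
        · have h3 := hxy.symm
          grind only
      obtain ⟨a', ha', haa', -⟩ := hYm.exists_mate ha
      have haa := haa'.ne
      have hxa' := key₁ ha ha' haa (hpair ha ha' haa) hya
      by_cases h3 : ∃ c ∈ X \ {x, y}, c ≠ a ∧ c ≠ a'
      · left
        obtain ⟨c, hc, hca, hca'⟩ := h3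
        have hxc' := key₁ ha hc hca.symm (hpair ha hc hca.symm) hya
        have hya' := key₂ hc ha' hca' (hpair hc ha' hca') hxc'
        refine hclique fun w hw ↦ ⟨?_, ?_⟩
        · by_cases hwa : w = a
          · subst hwa
            exact key₁ ha' hw haa.symm (hpair ha' hw haa.symm) hya'
          · exact key₁ ha hw (Ne.symm hwa) (hpair ha hw (Ne.symm hwa)) hya
        · by_cases hwa : w = a'
          · exact hwa ▸ hya'
          · exact key₂ ha' hw (Ne.symm hwa) (hpair ha' hw (Ne.symm hwa)) hxa'
      · push Not at h3
        by_cases hxa : G.Adj x a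
        · left
          have hya' := key₂ ha ha' haa (hpair ha ha' haa) hxa
          refine hclique fun w hw ↦ ?_
          by_cases hwa : w = a
          · subst hwa; exact ⟨hxa, hya⟩
          · obtain rfl := h3 w hw hwa; exact ⟨hxa', hya'⟩
        · right
          have h1 := (hmem a).mp ha
          have h2 := (hmem a').mp ha'
          refine ⟨x, a', a, y, ?_, h1.2.1.symm, h2.2.2, hxa', haa'.symm, hya.symm, hxy.symm, hxa,
            fun h ↦ hxa (key₁ ha' ha haa.symm (hpair ha' ha haa.symm) h.symm)⟩
          ext w
          have h4 := hmem w
          have h5 := h3 w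
          simp only [Finset.mem_insert, Finset.mem_singleton]
          grind only
    · -- four vertices of a cycle cannot be extended
      exfalso
      have key : ∀ {a b c d}, X \ {x, y} = {a, b, c, d} → a ≠ c → b ≠ d → G.Adj a b → G.Adj b c →
          G.Adj c d → G.Adj d a → ¬ G.Adj a c → ¬ G.Adj b d → ¬ G.Adj y a := by
        intro a b c d hY hac hbd hab hbc hcd hda hnac hnbd hya
        have hm : ∀ w, (w = a ∨ w = b ∨ w = c ∨ w = d) ↔ w ∈ X ∧ w ≠ x ∧ w ≠ y := fun w ↦ by
          rw [← hmem w, hY]; simp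
        have hXa := (hm a).mp (by simp)
        have hXb := (hm b).mp (by simp)
        have hXc := (hm c).mp (by simp)
        have hXd := (hm d).mp (by simp)
        have n1 := hab.ne
        have n2 := hbc.ne
        have n3 := hcd.ne
        have n4 := hda.ne
        have n5 := hxy.ne
        have hxb : G.Adj x b := by
          refine key₁ ((hmem a).mpr hXa) ((hmem b).mpr hXb) n1 ?_ hya
          convert matchable_edge hcd using 1
          rw [hY]; ext w; simp only [Finset.mem_sdiff, Finset.mem_insert, Finset.mem_singleton]
          grind only
        have hxd : G.Adj x d := by
          refine key₁ ((hmem a).mpr hXa) ((hmem d).mpr hXd) n4.symm ?_ hya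
          convert matchable_edge hbc using 1
          rw [hY]; ext w; simp only [Finset.mem_sdiff, Finset.mem_insert, Finset.mem_singleton]
          grind only
        have hclaw := hcf a hXa.1 y hy b hXb.1 d hXd.1 hya.symm hab hda.symm hXb.2.2.symm
          hXd.2.2.symm hbd
        refine hnac (h.adj hXa.1 hXc.1 hac ?_)
        rcases hclaw with h1 | h1 | h1
        · convert (matchable_edge hxd).insert_edge h1 (by simp; grind only)
            (by simp; grind only) using 1
          ext w
          have := hm w
          simp only [Finset.mem_sdiff, Finset.mem_insert, Finset.mem_singleton]
          grind only
        · convert (matchable_edge hxb).insert_edge h1 (by simp; grind only)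
            (by simp; grind only) using 1
          ext w
          have := hm w
          simp only [Finset.mem_sdiff, Finset.mem_insert, Finset.mem_singleton]
          grind only
        · exact absurd h1 hnbd
      obtain ⟨p, q, r, s, hY, hpr, hqs, hpq, hqr, hrs, hsp, hnpr, hnqs⟩ := hfc
      have ha' : a = p ∨ a = q ∨ a = r ∨ a = s := by rw [hY] at ha; simpa using ha
      rcases ha' with rfl | rfl | rfl | rfl
      · exact key hY hpr hqs hpq hqr hrs hsp hnpr hnqs hya
      · exact key (by rw [hY]; ext w; simp; tauto) hqs hpr.symm hqr hrs hsp hpq hnqs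
          (fun h ↦ hnpr h.symm) hya
      · exact key (by rw [hY]; ext w; simp; tauto) hpr.symm hqs.symm hrs hsp hpq hqr
          (fun h ↦ hnpr h.symm) (fun h ↦ hnqs h.symm) hya
      · exact key (by rw [hY]; ext w; simp; tauto) hqs.symm hpr hsp hpq hqr hrs
          (fun h ↦ hnqs h.symm) hnpr hya

/-! ### Comparison with subgraph matchings, connected and claw-free graphs -/

lemma connectedOn_iff_preconnected :
    G.ConnectedOn X ↔ (G.induce (X : Set V)).Preconnected := by
  classical
  constructor
  · intro h u v
    have h1 := h (X.filter fun w ↦ ∃ hw : w ∈ (X : Set V),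
      (G.induce (X : Set V)).Reachable u ⟨w, hw⟩)
      ⟨Finset.filter_subset _ _, fun a ha b hb hab ↦ by
        simp only [Finset.mem_filter] at ha ⊢
        obtain ⟨_, hw, hr⟩ := ha
        refine ⟨hb, hb, hr.trans (Adj.reachable ?_)⟩
        simpa using hab⟩ ⟨u, by
          simp only [Finset.mem_filter]
          exact ⟨u.2, u.2, Reachable.refl _⟩⟩
    have h2 := (Finset.ext_iff.mp h1 v).mpr v.2
    exact (Finset.mem_filter.mp h2).2.choose_spec
  · rintro h S hS ⟨s, hs⟩
    refine Finset.Subset.antisymm hS.1 fun x hx ↦ ?_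
    obtain ⟨p⟩ := h ⟨s, hS.1 hs⟩ ⟨x, hx⟩
    have key : ∀ {u v : (X : Set V)}, (G.induce (X : Set V)).Walk u v → (u : V) ∈ S →
        (v : V) ∈ S := by
      intro u v p
      induction p with
      | nil => exact id
      | cons h p ih => exact fun hu ↦ ih (hS.2 _ hu _ (Subtype.prop _) (by simpa using h))
    exact key p hs

lemma connected_iff_connectedOn_univ [Fintype V] :
    G.Connected ↔ G.ConnectedOn Finset.univ ∧ Nonempty V := by
  rw [connectedOn_iff_preconnected, Finset.coe_univ, connected_iff]
  have h := (induceUnivIso G).preconnected_iff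
  rw [h]

lemma isClawFree_iff [Fintype V] : G.IsClawFree ↔ G.ClawFreeOn Finset.univ := by
  constructor
  · intro h x _ a _ b _ c _ hxa hxb hxc hab hac hbc
    by_contra! hn
    obtain ⟨h1, h2, h3⟩ := hn
    have h1' := fun h ↦ h1 (Adj.symm h)
    have h2' := fun h ↦ h2 (Adj.symm h)
    have h3' := fun h ↦ h3 (Adj.symm h)
    have e1 := hxa.ne
    have e2 := hxb.ne
    have e3 := hxc.ne
    refine h ⟨⟨⟨Sum.elim (fun _ ↦ x) ![a, b, c], ?_⟩, ?_⟩⟩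
    · rintro (i | i) (j | j) hij
      · congr 1; exact Subsingleton.elim _ _
      · fin_cases j <;> simp_all
      · fin_cases i <;> simp_all
      · fin_cases i <;> fin_cases j <;> simp_all
    · intro i j
      change G.Adj (Sum.elim (fun _ ↦ x) ![a, b, c] i) (Sum.elim (fun _ ↦ x) ![a, b, c] j) ↔ _
      rcases i with i | i <;> rcases j with j | j
      · simp
      · fin_cases j <;> simpa
      · fin_cases i <;> simpa [adj_comm]
      · fin_cases i <;> fin_cases j <;> simp <;> assumption
  · rintro h ⟨f⟩
    have hadj : ∀ i, G.Adj (f (.inl 0)) (f (.inr i)) := fun i ↦ f.map_adj_iff.mpr (by simp)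
    have hne : ∀ i j, i ≠ j → f (.inr i) ≠ f (.inr j) := fun i j hij h ↦
      hij (Sum.inr_injective (f.injective h))
    have hno : ∀ i j, ¬ G.Adj (f (.inr i)) (f (.inr j)) := fun i j h ↦ by
      have := f.map_adj_iff.mp h
      simp at this
    have := h _ (Finset.mem_univ _) _ (Finset.mem_univ _) _ (Finset.mem_univ _) _
      (Finset.mem_univ _) (hadj 0) (hadj 1) (hadj 2) (hne 0 1 (by decide)) (hne 0 2 (by decide))
      (hne 1 2 (by decide))
    simp [hno] at this

lemma Subgraph.IsMatching.two_mul_ncard_edgeSet [Finite V] {M : G.Subgraph} (hM : M.IsMatching) :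
    2 * M.edgeSet.ncard = M.verts.ncard := by
  classical
  have := Fintype.ofFinite V
  have h := M.spanningCoe.sum_degrees_eq_twice_card_edges
  have h1 : M.spanningCoe.edgeFinset.card = M.edgeSet.ncard := by
    rw [← Subgraph.edgeSet_spanningCoe, Set.ncard_eq_toFinset_card', Set.toFinset_card,
      edgeFinset, Set.toFinset_card]
  have h2 : ∀ v, M.spanningCoe.degree v = if v ∈ M.verts then 1 else 0 := by
    intro v
    split_ifs with hv
    · obtain ⟨w, hw, huniq⟩ := hM hv
      rw [← card_neighborFinset_eq_degree, Finset.card_eq_one]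
      refine ⟨w, ?_⟩
      ext u
      simp only [mem_neighborFinset, Subgraph.spanningCoe_adj, Finset.mem_singleton]
      exact ⟨fun h ↦ huniq u h, fun h ↦ h ▸ hw⟩
    · rw [← card_neighborFinset_eq_degree, Finset.card_eq_zero]
      ext u
      simp only [mem_neighborFinset, Subgraph.spanningCoe_adj, Finset.notMem_empty, iff_false]
      exact fun h ↦ hv h.fst_mem
  rw [← h1, ← h, Finset.sum_congr rfl fun v _ ↦ h2 v, Finset.sum_boole, Nat.cast_id,
    Set.ncard_eq_toFinset_card']
  congr 1
  ext v
  simp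

lemma Subgraph.IsMatching.matchable {M : G.Subgraph} (hM : M.IsMatching)
    (hX : ∀ v ∈ X, v ∈ M.verts) (hcl : ∀ v ∈ X, ∀ w, M.Adj v w → w ∈ X) : G.Matchable X := by
  induction X using Finset.strongInduction with
  | H X ih =>
    rcases X.eq_empty_or_nonempty with rfl | ⟨v, hv⟩
    · exact .empty
    obtain ⟨w, hw, -⟩ := hM (hX v hv)
    refine .pair hv (hcl v hv w hw) hw.adj_sub (ih _ ?_ (fun u hu ↦ hX u ?_) fun u hu t hut ↦ ?_)
    · rw [Finset.ssubset_iff_of_subset Finset.sdiff_subset]; exact ⟨v, hv, by simp⟩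
    · simp only [Finset.mem_sdiff] at hu
      exact hu.1
    · simp only [Finset.mem_sdiff, Finset.mem_insert, Finset.mem_singleton, not_or] at hu ⊢
      refine ⟨hcl u hu.1 t hut, ?_, ?_⟩
      · rintro rfl
        exact hu.2.2 (hM.eq_of_adj_left hut.symm hw)
      · rintro rfl
        exact hu.2.1 (hM.eq_of_adj_right hut hw)

lemma Matchable.exists_isMatching (h : G.Matchable X) :
    ∃ M : G.Subgraph, M.IsMatching ∧ M.verts = X := by
  induction h with
  | empty => exact ⟨⊥, by simp [Subgraph.IsMatching], by simp⟩
  | @pair X u v hu hv huv h ih =>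
    obtain ⟨M, hM, hMX⟩ := ih
    refine ⟨M ⊔ G.subgraphOfAdj huv, hM.sup (.subgraphOfAdj huv) ?_, ?_⟩
    · rw [hM.support_eq_verts, (Subgraph.IsMatching.subgraphOfAdj huv).support_eq_verts, hMX,
        Set.disjoint_left]
      intro w hw
      simp at hw ⊢
      tauto
    · rw [Subgraph.verts_sup, hMX, subgraphOfAdj_verts]
      ext w
      simp only [Finset.coe_sdiff, Set.mem_union, Set.mem_sdiff, Finset.mem_coe, Finset.mem_insert,
        Finset.mem_singleton, Set.mem_insert_iff, Set.mem_singleton_iff]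
      constructor
      · rintro (⟨h, -⟩ | rfl | rfl) <;> assumption
      · tauto

lemma Subgraph.maximal_isMatching_iff {M : G.Subgraph} :
    Maximal Subgraph.IsMatching M ↔
      M.IsMatching ∧ ∀ x ∉ M.verts, ∀ y ∉ M.verts, ¬ G.Adj x y := by
  constructor
  · intro h
    refine ⟨h.prop, fun x hx y hy hxy ↦ ?_⟩
    have h1 : (M ⊔ G.subgraphOfAdj hxy).IsMatching := by
      refine h.prop.sup (.subgraphOfAdj hxy) ?_
      rw [h.prop.support_eq_verts, (Subgraph.IsMatching.subgraphOfAdj hxy).support_eq_verts,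
        Set.disjoint_left]
      rintro w hw (rfl | rfl)
      · exact hx hw
      · exact hy hw
    have h2 := h.le_of_ge h1 le_sup_left
    exact hx (h2.1 (by simp))
  · rintro ⟨hM, hI⟩
    refine ⟨hM, fun N hN hMN ↦ ?_⟩
    have key : ∀ {u w}, N.Adj u w → u ∈ M.verts → M.Adj u w := by
      intro u w huw hu
      obtain ⟨t, ht, -⟩ := hM hu
      exact hN.eq_of_adj_left (hMN.2 ht) huw ▸ ht
    have key' : ∀ {u w}, N.Adj u w → M.Adj u w := by
      intro u w huw
      by_cases hu : u ∈ M.verts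
      · exact key huw hu
      · by_cases hw : w ∈ M.verts
        · exact (key huw.symm hw).symm
        · exact absurd huw.adj_sub (hI u hu w hw)
    refine ⟨fun u hu ↦ ?_, fun u w huw ↦ key' huw⟩
    obtain ⟨w, hw, -⟩ := hN hu
    exact (key' hw).fst_mem

lemma LeavesAtMostOne.isEquimatchable [Fintype V] (h : G.LeavesAtMostOne) :
    G.IsEquimatchable := by
  classical
  have key : ∀ M : G.Subgraph, Maximal Subgraph.IsMatching M →
      M.edgeSet.ncard = Fintype.card V / 2 := by
    intro M hM
    obtain ⟨hM, hI⟩ := Subgraph.maximal_isMatching_iff.mp hM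
    have h1 := h M.verts.toFinset (hM.matchable (by simp) fun v _ w hvw ↦ by
      simpa using hvw.snd_mem)
      (by simpa using hI)
    have h2 : (M.verts.toFinsetᶜ).card ≤ 1 := by
      rw [Finset.card_le_one]
      intro a ha b hb
      exact h1 a (by simpa using ha) b (by simpa using hb)
    have h3 := hM.two_mul_ncard_edgeSet
    rw [Set.ncard_eq_toFinset_card' M.verts] at h3
    rw [Finset.card_compl] at h2
    have h4 := Finset.card_le_univ M.verts.toFinset
    omega
  intro M N hM hN
  rw [key M hM, key N hN]

/-- A connected claw-free graph has a matching that leaves at most one vertex uncovered, so if it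
is equimatchable, then all maximal matchings have this property. -/
lemma IsEquimatchable.leavesAtMostOne [Fintype V] (h : G.IsEquimatchable)
    (hc : G.ConnectedOn Finset.univ) (hcf : G.ClawFreeOn Finset.univ) : G.LeavesAtMostOne := by
  classical
  obtain ⟨Y, hYm, hYI⟩ : ∃ Y, G.Matchable Y ∧ ∀ x ∉ Y, ∀ y ∉ Y, x = y := by
    by_cases hev : Even (Finset.univ : Finset V).card
    · exact ⟨_, hc.matchable hcf hev, by simp⟩
    · have hne : (Finset.univ : Finset V).Nonempty := by
        rw [Finset.nonempty_iff_ne_empty]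
        intro h
        simp [h] at hev
      obtain ⟨w, hw, hwc⟩ := hc.exists_noncut' hne
      refine ⟨_, hwc.matchable (hcf.mono Finset.sdiff_subset) ?_, ?_⟩
      · have := card_sdiff_single hw
        grind
      · simp
  intro F hF hI
  obtain ⟨M, hM, hMF⟩ := hF.exists_isMatching
  obtain ⟨N, hN, hNY⟩ := hYm.exists_isMatching
  have hMm := Subgraph.maximal_isMatching_iff.mpr ⟨hM, by simpa [hMF] using hI⟩
  have hNm := Subgraph.maximal_isMatching_iff.mpr ⟨hN, fun x hx y hy hxy ↦ hxy.ne (by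
    simp only [hNY, Finset.mem_coe] at hx hy
    exact hYI x hx y hy)⟩
  have h1 := hM.two_mul_ncard_edgeSet
  have h2 := hN.two_mul_ncard_edgeSet
  rw [hMF, Set.ncard_coe_finset] at h1
  rw [hNY, Set.ncard_coe_finset, ← h M N hMm hNm, h1] at h2
  have h3 : Yᶜ.card ≤ 1 := by
    rw [Finset.card_le_one]
    intro a ha b hb
    exact hYI a (by simpa using ha) b (by simpa using hb)
  rw [Finset.card_compl, ← h2, ← Finset.card_compl, Finset.card_le_one] at h3
  exact fun x hx y hy ↦ h3 x (by simpa using hx) y (by simpa using hy)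

/-! ### Four-cycles -/

/-- Four vertices in cyclic order, as an embedding of `cycleGraph 4`. -/
lemma exists_cycleGraph_embedding {a b c d : V} (hac : a ≠ c) (hbd : b ≠ d) (hab : G.Adj a b)
    (hbc : G.Adj b c) (hcd : G.Adj c d) (hda : G.Adj d a) (hnac : ¬ G.Adj a c)
    (hnbd : ¬ G.Adj b d) : ∃ f : cycleGraph 4 ↪g G, f 0 = a ∧ f 1 = b ∧ f 2 = c ∧ f 3 = d := by
  have h1 := hab.ne
  have h2 := hbc.ne
  have h3 := hcd.ne
  have h4 := hda.ne
  have h5 : ¬ G.Adj c a := fun h ↦ hnac h.symm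
  have h6 : ¬ G.Adj d b := fun h ↦ hnbd h.symm
  refine ⟨⟨⟨![a, b, c, d], ?_⟩, ?_⟩, rfl, rfl, rfl, rfl⟩
  · intro i j hij
    fin_cases i <;> fin_cases j <;> simp_all
  · intro i j
    change G.Adj (![a, b, c, d] i) (![a, b, c, d] j) ↔ _
    fin_cases i <;> fin_cases j <;>
      simp [cycleGraph_adj', hab, hab.symm, hbc, hbc.symm, hcd, hcd.symm, hda, hda.symm, hnac,
        hnbd, h5, h6] <;> decide

lemma isFourCycle_iff_inducesC4 : G.IsFourCycle X ↔ G.InducesC4 (X : Set V) := by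
  constructor
  · rintro ⟨a, b, c, d, rfl, hac, hbd, hab, hbc, hcd, hda, hnac, hnbd⟩
    obtain ⟨f, rfl, rfl, rfl, rfl⟩ := exists_cycleGraph_embedding hac hbd hab hbc hcd hda hnac hnbd
    have hf : ∀ i, f i ∈ (({f 0, f 1, f 2, f 3} : Finset V) : Set V) := by
      intro i
      fin_cases i <;> simp
    refine ⟨RelIso.symm ⟨Equiv.ofBijective (fun i ↦ ⟨f i, hf i⟩) ⟨?_, ?_⟩, ?_⟩⟩
    · exact fun i j hij ↦ f.injective (congrArg Subtype.val hij)
    · rintro ⟨w, hw⟩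
      simp only [Finset.coe_insert, Finset.coe_singleton, Set.mem_insert_iff,
        Set.mem_singleton_iff] at hw
      rcases hw with rfl | rfl | rfl | rfl
      exacts [⟨0, rfl⟩, ⟨1, rfl⟩, ⟨2, rfl⟩, ⟨3, rfl⟩]
    · intro i j
      exact f.map_adj_iff
  · rintro ⟨f⟩
    have hadj : ∀ i j, G.Adj (f.symm i) (f.symm j) ↔ (cycleGraph 4).Adj i j := fun i j ↦ by
      rw [← f.symm.map_adj_iff]; simp
    have hne : ∀ i j, i ≠ j → (f.symm i : V) ≠ f.symm j := fun i j hij h ↦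
      hij (f.symm.injective (Subtype.ext h))
    refine ⟨f.symm 0, f.symm 1, f.symm 2, f.symm 3, ?_, hne _ _ (by decide), hne _ _ (by decide),
      (hadj _ _).mpr (by decide), (hadj _ _).mpr (by decide), (hadj _ _).mpr (by decide),
      (hadj _ _).mpr (by decide), fun h ↦ ?_, fun h ↦ ?_⟩
    · ext w
      simp only [Finset.mem_insert, Finset.mem_singleton]
      constructor
      · intro hw
        have : ∀ i : Fin 4, i = 0 ∨ i = 1 ∨ i = 2 ∨ i = 3 := by decide
        have h2 : (f.symm (f ⟨w, hw⟩) : V) = w := by simp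
        rcases this (f ⟨w, hw⟩) with h | h | h | h <;> rw [h] at h2 <;> simp [h2]
      · rintro (rfl | rfl | rfl | rfl) <;> exact Subtype.prop _
    · exact absurd ((hadj _ _).mp h) (by decide)
    · exact absurd ((hadj _ _).mp h) (by decide)

lemma IsFourCycle.exists_rotation {x : V} (h : G.IsFourCycle X) (hx : x ∈ X) :
    ∃ b c d, X = {x, b, c, d} ∧ x ≠ c ∧ b ≠ d ∧
      G.Adj x b ∧ G.Adj b c ∧ G.Adj c d ∧ G.Adj d x ∧ ¬ G.Adj x c ∧ ¬ G.Adj b d := by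
  obtain ⟨p, q, r, s, hX, hpr, hqs, hpq, hqr, hrs, hsp, hnpr, hnqs⟩ := h
  have hx' : x = p ∨ x = q ∨ x = r ∨ x = s := by rw [hX] at hx; simpa using hx
  rcases hx' with rfl | rfl | rfl | rfl
  · exact ⟨q, r, s, hX, hpr, hqs, hpq, hqr, hrs, hsp, hnpr, hnqs⟩
  · exact ⟨r, s, p, by rw [hX]; ext w; simp; tauto, hqs, hpr.symm, hqr, hrs, hsp, hpq, hnqs,
      fun h ↦ hnpr h.symm⟩
  · exact ⟨s, p, q, by rw [hX]; ext w; simp; tauto, hpr.symm, hqs.symm, hrs, hsp, hpq, hqr,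
      fun h ↦ hnpr h.symm, fun h ↦ hnqs h.symm⟩
  · exact ⟨p, q, r, by rw [hX]; ext w; simp; tauto, hqs.symm, hpr, hsp, hpq, hqr, hrs,
      fun h ↦ hnqs h.symm, hnpr⟩

/-- In a four-cycle, the two vertices other than a nonadjacent pair are nonadjacent and joined to
that pair. -/
lemma IsFourCycle.of_not_adj {x y z : V} (h : G.IsFourCycle X) (hx : x ∈ X) (hy : y ∈ X)
    (hz : z ∈ X) (hxy : x ≠ y) (hn : ¬ G.Adj x y) (hzx : z ≠ x) (hzy : z ≠ y) :
    G.Adj z x ∧ G.Adj z y ∧ ∀ w ∈ X, w ≠ x → w ≠ y → ¬ G.Adj z w := by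
  obtain ⟨b, c, d, rfl, hxc, hbd, hxb, hbc, hcd, hdx, hnxc, hnbd⟩ := h.exists_rotation hx
  have h1 := hxb.symm
  have h2 := hcd.symm
  have h3 := hdx.symm
  have h4 : ¬ G.Adj d b := fun h ↦ hnbd h.symm
  simp only [Finset.mem_insert, Finset.mem_singleton] at hy hz ⊢
  have : y = c := by rcases hy with rfl | rfl | rfl | rfl <;> simp_all
  subst this
  have hbb := G.irrefl (v := b)
  have hdd := G.irrefl (v := d)
  rcases hz with rfl | rfl | rfl | rfl
  · exact absurd rfl hzx
  · refine ⟨h1, hbc, ?_⟩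
    rintro w (rfl | rfl | rfl | rfl) <;> simp_all
  · exact absurd rfl hzy
  · refine ⟨hdx, h2, ?_⟩
    rintro w (rfl | rfl | rfl | rfl) <;> simp_all

/-! ### Separations -/

/-- The sets `S`, `A`, `B` partition the vertices, `A` and `B` are nonempty, and no edge joins `A`
and `B`. -/
structure Separates (G : SimpleGraph V) (S A B : Finset V) : Prop where
  cover : ∀ w, w ∈ S ∨ w ∈ A ∨ w ∈ B
  notMem_left : ∀ w ∈ S, w ∉ A
  notMem_right : ∀ w ∈ S, w ∉ B
  disjoint : ∀ w ∈ A, w ∉ B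
  not_adj : ∀ a ∈ A, ∀ b ∈ B, ¬ G.Adj a b
  nonempty_left : A.Nonempty
  nonempty_right : B.Nonempty

namespace Separates

variable {A B : Finset V}

lemma symm (h : G.Separates S A B) : G.Separates S B A where
  cover w := by have := h.cover w; tauto
  notMem_left := h.notMem_right
  notMem_right := h.notMem_left
  disjoint w hB hA := h.disjoint w hA hB
  not_adj b hb a ha hab := h.not_adj a ha b hb hab.symm
  nonempty_left := h.nonempty_right
  nonempty_right := h.nonempty_left

lemma coe_compl (h : G.Separates S A B) : ((A ∪ B : Finset V) : Set V) = (S : Set V)ᶜ := by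
  ext w
  have h1 := h.cover w
  have h2 := h.notMem_left w
  have h3 := h.notMem_right w
  simp only [Finset.coe_union, Set.mem_union, Finset.mem_coe, Set.mem_compl_iff]
  tauto

lemma not_connectedOn (h : G.Separates S A B) : ¬ G.ConnectedOn (A ∪ B) :=
  not_connectedOn_iff.mpr ⟨A, B, h.nonempty_left, h.nonempty_right,
    Finset.disjoint_left.mpr h.disjoint, rfl, h.not_adj⟩

lemma card_add [Fintype V] (h : G.Separates S A B) :
    S.card + (A.card + B.card) = Fintype.card V := by
  rw [← Finset.card_union_of_disjoint (Finset.disjoint_left.mpr h.disjoint),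
    ← Finset.card_union_of_disjoint, ← Finset.card_univ]
  · congr 1
    ext w
    have := h.cover w
    simp only [Finset.mem_union, Finset.mem_univ, iff_true]
    exact this
  · rw [Finset.disjoint_left]
    intro w hw
    have := h.notMem_left w hw
    have := h.notMem_right w hw
    simp only [Finset.mem_union]
    tauto

lemma hasTwoComponents (h : G.Separates S A B) (hA : G.ConnectedOn A) (hB : G.ConnectedOn B) :
    G.HasTwoComponents S A B where
  union_eq := by rw [← h.coe_compl, Finset.coe_union]
  disjoint := Set.disjoint_left.mpr h.disjoint
  left_connected := by
    have := h.nonempty_left.coe_sort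
    exact ⟨connectedOn_iff_preconnected.mp hA⟩
  right_connected := by
    have := h.nonempty_right.coe_sort
    exact ⟨connectedOn_iff_preconnected.mp hB⟩
  not_adj := h.not_adj

lemma isMinimalCutSet [Fintype V] (h : G.Separates S A B) (hG : G.Connected)
    (hA : G.ConnectedOn A) (hB : G.ConnectedOn B) (hSA : ∀ s ∈ S, ∃ a ∈ A, G.Adj s a)
    (hSB : ∀ s ∈ S, ∃ b ∈ B, G.Adj s b) : G.IsMinimalCutSet S := by
  classical
  refine ⟨⟨hG, ?_⟩, fun T hT hTS s hs ↦ ?_⟩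
  · rw [← h.coe_compl, ← connectedOn_iff_preconnected]
    exact h.not_connectedOn
  by_contra hsT
  refine hT.2 ?_
  have hTc : Tᶜ = ((Finset.univ \ T.toFinset : Finset V) : Set V) := by ext; simp
  rw [hTc, ← connectedOn_iff_preconnected]
  obtain ⟨a, ha, hsa⟩ := hSA s hs
  obtain ⟨b, hb, hsb⟩ := hSB s hs
  have hK : G.ConnectedOn (A ∪ insert s B) :=
    hA.union (hB.insert_vertex hb hsb) ha (Finset.mem_insert_self s B) (.inr hsa.symm)
  have hAT : ∀ w ∈ A, w ∉ T := fun w hw hwT ↦ h.notMem_left w (hTS hwT) hw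
  have hBT : ∀ w ∈ B, w ∉ T := fun w hw hwT ↦ h.notMem_right w (hTS hwT) hw
  intro W hW ⟨w, hw⟩
  have hKX : A ∪ insert s B ⊆ Finset.univ \ T.toFinset := by
    intro w hw
    simp only [Finset.mem_union, Finset.mem_insert] at hw
    simp only [Finset.mem_sdiff, Finset.mem_univ, Set.mem_toFinset, true_and]
    rcases hw with hw | rfl | hw
    · exact hAT w hw
    · exact hsT
    · exact hBT w hw
  have hKW : A ∪ insert s B ⊆ W := by
    rcases h.cover w with hwS | hwA | hwB
    · obtain ⟨a', ha', hwa⟩ := hSA w hwS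
      have haK : a' ∈ A ∪ insert s B := Finset.mem_union_left _ ha'
      exact hK.subset_of_closedPart hKX hW haK (hW.2 w hw a' (hKX haK) hwa)
    · exact hK.subset_of_closedPart hKX hW (Finset.mem_union_left _ hwA) hw
    · exact hK.subset_of_closedPart hKX hW (by simp [hwB]) hw
  refine Finset.Subset.antisymm hW.1 fun x hx ↦ ?_
  rcases h.cover x with hxS | hxA | hxB
  · obtain ⟨a', ha', hxa⟩ := hSA x hxS
    exact hW.2 a' (hKW (by simp [ha'])) x hx hxa.symm
  · exact hKW (by simp [hxA])
  · exact hKW (by simp [hxB])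

lemma isClosedPart_left (h : G.Separates S A B) (hX : X ⊆ A ∪ B) (hA : A ⊆ X) :
    G.IsClosedPart X A :=
  ⟨hA, fun a ha b hb hab ↦ by
    rcases Finset.mem_union.mp (hX hb) with h1 | h1
    · exact h1
    · exact absurd hab (h.not_adj a ha b h1)⟩

/-- In a claw-free graph, the neighbours in `A` of a vertex with a neighbour in `B` form a
clique. -/
lemma adj_of_adj [Fintype V] (h : G.Separates S A B) (hcf : G.ClawFreeOn Finset.univ)
    {s a a' b : V} (ha : a ∈ A) (ha' : a' ∈ A) (hb : b ∈ B) (hsa : G.Adj s a) (hsa' : G.Adj s a')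
    (hsb : G.Adj s b) (haa' : a ≠ a') : G.Adj a a' := by
  have := hcf s (Finset.mem_univ _) a (Finset.mem_univ _) a' (Finset.mem_univ _) b
    (Finset.mem_univ _) hsa hsa' hsb haa' (fun h' ↦ h.disjoint a ha (h' ▸ hb))
    (fun h' ↦ h.disjoint a' ha' (h' ▸ hb))
  have := h.not_adj a ha b hb
  have := h.not_adj a' ha' b hb
  tauto

end Separates

/-! ### Matchings that isolate a vertex -/

section Isolating

variable [Fintype V]

lemma LeavesAtMostOne.adj_of_triple (hE : G.LeavesAtMostOne) {x y z : V} (hxy : x ≠ y)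
    (hm : G.Matchable (Finset.univ \ {x, y, z})) : G.Adj x y ∨ G.Adj x z ∨ G.Adj y z := by
  by_contra! h
  obtain ⟨h1, h2, h3⟩ := h
  refine hxy (hE _ hm (fun a ha b hb hab ↦ ?_) x (by simp) y (by simp))
  simp only [Finset.mem_sdiff, Finset.mem_univ, Finset.mem_insert, Finset.mem_singleton, true_and,
    not_not] at ha hb
  have h4 := hab.ne
  have h5 := hab.symm
  rcases ha with rfl | rfl | rfl <;> rcases hb with rfl | rfl | rfl <;> contradiction

/-- If a matching covers all vertices outside `R` except one vertex `v`, and `v` has no neighbour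
in `R`, then `R` is randomly matchable. -/
lemma LeavesAtMostOne.randomlyMatchable (hE : G.LeavesAtMostOne) {F R : Finset V} {v : V}
    (hF : G.Matchable F) (hFR : ∀ w, w ∈ F ∨ w ∈ R ∨ w = v) (hd : ∀ w ∈ F, w ∉ R) (hvF : v ∉ F)
    (hvR : v ∉ R) (hv : ∀ w ∈ R, ¬ G.Adj v w) : G.RandomlyMatchable R := by
  intro F' hF' hm hI
  have hm' : G.Matchable (F ∪ F') := hF.union hm (by
    rw [Finset.disjoint_left]
    exact fun w hw hw' ↦ hd w hw (hF' hw'))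
  have hmem : ∀ w, w ∉ F ∪ F' → w = v ∨ w ∈ R \ F' := by
    intro w hw
    have := hFR w
    simp only [Finset.mem_union, Finset.mem_sdiff] at hw ⊢
    tauto
  have h1 := hE _ hm' (fun x hx y hy hxy ↦ by
    rcases hmem x hx with rfl | hxR <;> rcases hmem y hy with rfl | hyR
    · exact hxy.ne rfl
    · exact hv y (Finset.mem_sdiff.mp hyR).1 hxy
    · exact hv x (Finset.mem_sdiff.mp hxR).1 hxy.symm
    · exact hI x hxR y hyR hxy)
  refine Finset.Subset.antisymm hF' fun x hx ↦ ?_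
  by_contra hxF'
  have h2 := h1 v (by
    simp only [Finset.mem_union, not_or]
    exact ⟨hvF, fun h ↦ hvR (hF' h)⟩) x (by
    simp only [Finset.mem_union, not_or]
    exact ⟨fun h ↦ hd x h hx, hxF'⟩)
  exact hvR (h2 ▸ hx)

end Isolating

/-! ### Graphs with a cut vertex -/

lemma ConnectedOn.insert_closedPart {x : V} {C : Finset V} (hX : G.ConnectedOn X) (hx : x ∈ X)
    (hC : G.IsClosedPart (X \ {x}) C) : G.ConnectedOn (insert x C) := by
  have hCX : ∀ w ∈ C, w ∈ X ∧ w ≠ x := fun w hw ↦ by simpa using hC.1 hw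
  have hcl : ∀ u ∈ C, ∀ w ∈ X, w ≠ x → G.Adj u w → w ∈ C := fun u hu w hw hwx huw ↦
    hC.2 u hu w (by simp [hw, hwx]) huw
  have hxC : x ∉ C := fun h ↦ (hCX x h).2 rfl
  intro W hW ⟨w, hw⟩
  have hWs := hW.1
  by_cases hxW : x ∈ W
  · refine Finset.Subset.antisymm hWs ?_
    by_contra hn
    obtain ⟨u, hu, huW⟩ : ∃ u ∈ C, u ∉ W := by
      by_contra! h
      exact hn (Finset.insert_subset hxW h)
    have := hX (C \ W) ⟨fun a ha ↦ (hCX a (Finset.mem_sdiff.mp ha).1).1, fun a ha b hb hab ↦ by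
      rw [Finset.mem_sdiff] at ha ⊢
      have hbW : b ∉ W := fun h ↦ ha.2 (hW.2 b h a (by simp [ha.1]) hab.symm)
      exact ⟨hcl a ha.1 b hb (fun h ↦ hbW (h ▸ hxW)) hab, hbW⟩⟩ ⟨u, by simp [hu, huW]⟩
    have h2 : x ∈ C \ W := by rw [this]; exact hx
    simp [hxC] at h2
  · exfalso
    have hWC : ∀ w ∈ W, w ∈ C := fun w hw ↦ by
      have := hWs hw
      rw [Finset.mem_insert] at this
      exact this.resolve_left fun h ↦ hxW (h ▸ hw)
    have := hX W ⟨fun a ha ↦ (hCX a (hWC a ha)).1, fun a ha b hb hab ↦ by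
      by_cases hbx : b = x
      · exact hW.2 a ha b (by simp [hbx]) hab
      · exact hW.2 a ha b (by simp [hcl a (hWC a ha) b hb hbx hab]) hab⟩ ⟨w, hw⟩
    exact hxW (this ▸ hx)

/-- If the vertices that do not cut the connected set `X` are pairwise adjacent, then no vertex
cuts `X`: a cut vertex would separate two vertices that do not cut. -/
lemma ConnectedOn.connectedOn_sdiff_of_adj (hX : G.ConnectedOn X)
    (h : ∀ u ∈ X, ∀ w ∈ X, G.ConnectedOn (X \ {u}) → G.ConnectedOn (X \ {w}) → u ≠ w → G.Adj u w)
    {x : V} (hx : x ∈ X) : G.ConnectedOn (X \ {x}) := by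
  by_contra hn
  obtain ⟨C, D, ⟨c, hc⟩, ⟨d, hd⟩, hdis, hCD, hno⟩ := not_connectedOn_iff.mp hn
  rw [Finset.disjoint_left] at hdis
  have hmem : ∀ w, (w ∈ C ∨ w ∈ D) ↔ w ∈ X ∧ w ≠ x := fun w ↦ by
    simpa using Finset.ext_iff.mp hCD w
  have hC : G.ConnectedOn (insert x C) := hX.insert_closedPart hx ⟨hCD ▸ Finset.subset_union_left,
    fun a ha b hb hab ↦ by
      rw [← hCD, Finset.mem_union] at hb
      exact hb.resolve_right fun h ↦ hno a ha b h hab⟩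
  have hD : G.ConnectedOn (insert x D) := hX.insert_closedPart hx ⟨hCD ▸ Finset.subset_union_right,
    fun a ha b hb hab ↦ by
      rw [← hCD, Finset.mem_union] at hb
      exact hb.resolve_left fun h ↦ hno b h a ha hab.symm⟩
  have hcx := ((hmem c).mp (.inl hc)).2
  have hdx := ((hmem d).mp (.inr hd)).2
  obtain ⟨u, hu, hux, huc⟩ := hC.exists_noncut (Finset.mem_insert_self x C)
    (Finset.mem_insert_of_mem hc) hcx
  obtain ⟨w, hw, hwx, hwc⟩ := hD.exists_noncut (Finset.mem_insert_self x D)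
    (Finset.mem_insert_of_mem hd) hdx
  have hu : u ∈ C := Finset.mem_of_mem_insert_of_ne hu hux
  have hw : w ∈ D := Finset.mem_of_mem_insert_of_ne hw hwx
  have h1 : X \ {u} = (insert x C) \ {u} ∪ insert x D := by
    ext t
    have := hmem t
    have := @hdis t
    simp only [Finset.mem_sdiff, Finset.mem_union, Finset.mem_insert, Finset.mem_singleton]
    grind only
  have h2 : X \ {w} = (insert x D) \ {w} ∪ insert x C := by
    ext t
    have := hmem t
    have := @hdis t
    simp only [Finset.mem_sdiff, Finset.mem_union, Finset.mem_insert, Finset.mem_singleton]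
    grind only
  have h3 : G.ConnectedOn (X \ {u}) := h1 ▸ huc.union hD (x := x) (y := x)
    (by simp [hux.symm]) (by simp) (.inl rfl)
  have h4 : G.ConnectedOn (X \ {w}) := h2 ▸ hwc.union hC (x := x) (y := x)
    (by simp [hwx.symm]) (by simp) (.inl rfl)
  exact hno u hu w hw (h u ((hmem u).mp (.inl hu)).1 w ((hmem w).mp (.inr hw)).1 h3 h4
    (fun h ↦ hdis hu (h ▸ hw)))

/-- `G` has three pairwise nonadjacent vertices. -/
def HasIndepTriple (G : SimpleGraph V) : Prop :=
  ∃ x y z, x ≠ y ∧ x ≠ z ∧ y ≠ z ∧ ¬ G.Adj x y ∧ ¬ G.Adj x z ∧ ¬ G.Adj y z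

/-- A graph with three pairwise nonadjacent vertices is not covered by two cliques. -/
lemma HasIndepTriple.not_two_cliques (h : G.HasIndepTriple) {P : V → Prop}
    (h₁ : ∀ u w, P u → P w → u ≠ w → G.Adj u w) (h₂ : ∀ u w, ¬ P u → ¬ P w → u ≠ w → G.Adj u w) :
    False := by
  obtain ⟨x, y, z, hxy, hxz, hyz, nxy, nxz, nyz⟩ := h
  by_cases hx : P x <;> by_cases hy : P y <;> by_cases hz : P z <;> grind only

section CutVertex

variable [Fintype V] {v : V} {A B : Finset V}

lemma Separates.union_eq_sdiff (h : G.Separates {v} A B) : A ∪ B = Finset.univ \ {v} := by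
  ext w
  have h1 := h.cover w
  have h2 := h.notMem_left w
  have h3 := h.notMem_right w
  simp only [Finset.mem_singleton, Finset.mem_union, Finset.mem_sdiff, Finset.mem_univ,
    true_and] at h1 h2 h3 ⊢
  tauto

lemma Separates.connectedOn_left (h : G.Separates {v} A B) (hc : G.ConnectedOn Finset.univ)
    (hcf : G.ClawFreeOn Finset.univ) : G.ConnectedOn A :=
  hc.connectedOn_part hcf (Finset.mem_univ v) h.union_eq_sdiff
    (Finset.disjoint_left.mpr h.disjoint) h.nonempty_right h.not_adj

lemma Separates.exists_adj_left (h : G.Separates {v} A B) (hc : G.ConnectedOn Finset.univ) :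
    ∃ a ∈ A, G.Adj v a :=
  hc.exists_adj_of_closedPart (Finset.mem_univ v)
    (h.isClosedPart_left (by rw [h.union_eq_sdiff])
      (by rw [← h.union_eq_sdiff]; exact Finset.subset_union_left)) h.nonempty_left

/-- A side of a cut vertex is randomly matchable if the other side is even. -/
lemma Separates.randomlyMatchable_left (h : G.Separates {v} A B) (hE : G.LeavesAtMostOne)
    (hc : G.ConnectedOn Finset.univ) (hcf : G.ClawFreeOn Finset.univ) (hB : Even B.card) :
    G.RandomlyMatchable A := by
  have hBc := h.symm.connectedOn_left hc hcf
  obtain ⟨b, hb, hvb⟩ := h.symm.exists_adj_left hc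
  have hvA := h.notMem_left v (Finset.mem_singleton_self v)
  have hvB := h.notMem_right v (Finset.mem_singleton_self v)
  obtain ⟨w, hw, hwv, hwc⟩ := (hBc.insert_vertex hb hvb).exists_noncut
    (Finset.mem_insert_self v B) (Finset.mem_insert_of_mem hb) hvb.ne'
  have hwB := Finset.mem_of_mem_insert_of_ne hw hwv
  refine hE.randomlyMatchable (F := insert v B \ {w}) (v := w)
    (hwc.matchable (hcf.mono (Finset.subset_univ _)) ?_) (fun t ↦ ?_) (fun t ht htA ↦ ?_) (by simp)
    (fun hwA ↦ h.disjoint w hwA hwB) (fun a ha hwa ↦ h.not_adj a ha w hwB hwa.symm)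
  · have h1 := card_sdiff_single hw
    rw [Finset.card_insert_of_notMem hvB] at h1
    rw [Nat.succ_injective h1]
    exact hB
  · have := h.cover t
    simp only [Finset.mem_sdiff, Finset.mem_insert, Finset.mem_singleton] at this ⊢
    tauto
  · have := h.disjoint t htA
    simp only [Finset.mem_sdiff, Finset.mem_insert, Finset.mem_singleton] at ht
    rcases ht.1 with rfl | h
    · exact hvA htA
    · exact this h

/-- The neighbours of a cut vertex on a side that is a four-cycle are two adjacent vertices. -/
lemma Separates.neighborsIn_of_isFourCycle (h : G.Separates {v} A B)
    (hc : G.ConnectedOn Finset.univ) (hcf : G.ClawFreeOn Finset.univ) (hA : G.IsFourCycle A) :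
    ∃ x y : V, G.Adj x y ∧ G.neighborsIn A v = {x, y} := by
  obtain ⟨a, ha, hva⟩ := h.exists_adj_left hc
  obtain ⟨b', hb', hvb'⟩ := h.symm.exists_adj_left hc
  have hcl : ∀ {p q}, p ∈ A → q ∈ A → G.Adj v p → G.Adj v q → p ≠ q → G.Adj p q :=
    fun hp hq hvp hvq hpq ↦ h.adj_of_adj hcf hp hq hb' hvp hvq hvb' hpq
  obtain ⟨b, c, d, rfl, hac, hbd, hab, hbc, hcd, hda, hnac, hnbd⟩ := hA.exists_rotation ha
  have hvA := h.notMem_left v (Finset.mem_singleton_self v)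
  have hvc : ¬ G.Adj v c := fun h' ↦ hnac (hcl (by simp) (by simp) hva h' hac)
  have hvbd : ¬ (G.Adj v b ∧ G.Adj v d) := fun h' ↦ hnbd (hcl (by simp) (by simp) h'.1 h'.2 hbd)
  simp only [Finset.mem_insert, Finset.mem_singleton, not_or] at hvA
  rcases hcf a (Finset.mem_univ _) v (Finset.mem_univ _) b (Finset.mem_univ _) d (Finset.mem_univ _)
    hva.symm hab hda.symm hvA.2.1 hvA.2.2.2 hbd with h1 | h1 | h1
  · refine ⟨a, b, hab, ?_⟩
    ext w
    simp only [neighborsIn, Finset.coe_insert, Finset.coe_singleton, Set.mem_inter_iff,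
      mem_neighborSet, Set.mem_insert_iff, Set.mem_singleton_iff]
    constructor
    · rintro ⟨hw, rfl | rfl | rfl | rfl⟩ <;> tauto
    · rintro (rfl | rfl) <;> tauto
  · refine ⟨a, d, hda.symm, ?_⟩
    ext w
    simp only [neighborsIn, Finset.coe_insert, Finset.coe_singleton, Set.mem_inter_iff,
      mem_neighborSet, Set.mem_insert_iff, Set.mem_singleton_iff]
    constructor
    · rintro ⟨hw, rfl | rfl | rfl | rfl⟩ <;> tauto
    · rintro (rfl | rfl) <;> tauto
  · exact absurd h1 hnbd

lemma memG1_of_even (h : G.Separates {v} A B) (hE : G.LeavesAtMostOne)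
    (hc : G.ConnectedOn Finset.univ) (hcf : G.ClawFreeOn Finset.univ) (hT : G.HasIndepTriple)
    (hA : Even A.card) (hB : Even B.card) : G.MemG1 := by
  have hAc := h.connectedOn_left hc hcf
  have hBc := h.symm.connectedOn_left hc hcf
  have hG : G.Connected := connected_iff_connectedOn_univ.mpr ⟨hc, ⟨v⟩⟩
  have side : ∀ {A B : Finset V}, G.Separates {v} A B → Even A.card → Even B.card →
      ((∃ p : ℕ, 1 ≤ p ∧ G.InducesComplete (A : Set V) (2 * p)) ∨ G.InducesC4 (A : Set V)) ∧
      (G.InducesC4 (A : Set V) → ∃ x y : V, G.Adj x y ∧ G.neighborsIn (A : Set V) v = {x, y}) := by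
    intro A B h hA hB
    refine ⟨?_, fun h4 ↦ h.neighborsIn_of_isFourCycle hc hcf (isFourCycle_iff_inducesC4.mpr h4)⟩
    rcases (h.randomlyMatchable_left hE hc hcf hB).isClique_or_isFourCycle
      (h.connectedOn_left hc hcf) (hcf.mono (Finset.subset_univ _)) with h1 | h1
    · obtain ⟨p, hp⟩ := hA
      have := h.nonempty_left.card_pos
      exact .inl ⟨p, by omega, h1, by rw [Set.ncard_coe_finset]; omega⟩
    · exact .inr (isFourCycle_iff_inducesC4.mp h1)
  have nonadj : ∀ {A B : Finset V}, G.Separates {v} A B → G.IsClique (A : Set V) →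
      G.IsClique (B : Set V) → ∃ a ∈ (A : Set V), ¬ G.Adj v a := by
    intro A B h hA hB
    by_contra! hn
    refine hT.not_two_cliques (P := (· ∈ B)) (fun u w hu hw huw ↦ hB hu hw huw)
      (fun u w hu hw huw ↦ ?_)
    have h1 := h.cover u
    have h2 := h.cover w
    simp only [hu, hw, or_false, Finset.mem_singleton] at h1 h2
    rcases h1 with rfl | h1 <;> rcases h2 with rfl | h2
    · exact absurd rfl huw
    · exact hn w h2
    · exact (hn u h1).symm
    · exact hA h1 h2 huw
  refine ⟨v, A, B, ?_, ?_, ?_, fun h1 h2 ↦ ⟨nonadj h h1 h2, nonadj h.symm h2 h1⟩⟩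
  · have := h.isMinimalCutSet hG hAc hBc
      (by simpa using h.exists_adj_left hc) (by simpa using h.symm.exists_adj_left hc)
    simpa using this
  · simpa using h.hasTwoComponents hAc hBc
  · rintro C (rfl | rfl)
    · exact side h hA hB
    · exact side h.symm hB hA

/-- Suppose that the neighbours of `v` in `B` form a clique with at least two vertices, and that
deleting any of them from `B` leaves a clique or a four-cycle. Then `B` is a clique. -/
lemma isClique_of_sdiff {v b b' : V} {B : Finset V} (hcf : G.ClawFreeOn Finset.univ)
    (hvB' : v ∉ B) (hb : b ∈ B) (hb' : b' ∈ B) (hbb' : b ≠ b') (hvb : G.Adj v b)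
    (hvb' : G.Adj v b')
    (hQ : ∀ {p q}, p ∈ B → q ∈ B → G.Adj v p → G.Adj v q → p ≠ q → G.Adj p q)
    (hBc : ∀ b ∈ B, G.Adj v b →
      G.IsClique ((B \ {b} : Finset V) : Set V) ∨ G.IsFourCycle (B \ {b})) :
    G.IsClique (B : Set V) := by
  -- deleting a neighbour of `v` from `B` never leaves a four-cycle
  have no4 : ∀ b ∈ B, ∀ b' ∈ B, G.Adj v b → G.Adj v b' → b' ≠ b → ¬ G.IsFourCycle (B \ {b}) := by
    intro b hb b' hb' hvb hvb' hbb' h4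
    obtain ⟨p, q, r, hX, hbq, hpr, hbp, hpq, hqr, hrb, hnbq, hnpr⟩ :=
      h4.exists_rotation (x := b') (by simp [hb', hbb'])
    have hmem : ∀ w, (w ∈ B ∧ w ≠ b) ↔ w = b' ∨ w = p ∨ w = q ∨ w = r := fun w ↦ by
      simpa using Finset.ext_iff.mp hX w
    have hpB := (hmem p).mpr (by simp)
    have hqB := (hmem q).mpr (by simp)
    have hrB := (hmem r).mpr (by simp)
    have key : ∀ {p r}, p ∈ B → r ∈ B → p ≠ b → r ≠ b → G.Adj b' p → G.Adj p q → G.Adj q r →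
        G.Adj r b' → p ≠ r → ¬ G.Adj p r → ¬ G.Adj v p := by
      intro p r hpB hrB hpb hrb' hbp hpq hqr hrb hpr hnpr hvp
      have h1 : G.IsFourCycle (B \ {b'}) := by
        refine (hBc b' hb' hvb').resolve_left fun hcl ↦ hnpr (hcl ?_ ?_ hpr)
        · simp [hpB, hbp.ne']
        · simp [hrB, hrb.ne]
      have h2 : G.IsFourCycle (B \ {p}) := by
        refine (hBc p hpB hvp).resolve_left fun hcl ↦ hnbq (hcl ?_ ?_ hbq)
        · simp [hb', hbp.ne]
        · simp [hqB, hpq.ne']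
      have h3 := (h1.of_not_adj (x := p) (y := r) (z := b) (by simp [hpB, hbp.ne'])
        (by simp [hrB, hrb.ne]) (by simp [hb, hbb'.symm]) hpr hnpr hpb.symm hrb'.symm).2.2 q
        (by simp [hqB, hbq.symm]) hpq.ne' hqr.ne
      exact h3 (h2.of_not_adj (x := b') (y := q) (z := b) (by simp [hb', hbp.ne])
        (by simp [hqB, hpq.ne']) (by simp [hb, hpb.symm]) hbq hnbq hbb'.symm hqB.2.symm).2.1
    have hvp := key hpB.1 hrB.1 hpB.2 hrB.2 hbp hpq hqr hrb hpr hnpr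
    have hvr := key hrB.1 hpB.1 hrB.2 hpB.2 hrb.symm hqr.symm hpq.symm hbp.symm hpr.symm
      (fun h ↦ hnpr h.symm)
    have := hcf b' (Finset.mem_univ _) v (Finset.mem_univ _) p (Finset.mem_univ _) r
      (Finset.mem_univ _) hvb'.symm hbp hrb.symm (fun h ↦ hvB' (h ▸ hpB.1))
      (fun h ↦ hvB' (h ▸ hrB.1)) hpr
    tauto
  have h1 := (hBc b hb hvb).resolve_right (no4 b hb b' hb' hvb hvb' hbb'.symm)
  have h2 := (hBc b' hb' hvb').resolve_right (no4 b' hb' b hb hvb' hvb (hbb'))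
  have h3 := hQ hb hb' hvb hvb' (hbb')
  intro u hu w hw huw
  rw [Finset.mem_coe] at hu hw
  by_cases hub : u = b
  · by_cases hwb : w = b'
    · rw [hub, hwb]; exact h3
    · exact h2 (by simp [hub, hb, hbb']) (by simp [hw, hwb]) huw
  · by_cases hwb : w = b
    · by_cases hub' : u = b'
      · rw [hub', hwb]; exact h3.symm
      · exact h2 (by simp [hu, hub']) (by simp [hwb, hb, hbb']) huw
    · exact h1 (by simp [hu, hub]) (by simp [hw, hwb]) huw

/-- If both sides of a cut vertex `v` are odd and `v` is adjacent to all vertices of the clique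
`A`, then there is also a cut vertex with even sides. -/
lemma memG1_of_odd_of_isClique (h : G.Separates {v} A B) (hE : G.LeavesAtMostOne)
    (hc : G.ConnectedOn Finset.univ) (hcf : G.ClawFreeOn Finset.univ) (hT : G.HasIndepTriple)
    (hA : Odd A.card) (hB : Odd B.card) (hcl : G.IsClique (A : Set V))
    (hvA : ∀ a ∈ A, G.Adj v a) : G.MemG1 := by
  have hvA' := h.notMem_left v (Finset.mem_singleton_self v)
  have hvB' := h.notMem_right v (Finset.mem_singleton_self v)
  have hBcl : ¬ G.IsClique (B : Set V) := by
    intro hB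
    refine hT.not_two_cliques (P := (· ∈ B)) (fun u w hu hw huw ↦ hB hu hw huw)
      (fun u w hu hw huw ↦ ?_)
    have h1 := h.cover u
    have h2 := h.cover w
    simp only [hu, hw, or_false, Finset.mem_singleton] at h1 h2
    rcases h1 with rfl | h1 <;> rcases h2 with rfl | h2
    · exact absurd rfl huw
    · exact hvA w h2
    · exact (hvA u h1).symm
    · exact hcl h1 h2 huw
  obtain ⟨a, ha⟩ := h.nonempty_left
  have hQ : ∀ {p q}, p ∈ B → q ∈ B → G.Adj v p → G.Adj v q → p ≠ q → G.Adj p q :=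
    fun hp hq hvp hvq hpq ↦ h.symm.adj_of_adj hcf hp hq ha hvp hvq (hvA a ha) hpq
  -- `a` is isolated by the edge `vb` and a perfect matching of the rest of `A`
  have hRM : ∀ b ∈ B, G.Adj v b → G.RandomlyMatchable (B \ {b}) := by
    intro b hb hvb
    have hbA : b ∉ A := fun h' ↦ h.disjoint b h' hb
    have hm : G.Matchable (A \ {a}) := matchable_of_isClique (hcl.subset (by simp)) (by
      have := card_sdiff_single ha
      grind only [= Nat.even_iff, = Nat.odd_iff])
    refine hE.randomlyMatchable (v := a) (hm.insert_edge hvb (by simp [hvA']) (by simp [hbA]))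
      (fun w ↦ ?_) (fun w hw ↦ ?_) ?_ ?_ ?_
    · have := h.cover w
      simp only [Finset.mem_sdiff, Finset.mem_insert, Finset.mem_singleton] at this ⊢
      tauto
    · have := h.disjoint w
      simp only [Finset.mem_sdiff, Finset.mem_insert, Finset.mem_singleton] at hw ⊢
      rcases hw with rfl | rfl | hw
      · tauto
      · tauto
      · tauto
    · simp only [Finset.mem_sdiff, Finset.mem_insert, Finset.mem_singleton, not_true_eq_false,
        and_false, or_false]
      rintro (rfl | rfl)
      · exact hvA' ha
      · exact hbA ha
    · simp [h.disjoint a ha]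
    · intro w hw
      exact h.not_adj a ha w (Finset.mem_sdiff.mp hw).1
  obtain ⟨b, hb, hvb⟩ := h.symm.exists_adj_left hc
  by_cases hD : ∃ b ∈ B, G.Adj v b ∧ ∃ D, G.IsClosedPart (B \ {b}) D ∧ D.Nonempty ∧
      ∀ d ∈ D, ¬ G.Adj v d
  · -- `b` is a cut vertex with even sides
    obtain ⟨b, hb, hvb, D, hD, hDne, hvD⟩ := hD
    have hDB : ∀ d ∈ D, d ∈ B ∧ d ≠ b := fun d hd ↦ by simpa using hD.1 hd
    have hs : G.Separates {b} ((Finset.univ \ {b}) \ D) D :=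
      { cover := fun w ↦ by
          simp only [Finset.mem_singleton, Finset.mem_sdiff, Finset.mem_univ, true_and]; tauto
        notMem_left := by simp
        notMem_right := fun w hw hwD ↦ (hDB w hwD).2 (by simpa using hw)
        disjoint := fun w hw ↦ (Finset.mem_sdiff.mp hw).2
        not_adj := fun u hu d hd hud ↦ by
          simp only [Finset.mem_sdiff, Finset.mem_univ, Finset.mem_singleton, true_and] at hu
          rcases h.cover u with h1 | h1 | h1
          · rw [Finset.mem_singleton] at h1
            exact hvD d hd (h1 ▸ hud)
          · exact h.not_adj u h1 d (hDB d hd).1 hud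
          · exact hu.2 (hD.2 d hd u (by simp [h1, hu.1]) hud.symm)
        nonempty_left := ⟨v, by
          simp only [Finset.mem_sdiff, Finset.mem_univ, Finset.mem_singleton, true_and]
          exact ⟨hvb.ne, fun hv ↦ hvB' (hDB v hv).1⟩⟩
        nonempty_right := hDne }
    have h1 := ((hRM b hb hvb).matchable.of_closedPart hD).even_card
    have h2 := hs.card_add
    have h3 := h.card_add
    refine memG1_of_even hs hE hc hcf hT ?_ h1
    rw [Finset.card_singleton] at h2 h3
    grind only [= Nat.even_iff, = Nat.odd_iff]
  push Not at hD
  have hBc : ∀ b ∈ B, G.Adj v b → G.IsClique ((B \ {b} : Finset V) : Set V) ∨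
      G.IsFourCycle (B \ {b}) := by
    intro b hb hvb
    refine (hRM b hb hvb).isClique_or_isFourCycle ?_ (hcf.mono (Finset.subset_univ _))
    by_contra hn
    obtain ⟨C, D, hC, hDne, hdis, hCD, hno⟩ := not_connectedOn_iff.mp hn
    obtain ⟨c, hcC, hvc⟩ := hD b hb hvb C ⟨hCD ▸ Finset.subset_union_left, fun a ha b hb hab ↦ by
      rw [← hCD, Finset.mem_union] at hb
      exact hb.resolve_right fun h ↦ hno a ha b h hab⟩ hC
    obtain ⟨d, hdD, hvd⟩ := hD b hb hvb D ⟨hCD ▸ Finset.subset_union_right, fun a ha b hb hab ↦ by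
      rw [← hCD, Finset.mem_union] at hb
      exact hb.resolve_left fun h ↦ hno b h a ha hab.symm⟩ hDne
    have hcB : c ∈ B \ {b} := hCD ▸ Finset.mem_union_left _ hcC
    have hdB : d ∈ B \ {b} := hCD ▸ Finset.mem_union_right _ hdD
    exact hno c hcC d hdD (hQ (Finset.mem_sdiff.mp hcB).1 (Finset.mem_sdiff.mp hdB).1 hvc hvd
      (fun h ↦ Finset.disjoint_left.mp hdis hcC (h ▸ hdD)))
  exfalso
  obtain ⟨b', hb', hvb'⟩ := hD b hb hvb (B \ {b}) ⟨le_rfl, fun _ _ b hb _ ↦ hb⟩ (by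
    rw [Finset.nonempty_iff_ne_empty]
    intro h0
    refine hBcl fun u hu w hw huw ↦ absurd ?_ huw
    have h1 : ∀ w ∈ B, w = b := fun w hw ↦ by
      by_contra hn
      have : w ∈ B \ {b} := by simp [hw, hn]
      simp [h0] at this
    rw [h1 u hu, h1 w hw])
  simp only [Finset.mem_sdiff, Finset.mem_singleton] at hb'
  exact hBcl (isClique_of_sdiff hcf hvB' hb hb'.1 (Ne.symm hb'.2) hvb hvb' hQ hBc)

/-- An equimatchable claw-free graph of odd order with a cut vertex and three pairwise nonadjacent
vertices belongs to `𝒢₁`. -/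
theorem memG1_of_separates (h : G.Separates {v} A B) (hE : G.LeavesAtMostOne)
    (hc : G.ConnectedOn Finset.univ) (hcf : G.ClawFreeOn Finset.univ) (hT : G.HasIndepTriple)
    (hodd : Odd (Fintype.card V)) : G.MemG1 := by
  have hcard := h.card_add
  rw [Finset.card_singleton] at hcard
  rcases Nat.even_or_odd A.card with hA | hA
  · exact memG1_of_even h hE hc hcf hT hA (by grind only [= Nat.even_iff, = Nat.odd_iff])
  have hB : Odd B.card := by grind only [= Nat.even_iff, = Nat.odd_iff]
  have side : ∀ {A B : Finset V}, G.Separates {v} A B → Odd A.card → Odd B.card →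
      (∀ a ∈ A, G.ConnectedOn (A \ {a}) → G.Adj v a) → G.MemG1 := by
    intro A B h hA hB hn
    obtain ⟨b, hb, hvb⟩ := h.symm.exists_adj_left hc
    have h1 : ∀ a ∈ A, G.Adj v a := fun a ha ↦ hn a ha <|
      (h.connectedOn_left hc hcf).connectedOn_sdiff_of_adj (fun u hu w hw hu' hw' huw ↦
        h.adj_of_adj hcf hu hw hb (hn u hu hu') (hn w hw hw') hvb huw) ha
    exact memG1_of_odd_of_isClique h hE hc hcf hT hA hB (fun u hu w hw huw ↦
      h.adj_of_adj hcf hu hw hb (h1 u hu) (h1 w hw) hvb huw) h1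
  by_cases hAn : ∀ a ∈ A, G.ConnectedOn (A \ {a}) → G.Adj v a
  · exact side h hA hB hAn
  by_cases hBn : ∀ b ∈ B, G.ConnectedOn (B \ {b}) → G.Adj v b
  · exact side h.symm hB hA hBn
  exfalso
  push Not at hAn hBn
  obtain ⟨a, ha, hac, hva⟩ := hAn
  obtain ⟨b, hb, hbc, hvb⟩ := hBn
  have hvA := h.notMem_left v (Finset.mem_singleton_self v)
  have hvB := h.notMem_right v (Finset.mem_singleton_self v)
  have hm : G.Matchable ((A \ {a}) ∪ (B \ {b})) := by
    refine Matchable.union (hac.matchable (hcf.mono (Finset.subset_univ _)) ?_)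
      (hbc.matchable (hcf.mono (Finset.subset_univ _)) ?_) ?_
    · have := card_sdiff_single ha
      grind only [= Nat.even_iff, = Nat.odd_iff]
    · have := card_sdiff_single hb
      grind only [= Nat.even_iff, = Nat.odd_iff]
    · rw [Finset.disjoint_left]
      intro w hw
      have := h.disjoint w (Finset.mem_sdiff.mp hw).1
      simp [this]
  rcases hE.adj_of_triple (x := v) (y := a) (z := b) (fun h ↦ hvA (h ▸ ha)) (by
    convert hm using 1
    ext w
    have h1 := h.cover w
    have h2 := h.disjoint w
    have h3 := h.disjoint a ha
    have h4 := fun h' ↦ h.disjoint b h' hb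
    simp only [Finset.mem_sdiff, Finset.mem_insert, Finset.mem_singleton, Finset.mem_union,
      Finset.mem_univ, true_and] at h1 ⊢
    grind only) with h1 | h1 | h1
  · exact hva h1
  · exact hvb h1
  · exact h.not_adj a ha b hb h1

end CutVertex

/-! ### Nonadjacent two-vertex cuts -/

section TwoCut

variable [Fintype V] {s₁ s₂ z : V} {A B : Finset V}

/-- `{s₁, s₂}` is a cut set of two nonadjacent vertices, the even component `A` contains the vertex
`z`, which is adjacent neither to `s₁` nor to `s₂`, and the component `B` is odd. -/
structure IsTwoCut (G : SimpleGraph V) (s₁ s₂ z : V) (A B : Finset V) : Prop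
    extends G.Separates {s₁, s₂} A B where
  ne : s₁ ≠ s₂
  nadj : ¬ G.Adj s₁ s₂
  connectedOn_left : G.ConnectedOn A
  connectedOn_right : G.ConnectedOn B
  even_left : Even A.card
  odd_right : Odd B.card
  adj_left₁ : ∃ a ∈ A, G.Adj s₁ a
  adj_left₂ : ∃ a ∈ A, G.Adj s₂ a
  adj_right₁ : ∃ b ∈ B, G.Adj s₁ b
  adj_right₂ : ∃ b ∈ B, G.Adj s₂ b
  mem : z ∈ A
  nadj₁ : ¬ G.Adj s₁ z
  nadj₂ : ¬ G.Adj s₂ z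

/-- No vertex is a cut vertex. -/
def HasNoCutVertex (G : SimpleGraph V) : Prop := ∀ v, G.ConnectedOn (Finset.univ \ {v})

lemma Separates.swap (h : G.Separates {s₁, s₂} A B) : G.Separates {s₂, s₁} A B := by
  rwa [Finset.pair_comm] at h

lemma Separates.closedPart_of_pair (h : G.Separates {s₁, s₂} A B) :
    G.IsClosedPart ((Finset.univ \ {s₂}) \ {s₁}) A := by
  refine h.isClosedPart_left (fun w hw ↦ ?_) fun w hw ↦ ?_
  · have := h.cover w
    simp only [Finset.mem_sdiff, Finset.mem_univ, true_and, Finset.mem_singleton,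
      Finset.mem_insert, Finset.mem_union] at hw this ⊢
    tauto
  · have := h.notMem_left w
    simp only [Finset.mem_sdiff, Finset.mem_univ, true_and, Finset.mem_singleton,
      Finset.mem_insert] at this ⊢
    tauto

lemma Separates.exists_adj_of_pair (h : G.Separates {s₁, s₂} A B) (hN : G.HasNoCutVertex)
    (hne : s₁ ≠ s₂) : ∃ a ∈ A, G.Adj s₁ a :=
  (hN s₂).exists_adj_of_closedPart (by simp [hne]) h.closedPart_of_pair h.nonempty_left

lemma Separates.connectedOn_of_pair (h : G.Separates {s₁, s₂} A B) (hN : G.HasNoCutVertex)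
    (hcf : G.ClawFreeOn Finset.univ) (hne : s₁ ≠ s₂) : G.ConnectedOn A := by
  refine (hN s₂).connectedOn_part (y := s₁) (D := B) (hcf.mono (Finset.subset_univ _))
    (by simp [hne]) ?_ (Finset.disjoint_left.mpr h.disjoint) h.nonempty_right h.not_adj
  exact Finset.Subset.antisymm (Finset.union_subset h.closedPart_of_pair.1
    h.symm.closedPart_of_pair.1) fun w hw ↦ by
      have := h.cover w
      simp only [Finset.mem_sdiff, Finset.mem_univ, true_and, Finset.mem_singleton,
        Finset.mem_insert, Finset.mem_union] at hw this ⊢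
      tauto

lemma Separates.isTwoCut (h : G.Separates {s₁, s₂} A B) (hN : G.HasNoCutVertex)
    (hcf : G.ClawFreeOn Finset.univ) (hne : s₁ ≠ s₂) (hn : ¬ G.Adj s₁ s₂) (hA : Even A.card)
    (hB : Odd B.card) (hz : z ∈ A) (h₁ : ¬ G.Adj s₁ z) (h₂ : ¬ G.Adj s₂ z) :
    G.IsTwoCut s₁ s₂ z A B :=
  { h with
    ne := hne
    nadj := hn
    connectedOn_left := h.connectedOn_of_pair hN hcf hne
    connectedOn_right := h.symm.connectedOn_of_pair hN hcf hne
    even_left := hA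
    odd_right := hB
    adj_left₁ := h.exists_adj_of_pair hN hne
    adj_left₂ := h.swap.exists_adj_of_pair hN hne.symm
    adj_right₁ := h.symm.exists_adj_of_pair hN hne
    adj_right₂ := h.symm.swap.exists_adj_of_pair hN hne.symm
    mem := hz
    nadj₁ := h₁
    nadj₂ := h₂ }

namespace IsTwoCut

lemma swap (h : G.IsTwoCut s₁ s₂ z A B) : G.IsTwoCut s₂ s₁ z A B :=
  { h.toSeparates.swap with
    ne := h.ne.symm
    nadj := fun h' ↦ h.nadj h'.symm
    connectedOn_left := h.connectedOn_left
    connectedOn_right := h.connectedOn_right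
    even_left := h.even_left
    odd_right := h.odd_right
    adj_left₁ := h.adj_left₂
    adj_left₂ := h.adj_left₁
    adj_right₁ := h.adj_right₂
    adj_right₂ := h.adj_right₁
    mem := h.mem
    nadj₁ := h.nadj₂
    nadj₂ := h.nadj₁ }

lemma s₁_notMem (h : G.IsTwoCut s₁ s₂ z A B) : s₁ ∉ A ∧ s₁ ∉ B :=
  ⟨h.notMem_left s₁ (by simp), h.notMem_right s₁ (by simp)⟩

lemma cover' (h : G.IsTwoCut s₁ s₂ z A B) (w : V) : w = s₁ ∨ w = s₂ ∨ w ∈ A ∨ w ∈ B := by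
  have := h.cover w
  simp only [Finset.mem_insert, Finset.mem_singleton] at this
  tauto

lemma clique_left (h : G.IsTwoCut s₁ s₂ z A B) (hcf : G.ClawFreeOn Finset.univ) {a a' : V}
    (ha : a ∈ A) (ha' : a' ∈ A) (h₁ : G.Adj s₁ a) (h₁' : G.Adj s₁ a') (hne : a ≠ a') :
    G.Adj a a' := by
  obtain ⟨b, hb, hsb⟩ := h.adj_right₁
  exact h.adj_of_adj hcf ha ha' hb h₁ h₁' hsb hne

lemma clique_right (h : G.IsTwoCut s₁ s₂ z A B) (hcf : G.ClawFreeOn Finset.univ) {b b' : V}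
    (hb : b ∈ B) (hb' : b' ∈ B) (h₁ : G.Adj s₁ b) (h₁' : G.Adj s₁ b') (hne : b ≠ b') :
    G.Adj b b' := by
  obtain ⟨a, ha, hsa⟩ := h.adj_left₁
  exact h.symm.adj_of_adj hcf hb hb' ha h₁ h₁' hsa hne

/-- The vertex `z` is isolated by an edge at `s₂` and a perfect matching of the rest of `A`. -/
lemma randomlyMatchable_insert (h : G.IsTwoCut s₁ s₂ z A B) (hE : G.LeavesAtMostOne)
    (hA : G.IsClique (A : Set V)) : G.RandomlyMatchable (insert s₁ B) := by
  obtain ⟨a, ha, hsa⟩ := h.adj_left₂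
  have hza : z ≠ a := fun h' ↦ h.nadj₂ (h' ▸ hsa)
  have h₁ := h.s₁_notMem
  have h₂ := h.swap.s₁_notMem
  have hm : G.Matchable (A \ {z, a}) := matchable_of_isClique (hA.subset (by simp)) (by
    have h1 := card_sdiff_pair h.mem ha hza
    have h2 := h.even_left
    grind only [= Nat.even_iff])
  refine hE.randomlyMatchable (v := z) (hm.insert_edge hsa (by simp [h₂.1]) (by simp))
    (fun w ↦ ?_) (fun w hw ↦ ?_) ?_ ?_ ?_
  · have := h.cover' w
    simp only [Finset.mem_sdiff, Finset.mem_insert, Finset.mem_singleton]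
    tauto
  · have h3 := h.disjoint w
    have h4 := h.ne.symm
    have h5 := h.disjoint a ha
    simp only [Finset.mem_sdiff, Finset.mem_insert, Finset.mem_singleton, not_or] at hw ⊢
    rcases hw with rfl | rfl | hw
    · exact ⟨h4, h₂.2⟩
    · exact ⟨fun h ↦ h₁.1 (h ▸ ha), h5⟩
    · exact ⟨fun h ↦ h₁.1 (h ▸ hw.1), h3 hw.1⟩
  · simp only [Finset.mem_sdiff, Finset.mem_insert, Finset.mem_singleton, true_or,
      not_true_eq_false, and_false, or_false]
    rintro (h3 | h3)
    · exact h₂.1 (h3 ▸ h.mem)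
    · exact hza h3
  · rw [Finset.mem_insert]
    rintro (h3 | h3)
    · exact h₁.1 (h3 ▸ h.mem)
    · exact h.disjoint z h.mem h3
  · intro w hw hzw
    rcases Finset.mem_insert.mp hw with rfl | hw
    · exact h.nadj₁ hzw.symm
    · exact h.not_adj z h.mem w hw hzw

lemma isClique_right (h : G.IsTwoCut s₁ s₂ z A B) (hE : G.LeavesAtMostOne)
    (hcf : G.ClawFreeOn Finset.univ) (hA : G.IsClique (A : Set V)) :
    G.IsClique ((insert s₁ B : Finset V) : Set V) := by
  obtain ⟨b, hb, hsb⟩ := h.adj_right₁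
  refine ((h.randomlyMatchable_insert hE hA).isClique_or_isFourCycle
    (h.connectedOn_right.insert_vertex hb hsb) (hcf.mono (Finset.subset_univ _))).resolve_right ?_
  intro h4
  obtain ⟨p, q, r, hX, hq, hpr, hsp, -, -, hrs, -, hnpr⟩ :=
    h4.exists_rotation (Finset.mem_insert_self s₁ B)
  have hp : p ∈ insert s₁ B := by rw [hX]; simp
  have hr : r ∈ insert s₁ B := by rw [hX]; simp
  exact hnpr (h.clique_right hcf (Finset.mem_of_mem_insert_of_ne hp hsp.ne')
    (Finset.mem_of_mem_insert_of_ne hr hrs.ne) hsp hrs.symm hpr)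

lemma memG22 (h : G.IsTwoCut s₁ s₂ z A B) (hE : G.LeavesAtMostOne)
    (hc : G.ConnectedOn Finset.univ) (hcf : G.ClawFreeOn Finset.univ)
    (hA : G.IsClique (A : Set V)) : G.MemG22 := by
  have hB₁ := h.isClique_right hE hcf hA
  have hB₂ := h.swap.isClique_right hE hcf hA
  have hG : G.Connected := connected_iff_connectedOn_univ.mpr ⟨hc, ⟨z⟩⟩
  obtain ⟨p, hp⟩ := h.even_left
  obtain ⟨q, hq⟩ := h.odd_right
  have := h.nonempty_left.card_pos
  have h₁ := h.s₁_notMem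
  have h₂ := h.swap.s₁_notMem
  refine ⟨s₁, s₂, A, B, p, q, h.ne, h.nadj, ?_, ?_, by omega, ⟨hA, ?_⟩, ⟨hB₁.subset (by simp), ?_⟩,
    ?_, ?_, ⟨?_, fun hsub ↦ ?_⟩, ?_⟩
  · have := h.isMinimalCutSet hG h.connectedOn_left h.connectedOn_right
      (by simpa using ⟨h.adj_left₁, h.adj_left₂⟩) (by simpa using ⟨h.adj_right₁, h.adj_right₂⟩)
    simpa using this
  · simpa using h.hasTwoComponents h.connectedOn_left h.connectedOn_right
  · rw [Set.ncard_coe_finset]; omega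
  · rw [Set.ncard_coe_finset]; omega
  · refine Set.inter_eq_right.mpr fun b hb ↦ hB₁ (by simp) (by simpa using .inr hb) ?_
    rintro rfl
    exact h₁.2 hb
  · refine Set.inter_eq_right.mpr fun b hb ↦ hB₂ (by simp) (by simpa using .inr hb) ?_
    rintro rfl
    exact h₂.2 hb
  · exact Set.union_subset Set.inter_subset_right Set.inter_subset_right
  · rcases hsub h.mem with h3 | h3
    · exact h.nadj₁ h3.1
    · exact h.nadj₂ h3.1
  · rw [Set.eq_empty_iff_forall_notMem]
    rintro a ⟨⟨ha₁, ha⟩, ha₂, -⟩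
    have hza : z ≠ a := fun h' ↦ h.nadj₁ (h' ▸ ha₁)
    have := hcf a (Finset.mem_univ _) s₁ (Finset.mem_univ _) s₂ (Finset.mem_univ _) z
      (Finset.mem_univ _) (G.adj_symm ha₁) (G.adj_symm ha₂) (hA ha h.mem hza.symm) h.ne
      (fun h' ↦ h₁.1 (h' ▸ h.mem)) (fun h' ↦ h₂.1 (h' ▸ h.mem))
    have h3 := h.nadj
    have h4 := h.nadj₁
    have h5 := h.nadj₂
    tauto

/-- If `B` has at least three vertices, then some vertex of `B` can be left uncovered by a matching
of `B ∪ {s₁, s₂}`. If `s₁` and `s₂` both have two neighbours in `B`, this holds for every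
non-cut vertex of `B`; if `b₁` is the only neighbour of `s₁` in `B`, then `s₁b₁` is an edge of the
matching. -/
lemma exists_matchable (h : G.IsTwoCut s₁ s₂ z A B) (hN : G.HasNoCutVertex)
    (hcf : G.ClawFreeOn Finset.univ) (hB : B.card ≠ 1) :
    ∃ x ∈ B, G.Matchable ((B ∪ {s₁, s₂}) \ {x}) := by
  have h₁ := h.s₁_notMem
  have h₂ := h.swap.s₁_notMem
  have hodd := h.odd_right
  have hsingle : ∀ {s₁ s₂ : V}, G.IsTwoCut s₁ s₂ z A B → (∃ b₁ ∈ B, G.Adj s₁ b₁ ∧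
      ∀ b ∈ B, G.Adj s₁ b → b = b₁) → ∃ x ∈ B, G.Matchable ((B ∪ {s₁, s₂}) \ {x}) := by
    rintro s₁ s₂ h ⟨b₁, hb₁, hsb₁, huniq⟩
    have h₁ := h.s₁_notMem
    have h₂ := h.swap.s₁_notMem
    have hne := h.ne
    have hs₂b₁ : s₂ ≠ b₁ := fun h' ↦ h₂.2 (h' ▸ hb₁)
    have hs₁b₁ : s₁ ≠ b₁ := fun h' ↦ h₁.2 (h' ▸ hb₁)
    have hcl : ∀ W : Finset V, (∀ w ∈ W, w ∈ B ∧ w ≠ b₁) →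
        (∀ u ∈ W, ∀ w ∈ B, w ≠ b₁ → G.Adj u w → w ∈ W) → (∀ u ∈ W, ¬ G.Adj s₂ u) → W = ∅ := by
      intro W hW hW' hs
      by_contra hne'
      have := hN b₁ W ⟨fun w hw ↦ by simpa using (hW w hw).2, fun u hu w hw huw ↦ by
        simp only [Finset.mem_sdiff, Finset.mem_univ, Finset.mem_singleton, true_and] at hw
        rcases h.cover' w with rfl | rfl | hwA | hwB
        · exact absurd (huniq u (hW u hu).1 huw.symm) (hW u hu).2
        · exact absurd huw.symm (hs u hu)
        · exact absurd huw.symm (h.not_adj w hwA u (hW u hu).1)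
        · exact hW' u hu w hwB hw huw⟩ (Finset.nonempty_iff_ne_empty.mpr hne')
      exact h₂.2 (hW s₂ (this ▸ by simp [hs₂b₁])).1
    have hQ : G.ConnectedOn (insert s₂ (B \ {b₁})) := by
      intro W hW ⟨w, hw⟩
      have hWs : ∀ w ∈ W, w = s₂ ∨ w ∈ B ∧ w ≠ b₁ := fun w hw ↦ by simpa using hW.1 hw
      have hWc : ∀ u ∈ W, ∀ w, w = s₂ ∨ w ∈ B ∧ w ≠ b₁ → G.Adj u w → w ∈ W := fun u hu w hw huw ↦
        hW.2 u hu w (by simpa using hw) huw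
      by_cases hs : s₂ ∈ W
      · have := hcl ((B \ {b₁}) \ W) (fun w hw ↦ by
          simpa using (Finset.mem_sdiff.mp hw).1) (fun u hu w hw hwb huw ↦ by
          simp only [Finset.mem_sdiff, Finset.mem_singleton] at hu ⊢
          exact ⟨⟨hw, hwb⟩, fun h' ↦ hu.2 (hWc w h' u (.inr hu.1) huw.symm)⟩) (fun u hu hsu ↦ by
          simp only [Finset.mem_sdiff, Finset.mem_singleton] at hu
          exact hu.2 (hWc s₂ hs u (.inr hu.1) hsu))
        refine Finset.Subset.antisymm hW.1 (Finset.insert_subset hs ?_)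
        rwa [Finset.sdiff_eq_empty_iff_subset] at this
      · have := hcl W (fun w hw ↦ (hWs w hw).resolve_left fun h' ↦ hs (h' ▸ hw))
          (fun u hu w hw hwb huw ↦ hWc u hu w (.inr ⟨hw, hwb⟩) huw)
          (fun u hu hsu ↦ hs (hWc u hu s₂ (.inl rfl) hsu.symm))
        simp [this] at hw
    have hs₂B : s₂ ∉ B \ {b₁} := by simp [h₂.2]
    have hc1 := card_sdiff_single hb₁
    obtain ⟨t, ht⟩ : (B \ {b₁}).Nonempty := by
      rw [← Finset.card_pos]
      omega
    obtain ⟨y, hy, hys, hyc⟩ := hQ.exists_noncut (Finset.mem_insert_self _ _)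
      (Finset.mem_insert_of_mem ht) (fun h' ↦ hs₂B (h' ▸ ht))
    have hyB : y ∈ B ∧ y ≠ b₁ := by
      simpa using Finset.mem_of_mem_insert_of_ne hy hys
    have hc2 := card_sdiff_single hy
    rw [Finset.card_insert_of_notMem hs₂B] at hc2
    have hm := hyc.matchable (hcf.mono (Finset.subset_univ _)) (by
      have := h.odd_right
      grind only [= Nat.even_iff, = Nat.odd_iff])
    refine ⟨y, hyB.1, ?_⟩
    convert hm.insert_edge hsb₁ (by simp [hne, h₁.2]) (by simp [hs₂b₁.symm]) using 1
    ext w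
    have hs₁y : s₁ ≠ y := fun h' ↦ h₁.2 (h' ▸ hyB.1)
    simp only [Finset.mem_sdiff, Finset.mem_insert, Finset.mem_singleton, Finset.mem_union]
    grind only
  obtain ⟨b₁, hb₁, hsb₁⟩ := h.adj_right₁
  obtain ⟨b₂, hb₂, hsb₂⟩ := h.adj_right₂
  by_cases hs₁ : ∀ b ∈ B, G.Adj s₁ b → b = b₁
  · exact hsingle h ⟨b₁, hb₁, hsb₁, hs₁⟩
  by_cases hs₂ : ∀ b ∈ B, G.Adj s₂ b → b = b₂
  · rw [Finset.pair_comm]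
    exact hsingle h.swap ⟨b₂, hb₂, hsb₂, hs₂⟩
  push Not at hs₁ hs₂
  obtain ⟨c₁, hc₁, hsc₁, hbc₁⟩ := hs₁
  obtain ⟨c₂, hc₂, hsc₂, hbc₂⟩ := hs₂
  obtain ⟨x, hx, hxc⟩ := h.connectedOn_right.exists_noncut' h.nonempty_right
  obtain ⟨d₁, hd₁, hsd₁⟩ : ∃ d ∈ B \ {x}, G.Adj s₁ d := by
    by_cases hx' : b₁ = x
    · exact ⟨c₁, by simp [hc₁, ← hx', hbc₁], hsc₁⟩
    · exact ⟨b₁, by simp [hb₁, hx'], hsb₁⟩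
  obtain ⟨d₂, hd₂, hsd₂⟩ : ∃ d ∈ B \ {x}, G.Adj s₂ d := by
    by_cases hx' : b₂ = x
    · exact ⟨c₂, by simp [hc₂, ← hx', hbc₂], hsc₂⟩
    · exact ⟨b₂, by simp [hb₂, hx'], hsb₂⟩
  have h1 := (hxc.insert_vertex hd₁ hsd₁).insert_vertex (Finset.mem_insert_of_mem hd₂) hsd₂
  refine ⟨x, hx, ?_⟩
  convert h1.matchable (hcf.mono (Finset.subset_univ _)) ?_ using 1
  · ext w
    have hs₁y : s₁ ≠ x := fun h' ↦ h₁.2 (h' ▸ hx)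
    have hs₂y : s₂ ≠ x := fun h' ↦ h₂.2 (h' ▸ hx)
    simp only [Finset.mem_sdiff, Finset.mem_insert, Finset.mem_singleton, Finset.mem_union]
    grind only
  · have h3 := card_sdiff_single hx
    rw [Finset.card_insert_of_notMem (by simp [h₂.2, h.ne.symm]),
      Finset.card_insert_of_notMem (by simp [h₁.2])]
    grind only [= Nat.even_iff, = Nat.odd_iff]

lemma isClique_left_of_card_ne_one (h : G.IsTwoCut s₁ s₂ z A B) (hE : G.LeavesAtMostOne)
    (hN : G.HasNoCutVertex) (hcf : G.ClawFreeOn Finset.univ) (hB : B.card ≠ 1) :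
    G.IsClique (A : Set V) := by
  obtain ⟨x, hx, hm⟩ := h.exists_matchable hN hcf hB
  have h₁ := h.s₁_notMem
  have h₂ := h.swap.s₁_notMem
  have hRM : G.RandomlyMatchable A := by
    refine hE.randomlyMatchable (v := x) hm (fun w ↦ ?_) (fun w hw hwA ↦ ?_) (by simp)
      (fun h' ↦ h.disjoint x h' hx) (fun w hw hxw ↦ h.not_adj w hw x hx hxw.symm)
    · have := h.cover' w
      simp only [Finset.mem_sdiff, Finset.mem_insert, Finset.mem_singleton, Finset.mem_union]
      tauto
    · have := h.disjoint w hwA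
      simp only [Finset.mem_sdiff, Finset.mem_insert, Finset.mem_singleton,
        Finset.mem_union] at hw
      rcases hw.1 with hw | rfl | rfl
      · exact this hw
      · exact h₁.1 hwA
      · exact h₂.1 hwA
  refine (hRM.isClique_or_isFourCycle h.connectedOn_left
    (hcf.mono (Finset.subset_univ _))).resolve_right fun h4 ↦ ?_
  obtain ⟨p, q, r, hX, hzq, hpr, hzp, hpq, hqr, hrz, hnzq, hnpr⟩ := h4.exists_rotation h.mem
  have hmem : ∀ w, w ∈ A ↔ w = z ∨ w = p ∨ w = q ∨ w = r := fun w ↦ by rw [hX]; simp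
  have hp := (hmem p).mpr (by simp)
  have hq := (hmem q).mpr (by simp)
  have hr := (hmem r).mpr (by simp)
  -- `s₁` and `s₂` are adjacent to the vertex `q` opposite to `z` and to one neighbour of `q`
  have key : ∀ {s₁ s₂ : V}, G.IsTwoCut s₁ s₂ z A B →
      G.Adj s₁ q ∧ (G.Adj s₁ p ∧ ¬ G.Adj s₁ r ∨ G.Adj s₁ r ∧ ¬ G.Adj s₁ p) := by
    intro s₁ s₂ h
    have h₁ := h.s₁_notMem.1
    have hsz := h.nadj₁
    obtain ⟨a, ha, hsa⟩ := h.adj_left₁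
    have hsp : s₁ ≠ p := fun h' ↦ h₁ (h' ▸ hp)
    have hsr : s₁ ≠ r := fun h' ↦ h₁ (h' ▸ hr)
    have hsq : s₁ ≠ q := fun h' ↦ h₁ (h' ▸ hq)
    have hsz' : s₁ ≠ z := fun h' ↦ h₁ (h' ▸ h.mem)
    have hcl : ¬ (G.Adj s₁ p ∧ G.Adj s₁ r) := fun h' ↦
      hnpr (h.clique_left hcf hp hr h'.1 h'.2 hpr)
    have hpq' : G.Adj s₁ p → G.Adj s₁ q := fun h' ↦ by
      have := hcf p (Finset.mem_univ _) s₁ (Finset.mem_univ _) z (Finset.mem_univ _) q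
        (Finset.mem_univ _) h'.symm hzp.symm hpq hsz' hsq hzq
      tauto
    have hrq' : G.Adj s₁ r → G.Adj s₁ q := fun h' ↦ by
      have := hcf r (Finset.mem_univ _) s₁ (Finset.mem_univ _) z (Finset.mem_univ _) q
        (Finset.mem_univ _) h'.symm hrz hqr.symm hsz' hsq hzq
      tauto
    have hsq' : G.Adj s₁ q := by
      rcases (hmem a).mp ha with rfl | rfl | rfl | rfl <;> tauto
    have := hcf q (Finset.mem_univ _) s₁ (Finset.mem_univ _) p (Finset.mem_univ _) r
      (Finset.mem_univ _) hsq'.symm hpq.symm hqr hsp hsr hpr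
    tauto
  obtain ⟨hq₁, hs₁⟩ := key h
  obtain ⟨hq₂, hs₂⟩ := key h.swap
  have same : ∀ {t}, t ∈ A → G.Adj q t → ¬ G.Adj s₁ t → ¬ G.Adj s₂ t → False := by
    intro t ht hqt ht₁ ht₂
    have := hcf q (Finset.mem_univ _) s₁ (Finset.mem_univ _) s₂ (Finset.mem_univ _) t
      (Finset.mem_univ _) hq₁.symm hq₂.symm hqt h.ne (fun h' ↦ h₁.1 (h' ▸ ht))
      (fun h' ↦ h₂.1 (h' ▸ ht))
    have := h.nadj
    tauto
  -- otherwise `z`, `q` and a vertex of `B` can be left uncovered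
  have opp : ∀ {s₁ s₂ : V}, G.IsTwoCut s₁ s₂ z A B → G.Adj s₁ p → G.Adj s₂ r → False := by
    intro s₁ s₂ h hsp hsr
    have h₁ := h.s₁_notMem
    have h₂ := h.swap.s₁_notMem
    obtain ⟨b, hb, hbc⟩ := h.connectedOn_right.exists_noncut' h.nonempty_right
    have hm := hbc.matchable (hcf.mono (Finset.subset_univ _)) (by
      have := card_sdiff_single hb
      have := h.odd_right
      grind only [= Nat.even_iff, = Nat.odd_iff])
    have hpB := h.disjoint p hp
    have hrB := h.disjoint r hr
    have hm' := (hm.insert_edge hsp (by simp [h₁.2]) (by simp [hpB])).insert_edge hsr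
      (by
        simp only [Finset.mem_insert, Finset.mem_sdiff, not_or]
        exact ⟨h.ne.symm, fun h' ↦ h₂.1 (h' ▸ hp), fun h' ↦ h₂.2 h'.1⟩)
      (by
        simp only [Finset.mem_insert, Finset.mem_sdiff, not_or]
        exact ⟨fun h' ↦ h₁.1 (h' ▸ hr), hpr.symm, fun h' ↦ hrB h'.1⟩)
    rcases hE.adj_of_triple (x := z) (y := q) (z := b) hzq (by
      convert hm' using 1
      ext w
      have h3 := h.cover' w
      have h4 := h.disjoint w
      have h7 := hmem w
      have n1 := hzp.ne
      have n2 := hpq.ne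
      have n3 := hqr.ne
      have n4 := hrz.ne
      simp only [Finset.mem_sdiff, Finset.mem_insert, Finset.mem_singleton, Finset.mem_univ,
        true_and]
      grind only) with h3 | h3 | h3
    · exact hnzq h3
    · exact h.not_adj z h.mem b hb h3
    · exact h.not_adj q hq b hb h3
  rcases hs₁ with ⟨h3, h4⟩ | ⟨h3, h4⟩ <;> rcases hs₂ with ⟨h5, h6⟩ | ⟨h5, h6⟩
  · exact same hr hqr h4 h6
  · exact opp h h3 h5
  · exact opp h.swap h5 h3
  · exact same hp hpq.symm h4 h6

end IsTwoCut

end TwoCut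

/-! ### Two-vertex cuts with a component of one vertex -/

section SingleVertexComponent

variable [Fintype V] {s₁ s₂ z b : V} {A : Finset V}

namespace IsTwoCut

lemma adj₁ (h : G.IsTwoCut s₁ s₂ z A {b}) : G.Adj s₁ b := by simpa using h.adj_right₁

lemma b_notMem (h : G.IsTwoCut s₁ s₂ z A {b}) : b ∉ A := fun h' ↦ h.disjoint b h' (by simp)

/-- The vertex `b` is isolated by an edge at `s₁` and an edge at `s₂`. -/
lemma randomlyMatchable_sdiff (h : G.IsTwoCut s₁ s₂ z A {b}) (hE : G.LeavesAtMostOne) {p q : V}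
    (hp : p ∈ A) (hq : q ∈ A) (hpq : p ≠ q) (hsp : G.Adj s₁ p) (hsq : G.Adj s₂ q) :
    G.RandomlyMatchable (A \ {p, q}) := by
  have h₁ := h.s₁_notMem
  have h₂ := h.swap.s₁_notMem
  have hb := h.b_notMem
  have e1 : s₁ ≠ q := fun h' ↦ h₁.1 (h' ▸ hq)
  have e2 : s₂ ≠ p := fun h' ↦ h₂.1 (h' ▸ hp)
  have e3 : p ≠ b := fun h' ↦ hb (h' ▸ hp)
  have e4 : q ≠ b := fun h' ↦ hb (h' ▸ hq)
  have e5 := h.adj₁.ne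
  have e6 := h.swap.adj₁.ne
  have e7 := h.ne
  have hm := (matchable_edge hsq).insert_edge hsp (by simp; grind only) (by simp; grind only)
  refine hE.randomlyMatchable (v := b) hm (fun w ↦ ?_) (fun w hw ↦ ?_) ?_ ?_ ?_
  · have := h.cover' w
    simp only [Finset.mem_sdiff, Finset.mem_insert, Finset.mem_singleton] at this ⊢
    tauto
  · simp only [Finset.mem_sdiff, Finset.mem_insert, Finset.mem_singleton] at hw ⊢
    rcases hw with rfl | rfl | rfl | rfl <;> tauto
  · simp only [Finset.mem_insert, Finset.mem_singleton, not_or]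
    exact ⟨e5.symm, e3.symm, e6.symm, e4.symm⟩
  · simp [hb]
  · intro w hw hbw
    exact h.not_adj w (Finset.mem_sdiff.mp hw).1 b (by simp) hbw.symm

/-- A common neighbour of `s₁` and `s₂` in `A` has no neighbours in `A` outside the neighbourhoods
of `s₁` and `s₂`. -/
lemma adj_or_adj (h : G.IsTwoCut s₁ s₂ z A {b}) (hcf : G.ClawFreeOn Finset.univ) {u w : V}
    (hu₁ : G.Adj s₁ u) (hu₂ : G.Adj s₂ u) (hw : w ∈ A) (huw : G.Adj u w) :
    G.Adj s₁ w ∨ G.Adj s₂ w := by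
  have := hcf u (Finset.mem_univ _) s₁ (Finset.mem_univ _) s₂ (Finset.mem_univ _) w
    (Finset.mem_univ _) hu₁.symm hu₂.symm huw h.ne (fun h' ↦ h.s₁_notMem.1 (h' ▸ hw))
    (fun h' ↦ h.swap.s₁_notMem.1 (h' ▸ hw))
  have := h.nadj
  tauto

lemma not_adj_of_common (h : G.IsTwoCut s₁ s₂ z A {b}) (hE : G.LeavesAtMostOne)
    (hcf : G.ClawFreeOn Finset.univ) {u p q y : V} (hu : u ∈ A) (hu₁ : G.Adj s₁ u)
    (hu₂ : G.Adj s₂ u) (hp : p ∈ A) (hp₁ : G.Adj s₁ p) (hpu : p ≠ u) (hq : q ∈ A)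
    (hq₂ : G.Adj s₂ q) (hqu : q ≠ u) (hpq : p ≠ q) (hy : y ∈ A) (hy₁ : ¬ G.Adj s₁ y)
    (hy₂ : ¬ G.Adj s₂ y) : ¬ G.Adj y q := by
  intro hyq
  have h₁ := h.s₁_notMem
  have h₂ := h.swap.s₁_notMem
  have hb := h.b_notMem
  have e1 : s₁ ≠ q := fun h' ↦ h₁.1 (h' ▸ hq)
  have e2 : s₂ ≠ p := fun h' ↦ h₂.1 (h' ▸ hp)
  have e3 : p ≠ b := fun h' ↦ hb (h' ▸ hp)
  have e4 : q ≠ b := fun h' ↦ hb (h' ▸ hq)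
  have e5 := h.adj₁.ne
  have e6 := h.swap.adj₁.ne
  have e7 := h.ne
  have e8 : y ≠ p := fun h' ↦ hy₁ (h' ▸ hp₁)
  have e9 : y ≠ u := fun h' ↦ hy₁ (h' ▸ hu₁)
  have e10 := hyq.ne
  have hm := ((h.randomlyMatchable_sdiff hE hp hu hpu hp₁ hu₂).sdiff_edge
    (u := y) (v := q) (by simp; grind only) (by simp; grind only) hyq).matchable
  have hm' := (hm.insert_edge hp₁ (by simp [h₁.1]) (by simp)).insert_edge hq₂
    (by simp; grind only) (by simp; grind only)
  rcases hE.adj_of_triple (x := u) (y := y) (z := b) e9.symm (by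
    convert hm' using 1
    ext w
    have h3 := h.cover' w
    simp only [Finset.mem_sdiff, Finset.mem_insert, Finset.mem_singleton, Finset.mem_univ,
      true_and] at h3 ⊢
    grind only) with h3 | h3 | h3
  · have := h.adj_or_adj hcf hu₁ hu₂ hy h3
    tauto
  · exact h.not_adj u hu b (by simp) h3
  · exact h.not_adj y hy b (by simp) h3

/-- If `s₁` and `s₂` have a common neighbour `u`, then `u` is the only neighbour in `A` of one of
them: otherwise no vertex outside the two neighbourhoods is adjacent to a vertex inside. -/
lemma unique_neighbor (h : G.IsTwoCut s₁ s₂ z A {b}) (hE : G.LeavesAtMostOne)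
    (hcf : G.ClawFreeOn Finset.univ) {u : V} (hu : u ∈ A) (hu₁ : G.Adj s₁ u)
    (hu₂ : G.Adj s₂ u) :
    (∀ q ∈ A, G.Adj s₂ q → q = u) ∨ (∀ p ∈ A, G.Adj s₁ p → p = u) := by
  classical
  obtain ⟨w, hw, y, hy, hyS, hwy⟩ := h.connectedOn_left.exists_adj
    (S := A.filter fun w ↦ G.Adj s₁ w ∨ G.Adj s₂ w) (Finset.filter_subset _ _) (a := u)
    (by simp [hu, hu₁]) h.mem (by simp [h.nadj₁, h.nadj₂])
  simp only [Finset.mem_filter, not_and, not_or] at hw hyS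
  obtain ⟨hy₁, hy₂⟩ := hyS hy
  obtain ⟨hwA, hw⟩ := hw
  have hboth : ¬ (G.Adj s₁ w ∧ G.Adj s₂ w) := fun h' ↦ by
    have := h.adj_or_adj hcf h'.1 h'.2 hy hwy
    tauto
  have hwu : w ≠ u := fun h' ↦ hboth (h' ▸ ⟨hu₁, hu₂⟩)
  rcases hw with hw | hw
  · left
    intro q hq hq₂
    by_contra hqu
    have hqw : q ≠ w := fun h' ↦ hboth ⟨hw, h' ▸ hq₂⟩
    exact h.swap.not_adj_of_common hE hcf hu hu₂ hu₁ hq hq₂ hqu hwA hw hwu hqw hy hy₂ hy₁ hwy.symm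
  · right
    intro p hp hp₁
    by_contra hpu
    have hpw : p ≠ w := fun h' ↦ hboth ⟨h' ▸ hp₁, hw⟩
    exact h.not_adj_of_common hE hcf hu hu₁ hu₂ hp hp₁ hpu hwA hw hwu hpw hy hy₁ hy₂ hwy.symm

/-- The case in which `u` is a neighbour of `s₁` and the only neighbour of `s₂` in `A`. Then
`u s₁ b s₂` is an induced four-cycle and the rest of the graph is a clique. -/
lemma memG21 (h : G.IsTwoCut s₁ s₂ z A {b}) (hE : G.LeavesAtMostOne) (hN : G.HasNoCutVertex)
    (hcf : G.ClawFreeOn Finset.univ) {u : V} (hu : u ∈ A) (hu₁ : G.Adj s₁ u)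
    (hu₂ : G.Adj s₂ u) (huniq : ∀ q ∈ A, G.Adj s₂ q → q = u) : G.MemG21 := by
  have h₁ := h.s₁_notMem
  have h₂ := h.swap.s₁_notMem
  have hb := h.b_notMem
  have huN : ∀ w ∈ A, G.Adj u w → G.Adj s₁ w := fun w hw huw ↦
    (h.adj_or_adj hcf hu₁ hu₂ hw huw).resolve_right fun h' ↦ huw.ne (huniq w hw h').symm
  have hzu : z ≠ u := fun h' ↦ h.nadj₁ (h' ▸ hu₁)
  -- no vertex separates a part of `A` from the neighbours of `s₁`
  have hsep : ∀ p, p ≠ b → ∀ W ⊆ A \ {u}, W.Nonempty → (∀ w ∈ W, ∀ t ∈ A, t ≠ u → t ≠ p →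
      G.Adj w t → t ∈ W) → p ∉ W → ∃ w ∈ W, G.Adj s₁ w := by
    intro p hpb W hW hne hcl hpW
    by_contra! hn
    have := hN p W ⟨fun w hw ↦ by simpa using fun h' : w = p ↦ hpW (h' ▸ hw), fun w hw t ht hwt ↦ by
      have hwA := Finset.mem_sdiff.mp (hW hw)
      rcases h.cover' t with rfl | rfl | htA | htb
      · exact absurd hwt.symm (hn w hw)
      · exact absurd (huniq w hwA.1 hwt.symm) (by simpa using hwA.2)
      · by_cases htu : t = u
        · exact absurd (huN w hwA.1 (htu ▸ hwt.symm)) (hn w hw)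
        · exact hcl w hw t htA htu (by simpa using ht) hwt
      · rw [Finset.mem_singleton] at htb
        exact absurd (htb ▸ hwt) (h.not_adj w hwA.1 b (by simp))⟩ hne
    have hbW : b ∈ W := this ▸ (by simp [hpb.symm])
    exact hb (Finset.mem_sdiff.mp (hW hbW)).1
  obtain ⟨p, hp, hsp⟩ := hsep u (fun h' ↦ hb (h' ▸ hu)) (A \ {u}) le_rfl
    ⟨z, by simp [h.mem, hzu]⟩ (fun w _ t ht htu _ _ ↦ by simp [ht, htu]) (by simp)
  have hsecond : ∀ p ∈ A, G.Adj s₁ p → ∃ q ∈ A, q ≠ u ∧ q ≠ p ∧ G.Adj s₁ q := by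
    intro p hp hsp
    have hzp : z ≠ p := fun h' ↦ h.nadj₁ (h' ▸ hsp)
    obtain ⟨q, hq, hsq⟩ := hsep p (fun h' ↦ hb (h' ▸ hp)) ((A \ {u}) \ {p}) Finset.sdiff_subset
      ⟨z, by simp [h.mem, hzu, hzp]⟩
      (fun w _ t ht htu htp _ ↦ by simp [ht, htu, htp]) (by simp)
    simp only [Finset.mem_sdiff, Finset.mem_singleton] at hq
    exact ⟨q, hq.1.1, hq.1.2, hq.2, hsq⟩
  simp only [Finset.mem_sdiff, Finset.mem_singleton] at hp
  obtain ⟨q, hq, hqu, hqp, hsq⟩ := hsecond p hp.1 hsp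
  have hcl : G.IsClique ((A \ {u} : Finset V) : Set V) := by
    refine isClique_of_sdiff hcf (v := s₁) (by simp [h₁.1]) (b := p) (b' := q) (by simp [hp])
      (by simp [hq, hqu]) hqp.symm hsp hsq ?_ ?_
    · intro x y hx hy hsx hsy hxy
      exact h.clique_left hcf (Finset.mem_sdiff.mp hx).1 (Finset.mem_sdiff.mp hy).1 hsx hsy hxy
    · intro x hx hsx
      simp only [Finset.mem_sdiff, Finset.mem_singleton] at hx
      have hsd : (A \ {u}) \ {x} = A \ {x, u} := by ext w; simp; tauto
      rw [hsd]
      refine (h.randomlyMatchable_sdiff hE hx.1 hu hx.2 hsx hu₂).isClique_or_isFourCycle ?_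
        (hcf.mono (Finset.subset_univ _))
      rw [← hsd]
      by_contra hn
      obtain ⟨C, D, hC, hD, hdis, hCD, hno⟩ := not_connectedOn_iff.mp hn
      have hxb : x ≠ b := fun h' ↦ hb (h' ▸ hx.1)
      have hmem : ∀ w, (w ∈ C ∨ w ∈ D) ↔ (w ∈ A ∧ w ≠ u) ∧ w ≠ x := fun w ↦ by
        simpa using Finset.ext_iff.mp hCD w
      obtain ⟨c, hc, hsc⟩ := hsep x hxb C
        (fun w hw ↦ by simpa using ((hmem w).mp (.inl hw)).1) hC
        (fun w hw t ht htu htx hwt ↦ ((hmem t).mpr ⟨⟨ht, htu⟩, htx⟩).resolve_right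
          fun h' ↦ hno w hw t h' hwt) (fun h' ↦ ((hmem x).mp (.inl h')).2 rfl)
      obtain ⟨d, hd, hsd⟩ := hsep x hxb D
        (fun w hw ↦ by simpa using ((hmem w).mp (.inr hw)).1) hD
        (fun w hw t ht htu htx hwt ↦ ((hmem t).mpr ⟨⟨ht, htu⟩, htx⟩).resolve_left
          fun h' ↦ hno t h' w hw hwt.symm) (fun h' ↦ ((hmem x).mp (.inr h')).2 rfl)
      exact hno c hc d hd (h.clique_left hcf ((hmem c).mp (.inl hc)).1.1
        ((hmem d).mp (.inr hd)).1.1 hsc hsd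
        (fun h' ↦ Finset.disjoint_left.mp hdis hc (h' ▸ hd)))
  obtain ⟨f, hf0, hf1, hf2, hf3⟩ := exists_cycleGraph_embedding (G := G) (a := u) (b := s₁)
    (c := b) (d := s₂) (fun h' ↦ hb (h' ▸ hu)) h.ne hu₁.symm h.adj₁ h.swap.adj₁.symm hu₂
    (h.not_adj u hu b (by simp)) h.nadj
  have hNu : ∀ w, w ∈ G.neighborsIn ((A \ {u} : Finset V) : Set V) u ↔
      w ∈ A ∧ w ≠ u ∧ G.Adj u w := fun w ↦ by
    simp only [neighborsIn, Set.mem_inter_iff, mem_neighborSet, Finset.mem_coe, Finset.mem_sdiff,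
      Finset.mem_singleton]
    tauto
  have hcard := card_sdiff_single hu
  obtain ⟨k, hk⟩ := h.even_left
  have hA1 : 2 ≤ (A \ {u}).card := by
    rw [Nat.succ_le_iff, Finset.one_lt_card]
    exact ⟨p, by simp [hp], q, by simp [hq, hqu], hqp.symm⟩
  refine ⟨((A \ {u} : Finset V) : Set V), f, k - 1, ?_, by omega, ⟨hcl, ?_⟩, ?_, ?_, ?_, ?_, ?_⟩
  · ext w
    have hcov := h.cover' w
    have hub : s₁ ≠ u := fun h' ↦ h₁.1 (h' ▸ hu)
    simp only [Set.mem_range, Set.mem_compl_iff, Finset.mem_coe, Finset.mem_sdiff,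
      Finset.mem_singleton] at hcov ⊢
    constructor
    · rintro ⟨i, rfl⟩
      fin_cases i
      · simp [hf0]
      · simp [hf1, h₁.1]
      · simp [hf2, hb]
      · simp [hf3, h₂.1]
    · intro hw
      rcases hcov with rfl | rfl | hcov | rfl
      · exact ⟨1, hf1⟩
      · exact ⟨3, hf3⟩
      · exact ⟨0, by rw [hf0]; tauto⟩
      · exact ⟨2, hf2⟩
  · rw [Set.ncard_coe_finset]; omega
  · rw [hf0, hf1]
    ext w
    rw [hNu]
    simp only [neighborsIn, Set.mem_inter_iff, mem_neighborSet, Finset.mem_coe, Finset.mem_sdiff,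
      Finset.mem_singleton]
    constructor
    · rintro ⟨hw, hwu, huw⟩
      exact ⟨huN w hw huw, hw, hwu⟩
    · rintro ⟨hsw, hw, hwu⟩
      exact ⟨hw, hwu, h.clique_left hcf hu hw hu₁ hsw (Ne.symm hwu)⟩
  · rw [hf0, Nat.succ_le_iff, Set.one_lt_ncard (Set.toFinite _)]
    exact ⟨p, (hNu p).mpr ⟨hp.1, hp.2, h.clique_left hcf hu hp.1 hu₁ hsp (Ne.symm hp.2)⟩, q,
      (hNu q).mpr ⟨hq, hqu, h.clique_left hcf hu hq hu₁ hsq (Ne.symm hqu)⟩, hqp.symm⟩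
  · rw [hf0]
    refine Set.ncard_lt_ncard ⟨Set.inter_subset_right, fun hsub ↦ ?_⟩ (Set.toFinite _)
    exact h.nadj₁ (huN z h.mem ((hNu z).mp (hsub (by simp [h.mem, hzu]))).2.2)
  · rw [hf2, Set.eq_empty_iff_forall_notMem]
    rintro w ⟨hbw, hw⟩
    exact h.not_adj w (Finset.mem_sdiff.mp hw).1 b (by simp) (G.adj_symm hbw)
  · rw [hf3, Set.eq_empty_iff_forall_notMem]
    rintro w ⟨hsw, hw⟩
    have hw := Finset.mem_sdiff.mp hw
    exact hw.2 (by simpa using huniq w hw.1 hsw)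

end IsTwoCut

end SingleVertexComponent

/-! ### Joining two cliques -/

/-- The graph obtained from `G` by adding all edges between `P` and `Q`. -/
def joinSets (G : SimpleGraph V) (P Q : Set V) : SimpleGraph V where
  Adj x y := G.Adj x y ∨ x ≠ y ∧ (x ∈ P ∧ y ∈ Q ∨ x ∈ Q ∧ y ∈ P)
  symm := ⟨fun x y h ↦ by
    rcases h with h | ⟨h, h'⟩
    · exact .inl h.symm
    · exact .inr ⟨h.symm, by tauto⟩⟩
  loopless := ⟨fun x h ↦ by
    rcases h with h | h
    · exact G.irrefl h
    · exact h.1 rfl⟩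

/-- If `P` and `Q` are cliques, then two new edges of a matching can be replaced by an edge in `P`
and an edge in `Q`, so that a matching needs at most one new edge. -/
lemma matchable_or_of_joinSets {P Q : Set V} (hP : G.IsClique P) (hQ : G.IsClique Q)
    (h : (G.joinSets P Q).Matchable X) : G.Matchable X ∨
      ∃ p ∈ P, ∃ q ∈ Q, p ∈ X ∧ q ∈ X ∧ p ≠ q ∧ G.Matchable (X \ {p, q}) := by
  induction h with
  | empty => exact .inl .empty
  | @pair X u v hu hv huv _ ih =>
    have new : ∀ {u v}, u ∈ X → v ∈ X → u ≠ v → u ∈ P → v ∈ Q → (G.Matchable (X \ {u, v}) ∨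
        ∃ p ∈ P, ∃ q ∈ Q, p ∈ X \ {u, v} ∧ q ∈ X \ {u, v} ∧ p ≠ q ∧
          G.Matchable ((X \ {u, v}) \ {p, q})) → G.Matchable X ∨
      ∃ p ∈ P, ∃ q ∈ Q, p ∈ X ∧ q ∈ X ∧ p ≠ q ∧ G.Matchable (X \ {p, q}) := by
      intro u v hu hv huv huP hvQ ih
      rcases ih with ih | ⟨p, hp, q, hq, hpX, hqX, hpq, ih⟩
      · exact .inr ⟨u, huP, v, hvQ, hu, hv, huv, ih⟩
      · simp only [Finset.mem_sdiff, Finset.mem_insert, Finset.mem_singleton, not_or] at hpX hqX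
        left
        refine .pair hu hpX.1 (hP huP hp (Ne.symm hpX.2.1)) (.pair (u := v) (v := q) ?_ ?_
          (hQ hvQ hq (Ne.symm hqX.2.2)) ?_)
        · simp [hv, huv.symm, Ne.symm hpX.2.2]
        · simp [hqX, hpq.symm]
        · convert ih using 1
          ext w
          simp only [Finset.mem_sdiff, Finset.mem_insert, Finset.mem_singleton]
          tauto
    rcases huv with huv | ⟨huv, ⟨huP, hvQ⟩ | ⟨huQ, hvP⟩⟩
    · rcases ih with ih | ⟨p, hp, q, hq, hpX, hqX, hpq, ih⟩
      · exact .inl (.pair hu hv huv ih)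
      · simp only [Finset.mem_sdiff, Finset.mem_insert, Finset.mem_singleton, not_or] at hpX hqX
        refine .inr ⟨p, hp, q, hq, hpX.1, hqX.1, hpq, .pair (u := u) (v := v) ?_ ?_ huv ?_⟩
        · simp [hu, Ne.symm hpX.2.1, Ne.symm hqX.2.1]
        · simp [hv, Ne.symm hpX.2.2, Ne.symm hqX.2.2]
        · rwa [sdiff_sdiff_comm]
    · exact new hu hv huv huP hvQ ih
    · rw [Finset.pair_comm u v] at ih
      exact new hv hu huv.symm hvP huQ ih

/-! ### Induced paths and cycles -/

/-- Four vertices in order, as an isomorphism with `pathGraph 4`. -/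
lemma nonempty_induce_iso_pathGraph {W : Set V} {a b c d : V} (hW : W = {a, b, c, d})
    (hac : a ≠ c) (had : a ≠ d) (hbd : b ≠ d) (hab : G.Adj a b) (hbc : G.Adj b c)
    (hcd : G.Adj c d) (nac : ¬ G.Adj a c) (nad : ¬ G.Adj a d) (nbd : ¬ G.Adj b d) :
    Nonempty (G.induce W ≃g pathGraph 4) := by
  have hf : ∀ i, ![a, b, c, d] i ∈ W := by
    intro i
    subst hW
    fin_cases i <;> simp
  have h1 := hab.ne
  have h2 := hbc.ne
  have h3 := hcd.ne
  have h4 : ¬ G.Adj c a := fun h ↦ nac h.symm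
  have h5 : ¬ G.Adj d a := fun h ↦ nad h.symm
  have h6 : ¬ G.Adj d b := fun h ↦ nbd h.symm
  refine ⟨RelIso.symm ⟨Equiv.ofBijective (fun i ↦ ⟨![a, b, c, d] i, hf i⟩) ⟨?_, ?_⟩, ?_⟩⟩
  · intro i j hij
    have hij := congrArg Subtype.val hij
    revert hij
    fin_cases i <;> fin_cases j <;> simp_all
  · rintro ⟨w, hw⟩
    subst hW
    simp only [Set.mem_insert_iff, Set.mem_singleton_iff] at hw
    rcases hw with rfl | rfl | rfl | rfl
    exacts [⟨0, rfl⟩, ⟨1, rfl⟩, ⟨2, rfl⟩, ⟨3, rfl⟩]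
  · intro i j
    change G.Adj (![a, b, c, d] i) (![a, b, c, d] j) ↔ _
    fin_cases i <;> fin_cases j <;>
      simp [pathGraph_adj, hab, hab.symm, hbc, hbc.symm, hcd, hcd.symm, nac, nad, nbd, h4, h5, h6]

/-- Seven vertices in cyclic order, as an isomorphism with `cycleGraph 7`. They are distinct since
distinct vertices of `cycleGraph 7` have distinct neighbourhoods. -/
lemma nonempty_iso_cycleGraph_seven {f : Fin 7 → V}
    (hf : Function.Surjective f) (h₁ : ∀ i, G.Adj (f i) (f (i + 1)))
    (h₂ : ∀ i, ¬ G.Adj (f i) (f (i + 2))) (h₃ : ∀ i, ¬ G.Adj (f i) (f (i + 3))) :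
    Nonempty (G ≃g cycleGraph 7) := by
  have hij : ∀ i j : Fin 7, j = i ∨ (j = i + 1 ∨ i = j + 1) ∨ j = i + 2 ∨ i = j + 2 ∨
      j = i + 3 ∨ i = j + 3 := by decide
  have hadj : ∀ i j, G.Adj (f i) (f j) ↔ (cycleGraph 7).Adj i j := by
    intro i j
    have h1 : (cycleGraph 7).Adj i j ↔ j = i + 1 ∨ i = j + 1 := by revert i j; decide
    rcases hij i j with rfl | (rfl | rfl) | rfl | rfl | rfl | rfl
    · simp
    · exact iff_of_true (h₁ i) (h1.mpr (.inl rfl))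
    · exact iff_of_true (h₁ j).symm (h1.mpr (.inr rfl))
    · exact iff_of_false (h₂ i) (by rw [h1]; revert i; decide)
    · exact iff_of_false (fun h ↦ h₂ j h.symm) (by rw [h1]; revert j; decide)
    · exact iff_of_false (h₃ i) (by rw [h1]; revert i; decide)
    · exact iff_of_false (fun h ↦ h₃ j h.symm) (by rw [h1]; revert j; decide)
  refine ⟨RelIso.symm ⟨Equiv.ofBijective f ⟨fun i j h ↦ ?_, hf⟩, hadj _ _⟩⟩
  have h1 : ∀ k, (cycleGraph 7).Adj i k ↔ (cycleGraph 7).Adj j k := fun k ↦ by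
    rw [← hadj, ← hadj, h]
  have h2 : ∀ i j : Fin 7, (∀ k, (cycleGraph 7).Adj i k ↔ (cycleGraph 7).Adj j k) → i = j := by
    decide
  exact h2 i j h1

/-! ### Two-vertex cuts with joined neighbourhoods -/

section SingleVertexComponent

variable [Fintype V] {s₁ s₂ z b : V} {A : Finset V}

namespace IsTwoCut

/-- The graph in which the neighbourhoods of `s₁` and `s₂` in `A` are joined completely. -/
def joined (_ : G.IsTwoCut s₁ s₂ z A {b}) : SimpleGraph V :=
  G.joinSets {w | w ∈ A ∧ G.Adj s₁ w} {w | w ∈ A ∧ G.Adj s₂ w}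

lemma joined_adj (h : G.IsTwoCut s₁ s₂ z A {b}) {x y : V} : h.joined.Adj x y ↔
    G.Adj x y ∨ x ≠ y ∧ ((x ∈ A ∧ G.Adj s₁ x) ∧ (y ∈ A ∧ G.Adj s₂ y) ∨
      (x ∈ A ∧ G.Adj s₂ x) ∧ (y ∈ A ∧ G.Adj s₁ y)) := Iff.rfl

/-- The neighbourhoods of `s₁` and `s₂` together form a clique of the joined graph. -/
lemma joined_adj_of_adj (h : G.IsTwoCut s₁ s₂ z A {b}) (hcf : G.ClawFreeOn Finset.univ) {x y : V}
    (hx : x ∈ A) (hy : y ∈ A) (hxs : G.Adj s₁ x ∨ G.Adj s₂ x) (hys : G.Adj s₁ y ∨ G.Adj s₂ y)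
    (hxy : x ≠ y) : h.joined.Adj x y := by
  rw [joined_adj]
  rcases hxs with hxs | hxs <;> rcases hys with hys | hys
  · exact .inl (h.clique_left hcf hx hy hxs hys hxy)
  · exact .inr ⟨hxy, .inl ⟨⟨hx, hxs⟩, hy, hys⟩⟩
  · exact .inr ⟨hxy, .inr ⟨⟨hx, hxs⟩, hy, hys⟩⟩
  · exact .inl (h.swap.clique_left hcf hx hy hxs hys hxy)

lemma randomlyMatchable_joined (h : G.IsTwoCut s₁ s₂ z A {b}) (hE : G.LeavesAtMostOne)
    (hcf : G.ClawFreeOn Finset.univ) (hdis : ∀ u ∈ A, G.Adj s₁ u → ¬ G.Adj s₂ u) :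
    h.joined.RandomlyMatchable A := by
  have h₁ := h.s₁_notMem
  have h₂ := h.swap.s₁_notMem
  have hb := h.b_notMem
  have e5 := h.adj₁.ne
  have e6 := h.swap.adj₁.ne
  have e7 := h.ne
  -- if `s₁` has no neighbour among the uncovered vertices, the edge `s₂b` is added
  have one : ∀ {s₁ s₂ : V}, G.IsTwoCut s₁ s₂ z A {b} → ∀ F ⊆ A, G.Matchable F →
      (∀ x ∈ A \ F, ∀ y ∈ A \ F, ¬ G.Adj x y) → (∀ x ∈ A \ F, ¬ G.Adj s₁ x) → A \ F ⊆ ∅ := by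
    intro s₁ s₂ h F hF hm hI hs x hx
    have h₁ := h.s₁_notMem
    have h₂ := h.swap.s₁_notMem
    have e5 := h.adj₁.ne
    have e7 := h.ne
    have hm' := hm.insert_edge h.swap.adj₁ (fun h' ↦ h₂.1 (hF h')) (fun h' ↦ hb (hF h'))
    have hmem : ∀ w, w ∉ insert s₂ (insert b F) → w = s₁ ∨ w ∈ A \ F := by
      intro w hw
      have := h.cover' w
      simp only [Finset.mem_insert, Finset.mem_singleton, Finset.mem_sdiff] at hw this ⊢
      tauto
    have hx' := Finset.mem_sdiff.mp hx
    have := hE _ hm' (fun u hu w hw huw ↦ by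
      rcases hmem u hu with rfl | hu <;> rcases hmem w hw with rfl | hw
      · exact G.irrefl huw
      · exact hs w hw huw
      · exact hs u hu huw.symm
      · exact hI u hu w hw huw) x (by
        simp only [Finset.mem_insert, not_or]
        exact ⟨fun h' ↦ h₂.1 (h' ▸ hx'.1), fun h' ↦ hb (h' ▸ hx'.1), hx'.2⟩) s₁ (by
        simp only [Finset.mem_insert, not_or]
        exact ⟨e7, e5, fun h' ↦ h₁.1 (hF h')⟩)
    exact absurd (this ▸ hx'.1) h₁.1
  intro F hF hm hI
  have hIG : ∀ x ∈ A \ F, ∀ y ∈ A \ F, ¬ G.Adj x y := fun x hx y hy hxy ↦ hI x hx y hy (.inl hxy)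
  suffices A \ F ⊆ ∅ from
    Finset.Subset.antisymm hF (Finset.sdiff_eq_empty_iff_subset.mp (Finset.subset_empty.mp this))
  rcases matchable_or_of_joinSets
    (fun x hx y hy hxy ↦ h.clique_left hcf hx.1 hy.1 hx.2 hy.2 hxy)
    (fun x hx y hy hxy ↦ h.swap.clique_left hcf hx.1 hy.1 hx.2 hy.2 hxy) hm with
    hm | ⟨p, ⟨hp, hsp⟩, q, ⟨hq, hsq⟩, hpF, hqF, hpq, hm⟩
  · by_cases hs : ∃ x ∈ A \ F, G.Adj s₁ x
    · obtain ⟨x, hx, hsx⟩ := hs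
      have hxA := (Finset.mem_sdiff.mp hx).1
      refine one h.swap F hF hm hIG fun y hy hsy ↦ hI x hx y hy ?_
      refine h.joined_adj_of_adj hcf hxA (Finset.mem_sdiff.mp hy).1 (.inl hsx) (.inr hsy) ?_
      rintro rfl
      exact hdis x hxA hsx hsy
    · push Not at hs
      exact one h F hF hm hIG hs
  · intro x hx
    have hx' := Finset.mem_sdiff.mp hx
    have hm' := (hm.insert_edge hsp (fun h' ↦ h₁.1 (hF (Finset.mem_sdiff.mp h').1))
      (by simp)).insert_edge hsq (by
        simp only [Finset.mem_insert, not_or]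
        exact ⟨e7.symm, fun h' ↦ h₂.1 (h' ▸ hp),
          fun h' ↦ h₂.1 (hF (Finset.mem_sdiff.mp h').1)⟩) (by
        simp only [Finset.mem_insert, not_or]
        exact ⟨fun h' ↦ h₁.1 (h' ▸ hq), hpq.symm, by simp⟩)
    have hmem : ∀ w, w ∉ insert s₂ (insert q (insert s₁ (insert p (F \ {p, q})))) →
        w = b ∨ w ∈ A \ F := by
      intro w hw
      have := h.cover' w
      simp only [Finset.mem_insert, Finset.mem_singleton, Finset.mem_sdiff] at hw this ⊢
      tauto
    have := hE _ hm' (fun u hu w hw huw ↦ by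
      rcases hmem u hu with rfl | hu <;> rcases hmem w hw with rfl | hw
      · exact G.irrefl huw
      · exact h.not_adj w (Finset.mem_sdiff.mp hw).1 u (by simp) huw.symm
      · exact h.not_adj u (Finset.mem_sdiff.mp hu).1 w (by simp) huw
      · exact hIG u hu w hw huw) x (by
        simp only [Finset.mem_insert, Finset.mem_sdiff, not_or]
        exact ⟨fun h' ↦ h₂.1 (h' ▸ hx'.1), fun h' ↦ hx'.2 (h' ▸ hqF), fun h' ↦ h₁.1 (h' ▸ hx'.1),
          fun h' ↦ hx'.2 (h' ▸ hpF), fun h' ↦ hx'.2 h'.1⟩) b (by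
        simp only [Finset.mem_insert, Finset.mem_sdiff, not_or]
        exact ⟨e6.symm, fun h' ↦ hb (h' ▸ hq), e5.symm, fun h' ↦ hb (h' ▸ hp),
          fun h' ↦ hb (hF h'.1)⟩)
    exact absurd (this ▸ hx'.1) hb

/-- In the joined graph, the neighbours in `A` of a neighbour of `s₁` or `s₂` are covered by two
cliques: the joined neighbourhoods, and a clique of `G` by claw-freeness at that neighbour. -/
lemma clawFreeOn_joined (h : G.IsTwoCut s₁ s₂ z A {b}) (hcf : G.ClawFreeOn Finset.univ) :
    h.joined.ClawFreeOn A := by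
  have out : ∀ {s₁ s₂ : V}, G.IsTwoCut s₁ s₂ z A {b} → ∀ x ∈ A, ∀ u ∈ A, ∀ w ∈ A, G.Adj s₁ x →
      G.Adj x u → G.Adj x w → u ≠ w → ¬ G.Adj s₁ u → ¬ G.Adj s₁ w → G.Adj u w := by
    intro s₁ s₂ h x hx u hu w hw hs hxu hxw huw hsu hsw
    have := hcf x (Finset.mem_univ _) s₁ (Finset.mem_univ _) u (Finset.mem_univ _) w
      (Finset.mem_univ _) hs.symm hxu hxw (fun h' ↦ h.s₁_notMem.1 (h' ▸ hu))
      (fun h' ↦ h.s₁_notMem.1 (h' ▸ hw)) huw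
    tauto
  intro x hx a ha c hc d hd hxa hxc hxd hac had hcd
  by_cases hxs : G.Adj s₁ x ∨ G.Adj s₂ x
  · have key : ∀ u ∈ A, ∀ w ∈ A, h.joined.Adj x u → h.joined.Adj x w → u ≠ w →
        ¬ (G.Adj s₁ u ∨ G.Adj s₂ u) → ¬ (G.Adj s₁ w ∨ G.Adj s₂ w) → h.joined.Adj u w := by
      intro u hu w hw hxu hxw huw hsu hsw
      rw [joined_adj] at hxu hxw
      have hxu : G.Adj x u := by tauto
      have hxw : G.Adj x w := by tauto
      left
      rcases hxs with hxs | hxs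
      · exact out h x hx u hu w hw hxs hxu hxw huw (by tauto) (by tauto)
      · exact out h.swap x hx u hu w hw hxs hxu hxw huw (by tauto) (by tauto)
    by_cases h1 : G.Adj s₁ a ∨ G.Adj s₂ a <;> by_cases h2 : G.Adj s₁ c ∨ G.Adj s₂ c <;>
      by_cases h3 : G.Adj s₁ d ∨ G.Adj s₂ d
    · exact .inl (h.joined_adj_of_adj hcf ha hc h1 h2 hac)
    · exact .inl (h.joined_adj_of_adj hcf ha hc h1 h2 hac)
    · exact .inr (.inl (h.joined_adj_of_adj hcf ha hd h1 h3 had))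
    · exact .inr (.inr (key c hc d hd hxc hxd hcd h2 h3))
    · exact .inr (.inr (h.joined_adj_of_adj hcf hc hd h2 h3 hcd))
    · exact .inr (.inl (key a ha d hd hxa hxd had h1 h3))
    · exact .inl (key a ha c hc hxa hxc hac h1 h2)
    · exact .inl (key a ha c hc hxa hxc hac h1 h2)
  · have key : ∀ u, h.joined.Adj x u → G.Adj x u := fun u hxu ↦ by
      rw [joined_adj] at hxu
      tauto
    have := hcf x (Finset.mem_univ _) a (Finset.mem_univ _) c (Finset.mem_univ _) d
      (Finset.mem_univ _) (key a hxa) (key c hxc) (key d hxd) hac had hcd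
    exact this.imp .inl (.imp .inl .inl)

lemma isClique_or_isFourCycle_joined (h : G.IsTwoCut s₁ s₂ z A {b}) (hE : G.LeavesAtMostOne)
    (hcf : G.ClawFreeOn Finset.univ) (hdis : ∀ u ∈ A, G.Adj s₁ u → ¬ G.Adj s₂ u) :
    h.joined.IsClique (A : Set V) ∨ h.joined.IsFourCycle A :=
  (h.randomlyMatchable_joined hE hcf hdis).isClique_or_isFourCycle
    (fun W hW hne ↦ h.connectedOn_left W
      ⟨hW.1, fun a ha c hc hac ↦ hW.2 a ha c hc (.inl hac)⟩ hne) (h.clawFreeOn_joined hcf)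

/-- The case in which `A` becomes a clique and `t` is the only neighbour of `s₂` in `A`. Then
`{s₁, t}` is a cut set with components `{b, s₂}` and `A \ {t}`. -/
lemma memG23 (h : G.IsTwoCut s₁ s₂ z A {b}) (hc : G.ConnectedOn Finset.univ)
    (hdis : ∀ u ∈ A, G.Adj s₁ u → ¬ G.Adj s₂ u) (hK : h.joined.IsClique (A : Set V)) {t : V}
    (ht : t ∈ A) (hst : G.Adj s₂ t) (huniq : ∀ q ∈ A, G.Adj s₂ q → q = t) : G.MemG23 := by
  have h₁ := h.s₁_notMem
  have h₂ := h.swap.s₁_notMem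
  have hb := h.b_notMem
  have e5 := h.adj₁.ne
  have e6 := h.swap.adj₁.ne
  have e7 := h.ne
  have e8 : s₁ ≠ t := fun h' ↦ h₁.1 (h' ▸ ht)
  have e9 : s₂ ≠ t := fun h' ↦ h₂.1 (h' ▸ ht)
  have e10 : b ≠ t := fun h' ↦ hb (h' ▸ ht)
  have n1 : ¬ G.Adj s₁ t := fun h' ↦ hdis t ht h' hst
  have n2 : ¬ G.Adj b t := fun h' ↦ h.not_adj t ht b (by simp) h'.symm
  have hzt : z ≠ t := fun h' ↦ h.nadj₂ (h' ▸ hst)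
  obtain ⟨a, ha, hsa⟩ := h.adj_left₁
  have hat : a ≠ t := fun h' ↦ n1 (h' ▸ hsa)
  have haz : a ≠ z := fun h' ↦ h.nadj₁ (h' ▸ hsa)
  have hzt' : G.Adj z t := by
    have := hK h.mem ht hzt
    have h3 := h.nadj₁
    have h4 := h.nadj₂
    rw [joined_adj] at this
    tauto
  have hclique : G.IsClique ((A \ {t} : Finset V) : Set V) := by
    intro x hx y hy hxy
    simp only [Finset.coe_sdiff, Finset.coe_singleton, Set.mem_sdiff, Finset.mem_coe,
      Set.mem_singleton_iff] at hx hy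
    have := hK hx.1 hy.1 hxy
    have h3 := huniq x hx.1
    have h4 := huniq y hy.1
    rw [joined_adj] at this
    tauto
  have hsep : G.Separates {s₁, t} {b, s₂} (A \ {t}) :=
    { cover := fun w ↦ by
        have := h.cover' w
        simp only [Finset.mem_insert, Finset.mem_singleton, Finset.mem_sdiff] at this ⊢
        tauto
      notMem_left := fun w hw ↦ by
        simp only [Finset.mem_insert, Finset.mem_singleton] at hw ⊢
        rcases hw with rfl | rfl <;> tauto
      notMem_right := fun w hw ↦ by
        simp only [Finset.mem_insert, Finset.mem_singleton, Finset.mem_sdiff] at hw ⊢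
        rcases hw with rfl | rfl <;> tauto
      disjoint := fun w hw ↦ by
        simp only [Finset.mem_insert, Finset.mem_singleton, Finset.mem_sdiff] at hw ⊢
        rcases hw with rfl | rfl <;> tauto
      not_adj := fun x hx y hy hxy ↦ by
        simp only [Finset.mem_insert, Finset.mem_singleton, Finset.mem_sdiff] at hx hy
        rcases hx with rfl | rfl
        · exact h.not_adj y hy.1 x (by simp) hxy.symm
        · exact hy.2 (huniq y hy.1 hxy)
      nonempty_left := ⟨b, by simp⟩
      nonempty_right := ⟨z, by simp [h.mem, hzt]⟩ }
  have hc₁ : G.ConnectedOn {b, s₂} := (connectedOn_singleton s₂).insert_vertex (by simp)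
    h.swap.adj₁.symm
  have hc₂ := connectedOn_of_isClique hclique
  have hcard := card_sdiff_single ht
  obtain ⟨k, hk⟩ := h.even_left
  have hA1 : 2 ≤ (A \ {t}).card := by
    rw [Nat.succ_le_iff, Finset.one_lt_card]
    exact ⟨a, by simp [ha, hat], z, by simp [h.mem, hzt], haz⟩
  refine ⟨s₁, t, ({b, s₂} : Finset V), ((A \ {t} : Finset V) : Set V), k - 1, e8, n1, ?_, ?_,
    ⟨?_, ?_⟩, ?_, by omega, ⟨hclique, ?_⟩, ?_⟩
  · have := hsep.isMinimalCutSet (connected_iff_connectedOn_univ.mpr ⟨hc, ⟨z⟩⟩) hc₁ hc₂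
      (by
        simp only [Finset.mem_insert, Finset.mem_singleton]
        rintro s (rfl | rfl)
        · exact ⟨b, by simp, h.adj₁⟩
        · exact ⟨s₂, by simp, hst.symm⟩)
      (by
        simp only [Finset.mem_insert, Finset.mem_singleton]
        rintro s (rfl | rfl)
        · exact ⟨a, by simp [ha, hat], hsa⟩
        · exact ⟨z, by simp [h.mem, hzt], hzt'.symm⟩)
    simpa using this
  · simpa using hsep.hasTwoComponents hc₁ hc₂
  · simp only [Finset.coe_insert, Finset.coe_singleton]
    exact isClique_pair.mpr fun _ ↦ h.swap.adj₁.symm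
  · rw [Set.ncard_coe_finset, Finset.card_pair e6.symm]
  · refine nonempty_induce_iso_pathGraph (a := s₁) (b := b) (c := s₂) (d := t) ?_ e7 e8 e10 h.adj₁
      h.swap.adj₁.symm hst h.nadj n1 n2
    ext w
    simp only [Finset.coe_insert, Finset.coe_singleton, Set.mem_union, Set.mem_insert_iff,
      Set.mem_singleton_iff]
    tauto
  · rw [Set.ncard_coe_finset]; omega
  · refine Set.Subset.antisymm (Set.union_subset Set.inter_subset_right Set.inter_subset_right)
      fun w hw ↦ ?_
    have hw' := hw
    simp only [Finset.coe_sdiff, Finset.coe_singleton, Set.mem_sdiff, Finset.mem_coe,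
      Set.mem_singleton_iff] at hw'
    have := hK hw'.1 ht hw'.2
    rw [joined_adj] at this
    rcases this with this | ⟨-, ⟨h3, -⟩ | ⟨-, h3⟩⟩
    · exact .inr ⟨this.symm, hw⟩
    · exact .inl ⟨h3.2, hw⟩
    · exact absurd h3.2 n1

/-- If `A` becomes a clique but was not one, then one of `s₁` and `s₂` has only one neighbour in
`A`: otherwise a nonadjacent pair of neighbours `a₁`, `a₂` is kept when further neighbours of `s₁`
and `s₂` are deleted from `A`, and what remains is randomly matchable. -/
lemma memG23_of_isClique_joined (h : G.IsTwoCut s₁ s₂ z A {b}) (hE : G.LeavesAtMostOne)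
    (hc : G.ConnectedOn Finset.univ) (hcf : G.ClawFreeOn Finset.univ)
    (hdis : ∀ u ∈ A, G.Adj s₁ u → ¬ G.Adj s₂ u) (hA : ¬ G.IsClique (A : Set V))
    (hK : h.joined.IsClique (A : Set V)) : G.MemG23 := by
  obtain ⟨a₁, ha₁, a₂, ha₂, hs₁, hs₂, hne, hn⟩ : ∃ a₁ ∈ A, ∃ a₂ ∈ A, G.Adj s₁ a₁ ∧ G.Adj s₂ a₂ ∧
      a₁ ≠ a₂ ∧ ¬ G.Adj a₁ a₂ := by
    simp only [IsClique, Set.Pairwise, not_forall] at hA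
    obtain ⟨x, hx, y, hy, hxy, hn⟩ := hA
    rcases (hK hx hy hxy).resolve_left hn with ⟨-, ⟨h1, h2⟩ | ⟨h1, h2⟩⟩
    · exact ⟨x, hx, y, hy, h1.2, h2.2, hxy, hn⟩
    · exact ⟨y, hy, x, hx, h2.2, h1.2, hxy.symm, fun h' ↦ hn h'.symm⟩
  have hzadj : ∀ x ∈ A, x ≠ z → G.Adj z x := by
    intro x hx hxz
    have := hK h.mem hx hxz.symm
    have h3 := h.nadj₁
    have h4 := h.nadj₂
    rw [joined_adj] at this
    tauto
  by_cases hp : ∀ p ∈ A, G.Adj s₁ p → p = a₁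
  · have hK' : h.swap.joined.IsClique (A : Set V) := by
      intro x hx y hy hxy
      have := hK hx hy hxy
      rw [joined_adj] at this ⊢
      tauto
    exact h.swap.memG23 hc (fun u hu h1 h2 ↦ hdis u hu h2 h1) hK' ha₁ hs₁ hp
  by_cases hq : ∀ q ∈ A, G.Adj s₂ q → q = a₂
  · exact h.memG23 hc hdis hK ha₂ hs₂ hq
  push Not at hp hq
  obtain ⟨p, hp, hsp, hpa⟩ := hp
  obtain ⟨q, hq, hsq, hqa⟩ := hq
  have hpq : p ≠ q := fun h' ↦ hdis p hp hsp (h' ▸ hsq)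
  have e1 : a₁ ≠ q := fun h' ↦ hdis q hq (h' ▸ hs₁) hsq
  have e2 : a₂ ≠ p := fun h' ↦ hdis p hp hsp (h' ▸ hs₂)
  have e3 : z ≠ p := fun h' ↦ h.nadj₁ (h' ▸ hsp)
  have e4 : z ≠ q := fun h' ↦ h.nadj₂ (h' ▸ hsq)
  have hzR : z ∈ A \ {p, q} := by simp [h.mem, e3, e4]
  have hconn : G.ConnectedOn (A \ {p, q}) := by
    have key : ∀ W, G.IsClosedPart (A \ {p, q}) W → z ∈ W → W = A \ {p, q} := by
      intro W hW hzW
      refine Finset.Subset.antisymm hW.1 fun x hx ↦ ?_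
      by_cases hxz : x = z
      · rwa [hxz]
      · exact hW.2 z hzW x hx (hzadj x (Finset.mem_sdiff.mp hx).1 hxz)
    intro W hW ⟨w, hw⟩
    refine key W hW ?_
    by_cases hwz : w = z
    · rwa [← hwz]
    · exact hW.2 w hw z hzR (hzadj w (Finset.mem_sdiff.mp (hW.1 hw)).1 hwz).symm
  rcases (h.randomlyMatchable_sdiff hE hp hq hpq hsp hsq).isClique_or_isFourCycle hconn
    (hcf.mono (Finset.subset_univ _)) with h5 | h5
  · exact absurd (h5 (by simp [ha₁, hpa.symm, e1]) (by simp [ha₂, hqa.symm, e2]) hne) hn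
  · obtain ⟨x, y, w, hX, hzy, -, -, -, -, -, hnzy, -⟩ := h5.exists_rotation hzR
    have hy : y ∈ A \ {p, q} := by rw [hX]; simp
    exact absurd (hzadj y (Finset.mem_sdiff.mp hy).1 hzy.symm) hnzy

/-- If `A` becomes a four-cycle, then one of its edges is the only added edge, and the rest of this
four-cycle and the path through `s₁`, `b` and `s₂` form an induced cycle. -/
lemma nonempty_iso_cycleGraph (h : G.IsTwoCut s₁ s₂ z A {b}) (hcf : G.ClawFreeOn Finset.univ)
    (hdis : ∀ u ∈ A, G.Adj s₁ u → ¬ G.Adj s₂ u) (h4 : h.joined.IsFourCycle A) :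
    Nonempty (G ≃g cycleGraph 7) := by
  obtain ⟨p, hp, hsp⟩ := h.adj_left₁
  obtain ⟨q, hq, hsq⟩ := h.adj_left₂
  have hpq : p ≠ q := fun h' ↦ hdis p hp hsp (h' ▸ hsq)
  obtain ⟨y, x, hA, hpy, hqx, hqy, hyx, hxp, npy, nqx⟩ : ∃ y x, A = {p, q, y, x} ∧ p ≠ y ∧ q ≠ x ∧
      h.joined.Adj q y ∧ h.joined.Adj y x ∧ h.joined.Adj x p ∧ ¬ h.joined.Adj p y ∧
      ¬ h.joined.Adj q x := by
    obtain ⟨x, y, w, hX, hpy, hxw, hpx, hxy, hyw, hwp, npy, nxw⟩ := h4.exists_rotation hp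
    have : q = x ∨ q = w := by
      have h1 : q ≠ y := fun h' ↦
        npy (h' ▸ h.joined_adj_of_adj hcf hp hq (.inl hsp) (.inr hsq) hpq)
      have h2 := hq
      rw [hX] at h2
      simp only [Finset.mem_insert, Finset.mem_singleton] at h2
      tauto
    rcases this with rfl | rfl
    · exact ⟨y, w, hX, hpy, hxw, hxy, hyw, hwp, npy, nxw⟩
    · refine ⟨y, x, ?_, hpy, hxw.symm, hyw.symm, hxy.symm, hpx.symm, npy, fun h' ↦ nxw h'.symm⟩
      rw [hX]
      ext
      simp only [Finset.mem_insert, Finset.mem_singleton]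
      tauto
  have hyA : y ∈ A := by rw [hA]; simp
  have hxA : x ∈ A := by rw [hA]; simp
  have hy : ¬ (G.Adj s₁ y ∨ G.Adj s₂ y) := fun h' ↦
    npy (h.joined_adj_of_adj hcf hp hyA (.inl hsp) h' hpy)
  have hx : ¬ (G.Adj s₁ x ∨ G.Adj s₂ x) := fun h' ↦
    nqx (h.joined_adj_of_adj hcf hq hxA (.inr hsq) h' hqx)
  rw [not_or] at hx hy
  have old : ∀ u w, ¬ G.Adj s₁ w ∧ ¬ G.Adj s₂ w → h.joined.Adj w u → G.Adj w u := by
    rintro u w ⟨hw₁, hw₂⟩ (hwu | ⟨-, ⟨h', -⟩ | ⟨h', -⟩⟩)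
    exacts [hwu, absurd h'.2 hw₁, absurd h'.2 hw₂]
  replace hqy := (old q y hy hqy.symm).symm
  replace hyx := old x y hy hyx
  replace hxp := old p x hx hxp
  replace npy : ¬ G.Adj p y := fun h' ↦ npy (.inl h')
  replace nqx : ¬ G.Adj q x := fun h' ↦ nqx (.inl h')
  have h₁ := h.s₁_notMem
  have h₂ := h.swap.s₁_notMem
  have hb := h.b_notMem
  have hne : ∀ w ∈ A, w ≠ s₁ ∧ w ≠ s₂ ∧ w ≠ b := fun w hw ↦
    ⟨fun h' ↦ h₁.1 (h' ▸ hw), fun h' ↦ h₂.1 (h' ▸ hw), fun h' ↦ hb (h' ▸ hw)⟩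
  have hnb : ∀ w ∈ A, ¬ G.Adj w b := fun w hw ↦ h.not_adj w hw b (by simp)
  have nsq : ¬ G.Adj s₁ q := fun h' ↦ hdis q hq h' hsq
  have nsp := hdis p hp hsp
  -- `p` is adjacent to `s₁` and `x`, hence not to `q`
  have npq : ¬ G.Adj p q := fun h' ↦ by
    have := hcf p (Finset.mem_univ _) s₁ (Finset.mem_univ _) x (Finset.mem_univ _) q
      (Finset.mem_univ _) hsp.symm hxp.symm h' (hne x hxA).1.symm (hne q hq).1.symm hqx.symm
    rcases this with h6 | h6 | h6
    exacts [hx.1 h6, nsq h6, nqx h6.symm]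
  have bp := hnb p hp
  have bq := hnb q hq
  have bx := hnb x hxA
  have byy := hnb y hyA
  have a1 := h.adj₁
  have a2 := h.swap.adj₁
  have hcov : ∀ w, w = s₁ ∨ w = s₂ ∨ w = p ∨ w = q ∨ w = y ∨ w = x ∨ w = b := fun w ↦ by
    have := h.cover' w
    rw [hA] at this
    simp only [Finset.mem_insert, Finset.mem_singleton] at this
    tauto
  have nse := h.nadj
  refine nonempty_iso_cycleGraph_seven (f := ![s₁, p, x, y, q, s₂, b]) (fun w ↦ ?_) ?_ ?_ ?_
  · rcases hcov w with rfl | rfl | rfl | rfl | rfl | rfl | rfl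
    exacts [⟨0, rfl⟩, ⟨5, rfl⟩, ⟨1, rfl⟩, ⟨4, rfl⟩, ⟨3, rfl⟩, ⟨2, rfl⟩, ⟨6, rfl⟩]
  · intro i
    fin_cases i
    exacts [hsp, hxp.symm, hyx.symm, hqy.symm, hsq.symm, a2, a1.symm]
  · intro i
    fin_cases i
    exacts [hx.1, npy, fun h ↦ nqx h.symm, fun h ↦ hy.2 h.symm, bq, fun h ↦ nse h.symm,
      fun h ↦ bp h.symm]
  · intro i
    fin_cases i
    exacts [hy.1, npq, fun h ↦ hx.2 h.symm, byy, fun h ↦ nsq h.symm, nsp, fun h ↦ bx h.symm]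

/-- The structure of the graph when it has no cut vertex and a nonadjacent two-vertex cut with an
odd component and a vertex outside of it that is not adjacent to the cut. -/
theorem memG2 {B : Finset V} (h : G.IsTwoCut s₁ s₂ z A B) (hE : G.LeavesAtMostOne)
    (hN : G.HasNoCutVertex) (hc : G.ConnectedOn Finset.univ) (hcf : G.ClawFreeOn Finset.univ) :
    G.MemG21 ∨ G.MemG22 ∨ G.MemG23 ∨ Nonempty (G ≃g cycleGraph 7) := by
  by_cases hA : G.IsClique (A : Set V)
  · exact .inr (.inl (h.memG22 hE hc hcf hA))
  have hB : B.card = 1 := by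
    by_contra hB
    exact hA (h.isClique_left_of_card_ne_one hE hN hcf hB)
  obtain ⟨b, rfl⟩ := Finset.card_eq_one.mp hB
  by_cases hdis : ∀ u ∈ A, G.Adj s₁ u → ¬ G.Adj s₂ u
  · rcases h.isClique_or_isFourCycle_joined hE hcf hdis with hK | h4
    · exact .inr (.inr (.inl (h.memG23_of_isClique_joined hE hc hcf hdis hA hK)))
    · exact .inr (.inr (.inr (h.nonempty_iso_cycleGraph hcf hdis h4)))
  · push Not at hdis
    obtain ⟨u, hu, hu₁, hu₂⟩ := hdis
    left
    rcases h.unique_neighbor hE hcf hu hu₁ hu₂ with h5 | h5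
    · exact h.memG21 hE hN hcf hu hu₁ hu₂ h5
    · exact h.swap.memG21 hE hN hcf hu hu₂ hu₁ h5

end IsTwoCut

end SingleVertexComponent

/-! ### Independent three-vertex cuts -/

lemma exists_third {x y : V} (h : Odd X.card) (hx : x ∈ X) (hy : y ∈ X) (hxy : x ≠ y) :
    ∃ w ∈ X, w ≠ x ∧ w ≠ y := by
  have h1 := card_sdiff_pair hx hy hxy
  have h2 : 0 < (X \ {x, y}).card := Nat.pos_of_ne_zero fun h0 ↦ by
    rw [h0] at h1
    exact absurd h (by rw [← h1]; decide)
  obtain ⟨w, hw⟩ := Finset.card_pos.mp h2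
  simp only [Finset.mem_sdiff, Finset.mem_insert, Finset.mem_singleton, not_or] at hw
  exact ⟨w, hw⟩

section TripleCut

variable [Fintype V] {s₁ s₂ s₃ : V} {A B : Finset V}

/-- `{s₁, s₂, s₃}` is an independent cut set with two components `A` and `B`, both odd, and each of
its vertices has neighbours in both components. -/
structure IsTripleCut (G : SimpleGraph V) (s₁ s₂ s₃ : V) (A B : Finset V) : Prop
    extends G.Separates {s₁, s₂, s₃} A B where
  ne₁₂ : s₁ ≠ s₂
  ne₁₃ : s₁ ≠ s₃
  ne₂₃ : s₂ ≠ s₃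
  nadj₁₂ : ¬ G.Adj s₁ s₂
  nadj₁₃ : ¬ G.Adj s₁ s₃
  nadj₂₃ : ¬ G.Adj s₂ s₃
  connectedOn_left : G.ConnectedOn A
  connectedOn_right : G.ConnectedOn B
  odd_left : Odd A.card
  odd_right : Odd B.card
  adj_left₁ : ∃ a ∈ A, G.Adj s₁ a
  adj_left₂ : ∃ a ∈ A, G.Adj s₂ a
  adj_left₃ : ∃ a ∈ A, G.Adj s₃ a
  adj_right₁ : ∃ b ∈ B, G.Adj s₁ b
  adj_right₂ : ∃ b ∈ B, G.Adj s₂ b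
  adj_right₃ : ∃ b ∈ B, G.Adj s₃ b

lemma card_sdiff_triple {x y z : V} (hxy : x ≠ y) (hxz : x ≠ z) (hyz : y ≠ z) :
    (Finset.univ \ {x, y, z} : Finset V).card + 3 = Fintype.card V := by
  have h1 : ({x, y, z} : Finset V).card = 3 := Finset.card_eq_three.mpr
    ⟨x, y, z, hxy, hxz, hyz, rfl⟩
  rw [← Finset.card_univ, ← Finset.card_sdiff_add_card_eq_card (Finset.subset_univ {x, y, z}), h1]

lemma LeavesAtMostOne.not_connectedOn_triple (hE : G.LeavesAtMostOne)
    (hcf : G.ClawFreeOn Finset.univ) (hodd : Odd (Fintype.card V)) {x y z : V} (hxy : x ≠ y)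
    (hxz : x ≠ z) (hyz : y ≠ z) (nxy : ¬ G.Adj x y) (nxz : ¬ G.Adj x z) (nyz : ¬ G.Adj y z) :
    ¬ G.ConnectedOn (Finset.univ \ {x, y, z}) := by
  intro h
  have := hE.adj_of_triple hxy (h.matchable (hcf.mono (Finset.subset_univ _)) (by
    have := card_sdiff_triple hxy hxz hyz
    grind only [= Nat.even_iff, = Nat.odd_iff]))
  tauto

/-- If `z` has no neighbour in the odd part `C` left by an independent triple `x`, `y`, `z`, then
`{x, y}` is a cut set. -/
lemma isTwoCut_of_isClosedPart (hodd : Odd (Fintype.card V)) (hN : G.HasNoCutVertex)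
    (hcf : G.ClawFreeOn Finset.univ) {x y z : V} (hxy : x ≠ y) (hxz : x ≠ z) (hyz : y ≠ z)
    (nxy : ¬ G.Adj x y) (nxz : ¬ G.Adj x z) (nyz : ¬ G.Adj y z) {C : Finset V}
    (hC : G.IsClosedPart (Finset.univ \ {x, y, z}) C) (hCo : Odd C.card)
    (hz : ∀ c ∈ C, ¬ G.Adj z c) : G.IsTwoCut x y z ((Finset.univ \ {x, y}) \ C) C := by
  have hCm : ∀ w ∈ C, w ≠ x ∧ w ≠ y ∧ w ≠ z := fun w hw ↦ by simpa using hC.1 hw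
  have h : G.Separates {x, y} ((Finset.univ \ {x, y}) \ C) C :=
    { cover := fun w ↦ by
        simp only [Finset.mem_sdiff, Finset.mem_univ, true_and]
        tauto
      notMem_left := fun w hw ↦ by
        simp only [Finset.mem_sdiff, Finset.mem_univ, true_and]
        tauto
      notMem_right := fun w hw hwC ↦ by
        have := hCm w hwC
        simp only [Finset.mem_insert, Finset.mem_singleton] at hw
        tauto
      disjoint := fun w hw ↦ (Finset.mem_sdiff.mp hw).2
      not_adj := fun a ha c hc hac ↦ by
        simp only [Finset.mem_sdiff, Finset.mem_univ, true_and, Finset.mem_insert,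
          Finset.mem_singleton, not_or] at ha
        by_cases haz : a = z
        · exact hz c hc (haz ▸ hac)
        · exact ha.2 (hC.2 c hc a (by simp [ha, haz]) hac.symm)
      nonempty_left := ⟨z, by
        have : z ∉ C := fun h ↦ (hCm z h).2.2 rfl
        simp [hxz.symm, hyz.symm, this]⟩
      nonempty_right := Finset.card_pos.mp hCo.pos }
  refine h.isTwoCut hN hcf hxy nxy ?_ hCo ?_ nxz nyz
  · have h1 := h.card_add
    rw [Finset.card_pair hxy] at h1
    grind only [= Nat.even_iff, = Nat.odd_iff]
  · have : z ∉ C := fun h ↦ (hCm z h).2.2 rfl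
    simp [hxz.symm, hyz.symm, this]

/-- If no two-vertex cut is left, then every independent triple is a cut set with two odd
components. -/
lemma exists_isTripleCut (hE : G.LeavesAtMostOne) (hodd : Odd (Fintype.card V))
    (hN : G.HasNoCutVertex) (hc : G.ConnectedOn Finset.univ) (hcf : G.ClawFreeOn Finset.univ)
    (hno : ∀ s₁ s₂ z A B, ¬ G.IsTwoCut s₁ s₂ z A B) {x y z : V} (hxy : x ≠ y) (hxz : x ≠ z)
    (hyz : y ≠ z) (nxy : ¬ G.Adj x y) (nxz : ¬ G.Adj x z) (nyz : ¬ G.Adj y z) :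
    ∃ A B, G.IsTripleCut x y z A B := by
  have hcard := card_sdiff_triple hxy hxz hyz
  obtain ⟨C, hC, hCc, hCo⟩ := exists_odd_part (X := Finset.univ \ {x, y, z})
    (hcf.mono (Finset.subset_univ _)) fun hm ↦ by
      have := hE.adj_of_triple hxy hm
      tauto
  have hcard' := Finset.card_sdiff_add_card_eq_card hC.1
  obtain ⟨D, hD', hDc, hDo⟩ := exists_odd_part (X := (Finset.univ \ {x, y, z}) \ C)
    (hcf.mono (Finset.subset_univ _)) fun hm ↦ by
      have := hm.even_card
      grind only [= Nat.even_iff, = Nat.odd_iff]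
  have hDC : ∀ d ∈ D, d ∉ C := fun d hd ↦ (Finset.mem_sdiff.mp (hD'.1 hd)).2
  have hD : G.IsClosedPart (Finset.univ \ {x, y, z}) D :=
    ⟨hD'.1.trans Finset.sdiff_subset, fun a ha b hb hab ↦ hD'.2 a ha b (by
      rw [Finset.mem_sdiff]
      exact ⟨hb, fun hbC ↦ hDC a ha (hC.2 b hbC a (Finset.sdiff_subset (hD'.1 ha)) hab.symm)⟩) hab⟩
  have touch : ∀ C, G.IsClosedPart (Finset.univ \ {x, y, z}) C → Odd C.card →
      (∃ c ∈ C, G.Adj x c) ∧ (∃ c ∈ C, G.Adj y c) ∧ ∃ c ∈ C, G.Adj z c := by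
    intro C hC hCo
    refine ⟨?_, ?_, ?_⟩ <;> by_contra! h
    · refine hno y z x _ C (isTwoCut_of_isClosedPart hodd hN hcf hyz hxy.symm hxz.symm nyz
        (fun h ↦ nxy h.symm) (fun h ↦ nxz h.symm) ?_ hCo h)
      convert hC using 2
      ext
      simp only [Finset.mem_insert, Finset.mem_singleton]
      tauto
    · refine hno x z y _ C (isTwoCut_of_isClosedPart hodd hN hcf hxz hxy hyz.symm nxz nxy
        (fun h ↦ nyz h.symm) ?_ hCo h)
      convert hC using 2
      ext
      simp only [Finset.mem_insert, Finset.mem_singleton]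
      tauto
    · exact hno x y z _ C (isTwoCut_of_isClosedPart hodd hN hcf hxy hxz hyz nxy nxz nyz hC hCo h)
  obtain ⟨hC₁, hC₂, hC₃⟩ := touch C hC hCo
  obtain ⟨hD₁, hD₂, hD₃⟩ := touch D hD hDo
  have hnoCD : ∀ c ∈ C, ∀ d ∈ D, ¬ G.Adj c d := fun c hc d hd hcd ↦
    hDC d hd (hC.2 c hc d (hD.1 hd) hcd)
  have hCm : ∀ w ∈ C, w ≠ x ∧ w ≠ y ∧ w ≠ z := fun w hw ↦ by simpa using hC.1 hw
  have hDm : ∀ w ∈ D, w ≠ x ∧ w ≠ y ∧ w ≠ z := fun w hw ↦ by simpa using hD.1 hw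
  -- a third component would give a claw at a vertex of the triple
  have hcov : ∀ w, w ∈ ({x, y, z} : Finset V) ∨ w ∈ C ∨ w ∈ D := by
    intro w
    by_contra! hw
    obtain ⟨hw₁, hw₂, hw₃⟩ := hw
    obtain ⟨e, he, t, -, ht, het⟩ := hc.exists_adj
      (S := ((Finset.univ \ {x, y, z}) \ C) \ D) (Finset.subset_univ _) (a := w)
      (by simpa only [Finset.mem_sdiff, Finset.mem_univ, true_and, hw₁, hw₂, hw₃] using by simp)
      (Finset.mem_univ x) (by simp)
    rw [Finset.mem_sdiff, Finset.mem_sdiff] at he ht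
    have htI : t ∈ ({x, y, z} : Finset V) := by
      by_contra htI
      have htI : t ∈ Finset.univ \ {x, y, z} := Finset.mem_sdiff.mpr ⟨Finset.mem_univ _, htI⟩
      have h1 : t ∉ C := fun h ↦ he.1.2 (hC.2 t h e he.1.1 het.symm)
      have h2 : t ∉ D := fun h ↦ he.2 (hD.2 t h e he.1.1 het.symm)
      tauto
    have claw : ∀ t, G.Adj t e → (∃ c ∈ C, G.Adj t c) → (∃ d ∈ D, G.Adj t d) → False := by
      rintro t hte ⟨c, hc, htc⟩ ⟨d, hd, htd⟩
      rcases hcf t (Finset.mem_univ _) c (Finset.mem_univ _) d (Finset.mem_univ _) e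
        (Finset.mem_univ _) htc htd hte (fun h ↦ hDC d hd (h ▸ hc)) (fun h ↦ he.1.2 (h ▸ hc))
        (fun h ↦ he.2 (h ▸ hd)) with h | h | h
      · exact hnoCD c hc d hd h
      · exact he.1.2 (hC.2 c hc e he.1.1 h)
      · exact he.2 (hD.2 d hd e he.1.1 h)
    simp only [Finset.mem_insert, Finset.mem_singleton] at htI
    rcases htI with rfl | rfl | rfl
    · exact claw _ het.symm hC₁ hD₁
    · exact claw _ het.symm hC₂ hD₂
    · exact claw _ het.symm hC₃ hD₃
  exact ⟨C, D,
    { cover := hcov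
      notMem_left := fun w hw hwC ↦ by
        have := hCm w hwC
        simp only [Finset.mem_insert, Finset.mem_singleton] at hw
        tauto
      notMem_right := fun w hw hwD ↦ by
        have := hDm w hwD
        simp only [Finset.mem_insert, Finset.mem_singleton] at hw
        tauto
      disjoint := fun w hwC hwD ↦ hDC w hwD hwC
      not_adj := hnoCD
      nonempty_left := Finset.card_pos.mp hCo.pos
      nonempty_right := Finset.card_pos.mp hDo.pos
      ne₁₂ := hxy
      ne₁₃ := hxz
      ne₂₃ := hyz
      nadj₁₂ := nxy
      nadj₁₃ := nxz
      nadj₂₃ := nyz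
      connectedOn_left := hCc
      connectedOn_right := hDc
      odd_left := hCo
      odd_right := hDo
      adj_left₁ := hC₁
      adj_left₂ := hC₂
      adj_left₃ := hC₃
      adj_right₁ := hD₁
      adj_right₂ := hD₂
      adj_right₃ := hD₃ }⟩

namespace IsTripleCut

lemma swap (h : G.IsTripleCut s₁ s₂ s₃ A B) : G.IsTripleCut s₂ s₁ s₃ A B :=
  { (Finset.insert_comm s₁ s₂ {s₃} ▸ h.toSeparates : G.Separates {s₂, s₁, s₃} A B) with
    ne₁₂ := h.ne₁₂.symm
    ne₁₃ := h.ne₂₃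
    ne₂₃ := h.ne₁₃
    nadj₁₂ := fun h' ↦ h.nadj₁₂ h'.symm
    nadj₁₃ := h.nadj₂₃
    nadj₂₃ := h.nadj₁₃
    connectedOn_left := h.connectedOn_left
    connectedOn_right := h.connectedOn_right
    odd_left := h.odd_left
    odd_right := h.odd_right
    adj_left₁ := h.adj_left₂
    adj_left₂ := h.adj_left₁
    adj_left₃ := h.adj_left₃
    adj_right₁ := h.adj_right₂
    adj_right₂ := h.adj_right₁
    adj_right₃ := h.adj_right₃ }

lemma swap' (h : G.IsTripleCut s₁ s₂ s₃ A B) : G.IsTripleCut s₁ s₃ s₂ A B :=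
  { (Finset.pair_comm s₂ s₃ ▸ h.toSeparates : G.Separates {s₁, s₃, s₂} A B) with
    ne₁₂ := h.ne₁₃
    ne₁₃ := h.ne₁₂
    ne₂₃ := h.ne₂₃.symm
    nadj₁₂ := h.nadj₁₃
    nadj₁₃ := h.nadj₁₂
    nadj₂₃ := fun h' ↦ h.nadj₂₃ h'.symm
    connectedOn_left := h.connectedOn_left
    connectedOn_right := h.connectedOn_right
    odd_left := h.odd_left
    odd_right := h.odd_right
    adj_left₁ := h.adj_left₁
    adj_left₂ := h.adj_left₃
    adj_left₃ := h.adj_left₂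
    adj_right₁ := h.adj_right₁
    adj_right₂ := h.adj_right₃
    adj_right₃ := h.adj_right₂ }

lemma symm (h : G.IsTripleCut s₁ s₂ s₃ A B) : G.IsTripleCut s₁ s₂ s₃ B A :=
  { h.toSeparates.symm with
    ne₁₂ := h.ne₁₂
    ne₁₃ := h.ne₁₃
    ne₂₃ := h.ne₂₃
    nadj₁₂ := h.nadj₁₂
    nadj₁₃ := h.nadj₁₃
    nadj₂₃ := h.nadj₂₃
    connectedOn_left := h.connectedOn_right
    connectedOn_right := h.connectedOn_left
    odd_left := h.odd_right
    odd_right := h.odd_left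
    adj_left₁ := h.adj_right₁
    adj_left₂ := h.adj_right₂
    adj_left₃ := h.adj_right₃
    adj_right₁ := h.adj_left₁
    adj_right₂ := h.adj_left₂
    adj_right₃ := h.adj_left₃ }

lemma cover' (h : G.IsTripleCut s₁ s₂ s₃ A B) (w : V) :
    w = s₁ ∨ w = s₂ ∨ w = s₃ ∨ w ∈ A ∨ w ∈ B := by
  have := h.cover w
  simp only [Finset.mem_insert, Finset.mem_singleton] at this
  tauto

lemma ne_of_mem_left (h : G.IsTripleCut s₁ s₂ s₃ A B) {w : V} (hw : w ∈ A) :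
    w ≠ s₁ ∧ w ≠ s₂ ∧ w ≠ s₃ := by
  refine ⟨?_, ?_, ?_⟩ <;> rintro rfl <;> exact h.notMem_left w (by simp) hw

lemma clique_left (h : G.IsTripleCut s₁ s₂ s₃ A B) (hcf : G.ClawFreeOn Finset.univ) {a a' : V}
    (ha : a ∈ A) (ha' : a' ∈ A) (h₁ : G.Adj s₁ a) (h₁' : G.Adj s₁ a') (hne : a ≠ a') :
    G.Adj a a' := by
  obtain ⟨b, hb, hsb⟩ := h.adj_right₁
  exact h.adj_of_adj hcf ha ha' hb h₁ h₁' hsb hne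

lemma not_adj_all (h : G.IsTripleCut s₁ s₂ s₃ A B) (hcf : G.ClawFreeOn Finset.univ) (x : V) :
    ¬ (G.Adj s₁ x ∧ G.Adj s₂ x ∧ G.Adj s₃ x) := by
  rintro ⟨h₁, h₂, h₃⟩
  rcases hcf x (Finset.mem_univ _) s₁ (Finset.mem_univ _) s₂ (Finset.mem_univ _) s₃
    (Finset.mem_univ _) h₁.symm h₂.symm h₃.symm h.ne₁₂ h.ne₁₃ h.ne₂₃ with h' | h' | h'
  exacts [h.nadj₁₂ h', h.nadj₁₃ h', h.nadj₂₃ h']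

/-- If `A` is smallest possible, then a vertex `a` of `A` is adjacent to `s₁` or `s₂`: otherwise
one of the components for the triple `a`, `s₁`, `s₂` is a proper subset of `A`. -/
lemma adj_or_adj (h : G.IsTripleCut s₁ s₂ s₃ A B)
    (htri : ∀ x y z, x ≠ y → x ≠ z → y ≠ z → ¬ G.Adj x y → ¬ G.Adj x z → ¬ G.Adj y z →
      ∃ A B, G.IsTripleCut x y z A B)
    (hmin : ∀ x y z C D, G.IsTripleCut x y z C D → A.card ≤ C.card) {a : V} (ha : a ∈ A) :
    G.Adj s₁ a ∨ G.Adj s₂ a := by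
  by_contra! hn
  have hne := h.ne_of_mem_left ha
  obtain ⟨C, D, hCD⟩ := htri a s₁ s₂ hne.1 hne.2.1 h.ne₁₂ (fun h' ↦ hn.1 h'.symm)
    (fun h' ↦ hn.2 h'.symm) h.nadj₁₂
  have key : ∀ C D, G.IsTripleCut a s₁ s₂ C D → s₃ ∉ C → False := by
    intro C D hCD hs
    obtain ⟨b, hb, hsb⟩ := h.adj_right₃
    have hcon := h.connectedOn_right.insert_vertex hb hsb
    have hC : G.IsClosedPart (C ∪ D) C := hCD.isClosedPart_left le_rfl Finset.subset_union_left
    have hsub : insert s₃ B ⊆ C ∪ D := by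
      intro w hw
      have h1 := hCD.cover' w
      have h2 : w ∈ B → w ≠ s₁ ∧ w ≠ s₂ ∧ w ≠ s₃ := h.symm.ne_of_mem_left
      have h3 := h.disjoint a ha
      have h4 := h.ne₁₃
      have h5 := h.ne₂₃
      simp only [Finset.mem_insert, Finset.mem_union] at hw ⊢
      grind only
    have hCA : C ⊆ A \ {a} := by
      intro w hw
      have h1 := hCD.ne_of_mem_left hw
      have h2 := h.cover' w
      have h3 : w ≠ s₃ := fun h' ↦ hs (h' ▸ hw)
      have h4 : w ∉ B := fun hwB ↦ hs (hcon.subset_of_closedPart hsub hC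
        (Finset.mem_insert_of_mem hwB) hw (Finset.mem_insert_self _ _))
      simp only [Finset.mem_sdiff, Finset.mem_singleton]
      tauto
    have h1 := hmin _ _ _ C D hCD
    have h2 := Finset.card_le_card hCA
    have h3 := card_sdiff_single ha
    omega
  by_cases hs : s₃ ∈ C
  · exact key D C hCD.symm (hCD.disjoint s₃ hs)
  · exact key C D hCD hs

/-- If `a` is not adjacent to `s₃`, and `s₁` and `s₂` have distinct neighbours `p` and `q` other
than `a` in the clique `A`, then `a` is isolated by a matching of the rest of `A` together with
`s₁` and `s₂`. -/
lemma isClique_right (h : G.IsTripleCut s₁ s₂ s₃ A B) (hE : G.LeavesAtMostOne)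
    (hcf : G.ClawFreeOn Finset.univ) (hA : G.IsClique (A : Set V)) {a p q : V} (ha : a ∈ A)
    (hp : p ∈ A) (hq : q ∈ A) (hap : a ≠ p) (haq : a ≠ q) (hpq : p ≠ q) (hsp : G.Adj s₁ p)
    (hsq : G.Adj s₂ q) (hsa : ¬ G.Adj s₃ a) :
    G.IsClique ((insert s₃ B : Finset V) : Set V) := by
  have hm : G.Matchable (((A \ {p, q}) \ {a})) := matchable_of_isClique (hA.subset (by
    intro w
    simp only [Finset.coe_sdiff, Finset.coe_singleton, Set.mem_sdiff, Finset.mem_coe]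
    tauto)) (by
    have h1 := card_sdiff_pair hp hq hpq
    have h2 := card_sdiff_single (X := A \ {p, q}) (x := a) (by simp [ha, hap, haq])
    have h3 := h.odd_left
    grind only [= Nat.even_iff, = Nat.odd_iff])
  have n1 : s₁ ∉ A := h.notMem_left s₁ (by simp)
  have n2 : s₂ ∉ A := h.notMem_left s₂ (by simp)
  have n3 : s₃ ∉ A := h.notMem_left s₃ (by simp)
  have m1 : s₁ ∉ B := h.notMem_right s₁ (by simp)
  have m2 : s₂ ∉ B := h.notMem_right s₂ (by simp)
  have m3 : s₃ ∉ B := h.notMem_right s₃ (by simp)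
  have e1 := h.ne₁₂
  have e2 := h.ne₁₃
  have e3 := h.ne₂₃
  have e4 : s₁ ≠ q := fun h' ↦ n1 (h' ▸ hq)
  have e5 : s₂ ≠ p := fun h' ↦ n2 (h' ▸ hp)
  have e6 : s₁ ≠ a := fun h' ↦ n1 (h' ▸ ha)
  have e7 : s₂ ≠ a := fun h' ↦ n2 (h' ▸ ha)
  have e8 : s₃ ≠ a := fun h' ↦ n3 (h' ▸ ha)
  have hm' := (hm.insert_edge hsp (by simp [n1]) (by simp)).insert_edge hsq
    (by simp [n2, e1.symm, e5]) (by simp [e4.symm, hpq.symm])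
  have hR : G.RandomlyMatchable (insert s₃ B) := by
    refine hE.randomlyMatchable (v := a) hm' (fun w ↦ ?_) (fun w hw ↦ ?_) ?_ ?_ ?_
    · have := h.cover' w
      simp only [Finset.mem_sdiff, Finset.mem_insert, Finset.mem_singleton]
      tauto
    · have h2 := h.disjoint w
      have h3 := h.disjoint p hp
      have h4 := h.disjoint q hq
      simp only [Finset.mem_sdiff, Finset.mem_insert, Finset.mem_singleton, not_or] at hw ⊢
      rcases hw with rfl | rfl | rfl | rfl | hw
      · exact ⟨e3, m2⟩
      · exact ⟨fun h' ↦ n3 (h' ▸ hq), h4⟩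
      · exact ⟨e2, m1⟩
      · exact ⟨fun h' ↦ n3 (h' ▸ hp), h3⟩
      · exact ⟨fun h' ↦ n3 (h' ▸ hw.1.1), h2 hw.1.1⟩
    · simp [e7.symm, haq, e6.symm, hap]
    · simp [e8.symm, h.disjoint a ha]
    · intro w hw haw
      rcases Finset.mem_insert.mp hw with rfl | hw
      · exact hsa haw.symm
      · exact h.not_adj a ha w hw haw
  obtain ⟨b, hb, hsb⟩ := h.adj_right₃
  refine (hR.isClique_or_isFourCycle (h.connectedOn_right.insert_vertex hb hsb)
    (hcf.mono (Finset.subset_univ _))).resolve_right fun h4 ↦ ?_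
  obtain ⟨u, v, w, hX, -, huw, hsu, -, -, hws, -, hnuw⟩ :=
    h4.exists_rotation (Finset.mem_insert_self s₃ B)
  have hu : u ∈ insert s₃ B := by rw [hX]; simp
  have hw : w ∈ insert s₃ B := by rw [hX]; simp
  exact hnuw (h.swap'.swap.symm.clique_left hcf (Finset.mem_of_mem_insert_of_ne hu hsu.ne')
    (Finset.mem_of_mem_insert_of_ne hw hws.ne) hsu hws.symm huw)

end IsTripleCut

end TripleCut

section TripleCut

variable [Fintype V] {s₁ s₂ s₃ : V} {A B : Finset V}

namespace IsTripleCut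

/-- The vertex `a` of `A` is given with a vertex adjacent to `s₃` and any third vertex of `A`. -/
lemma exists_isClique_right (h : G.IsTripleCut s₁ s₂ s₃ A B) (hE : G.LeavesAtMostOne)
    (hcf : G.ClawFreeOn Finset.univ) (hA : G.IsClique (A : Set V))
    (h₁₂ : ∀ a ∈ A, G.Adj s₁ a ∨ G.Adj s₂ a) (h₁₃ : ∀ a ∈ A, G.Adj s₁ a ∨ G.Adj s₃ a)
    (h₂₃ : ∀ a ∈ A, G.Adj s₂ a ∨ G.Adj s₃ a) {a : V} (ha : a ∈ A) (ha₁ : G.Adj s₁ a)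
    (ha₂ : G.Adj s₂ a) :
    G.IsClique ((insert s₁ B : Finset V) : Set V) ∨
      G.IsClique ((insert s₂ B : Finset V) : Set V) ∨
      G.IsClique ((insert s₃ B : Finset V) : Set V) := by
  have ha₃ : ¬ G.Adj s₃ a := fun h' ↦ h.not_adj_all hcf a ⟨ha₁, ha₂, h'⟩
  obtain ⟨w, hw, hw₃⟩ := h.adj_left₃
  have haw : a ≠ w := fun h' ↦ ha₃ (h' ▸ hw₃)
  obtain ⟨x, hx, hxa, hxw⟩ := exists_third h.odd_left ha hw haw
  have hxall := h.not_adj_all hcf x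
  by_cases hx₃ : G.Adj s₃ x
  · rcases h₁₂ w hw with hw₁ | hw₂ <;> rcases h₁₂ x hx with hx₁ | hx₂
    · exact .inr (.inl (h.swap'.isClique_right hE hcf hA hx ha hw hxa hxw haw ha₁ hw₃
        fun h' ↦ hxall ⟨hx₁, h', hx₃⟩))
    · exact .inr (.inr (h.isClique_right hE hcf hA ha hw hx haw hxa.symm hxw.symm hw₁ hx₂ ha₃))
    · exact .inr (.inr (h.isClique_right hE hcf hA ha hx hw hxa.symm haw hxw hx₁ hw₂ ha₃))
    · exact .inl (h.swap.swap'.isClique_right hE hcf hA hx ha hw hxa hxw haw ha₂ hw₃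
        fun h' ↦ hxall ⟨h', hx₂, hx₃⟩)
  · have hx₁ := (h₁₃ x hx).resolve_right hx₃
    have hx₂ := (h₂₃ x hx).resolve_right hx₃
    rcases h₁₂ w hw with hw₁ | hw₂
    · exact .inr (.inr (h.isClique_right hE hcf hA ha hw hx haw hxa.symm hxw.symm hw₁ hx₂ ha₃))
    · exact .inr (.inr (h.isClique_right hE hcf hA ha hx hw hxa.symm haw hxw hx₁ hw₂ ha₃))

/-- Suppose that `s₁` is adjacent to all of `B`. The triple `a`, `b`, `s₃` separates the graph,
which restricts the neighbours of `s₂` and `s₁`. -/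
lemma unique_of_adj (h : G.IsTripleCut s₁ s₂ s₃ A B) (hE : G.LeavesAtMostOne)
    (hcf : G.ClawFreeOn Finset.univ) (hodd : Odd (Fintype.card V)) (hA : G.IsClique (A : Set V))
    (h₁₂ : ∀ a ∈ A, G.Adj s₁ a ∨ G.Adj s₂ a)
    (hB : G.IsClique ((insert s₁ B : Finset V) : Set V)) {a b : V} (ha : a ∈ A)
    (ha₁ : G.Adj s₁ a) (ha₂ : G.Adj s₂ a) (hb : b ∈ B) (hb₂ : G.Adj s₂ b) :
    (∀ b' ∈ B, G.Adj s₂ b' → b' = b) ∧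
      ((∀ a' ∈ A, G.Adj s₂ a' → a' = a) ∨ ∀ a' ∈ A, G.Adj s₁ a' → a' = a) := by
  have hane := h.ne_of_mem_left ha
  have hbne := h.symm.ne_of_mem_left hb
  have hs₁B : ∀ b ∈ B, G.Adj s₁ b := fun b hb ↦ hB (by simp) (by simp [hb])
    (h.symm.ne_of_mem_left hb).1.symm
  have ha₃ : ¬ G.Adj s₃ a := fun h' ↦ h.not_adj_all hcf a ⟨ha₁, ha₂, h'⟩
  have hb₃ : ¬ G.Adj s₃ b := fun h' ↦ h.not_adj_all hcf b ⟨hs₁B b hb, hb₂, h'⟩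
  have hab : a ≠ b := fun h' ↦ h.disjoint a ha (h' ▸ hb)
  have hn := hE.not_connectedOn_triple hcf hodd hab hane.2.2 hbne.2.2 (h.not_adj a ha b hb)
    (fun h' ↦ ha₃ h'.symm) (fun h' ↦ hb₃ h'.symm)
  have hK : G.ConnectedOn (insert s₁ (B \ {b})) := connectedOn_of_isClique (hB.subset (by
    intro w
    simp only [Finset.coe_insert, Finset.coe_sdiff, Set.mem_insert_iff, Set.mem_sdiff]
    tauto))
  have hL : G.ConnectedOn (A \ {a}) := connectedOn_of_isClique (hA.subset (by
    intro w
    simp only [Finset.coe_sdiff, Set.mem_sdiff]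
    tauto))
  have n1 := h.ne₁₂
  have n2 := h.ne₁₃
  have n3 := h.ne₂₃
  have heq : insert s₂ (insert s₁ (B \ {b})) ∪ A \ {a} = Finset.univ \ {a, b, s₃} := by
    ext w
    have h1 := h.cover' w
    have h2 : w ∈ A → _ := h.ne_of_mem_left
    have h3 : w ∈ B → _ := h.symm.ne_of_mem_left
    have h4 := h.disjoint w
    simp only [Finset.mem_union, Finset.mem_insert, Finset.mem_sdiff, Finset.mem_singleton,
      Finset.mem_univ, true_and]
    grind only
  rw [← heq] at hn
  refine ⟨fun b' hb' hb'₂ ↦ ?_, ?_⟩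
  · by_contra hbb'
    have hc := hK.insert_vertex (x := b') (y := s₂) (by simp [hb', hbb']) hb'₂
    obtain ⟨a', ha', hsa'⟩ := h.adj_left₃
    have haa' : a' ≠ a := fun h' ↦ ha₃ (h' ▸ hsa')
    have ha'L : a' ∈ A \ {a} := by simp [ha', haa']
    rcases h₁₂ a' ha' with h' | h'
    · exact hn (hc.union hL (x := s₁) (by simp) ha'L (.inr h'))
    · exact hn (hc.union hL (x := s₂) (by simp) ha'L (.inr h'))
  · by_contra! hnn
    obtain ⟨⟨a', ha', ha'₂, hne'⟩, a'', ha'', ha''₁, hne''⟩ := hnn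
    have hc := hL.insert_vertex (x := a') (y := s₂) (by simp [ha', hne']) ha'₂
    have := hK.union hc (x := s₁) (y := a'') (by simp) (by simp [ha'', hne'']) (.inr ha''₁)
    refine hn ?_
    convert this using 1
    ext w
    simp only [Finset.mem_union, Finset.mem_insert]
    tauto

/-- The case in which `s₁` is adjacent to all of `B` and has a common neighbour with `s₂` in `A`. -/
lemma memG3_of_adj (h : G.IsTripleCut s₁ s₂ s₃ A B) (hE : G.LeavesAtMostOne)
    (hc : G.ConnectedOn Finset.univ) (hcf : G.ClawFreeOn Finset.univ)
    (hodd : Odd (Fintype.card V)) (hA : G.IsClique (A : Set V))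
    (h₁₂ : ∀ a ∈ A, G.Adj s₁ a ∨ G.Adj s₂ a) (h₁₃ : ∀ a ∈ A, G.Adj s₁ a ∨ G.Adj s₃ a)
    (h₂₃ : ∀ a ∈ A, G.Adj s₂ a ∨ G.Adj s₃ a)
    (hB : G.IsClique ((insert s₁ B : Finset V) : Set V)) {a : V} (ha : a ∈ A)
    (ha₁ : G.Adj s₁ a) (ha₂ : G.Adj s₂ a) : G.MemG3 := by
  have hs₁B : ∀ b ∈ B, G.Adj s₁ b := fun b hb ↦ hB (by simp) (by simp [hb])
    (h.symm.ne_of_mem_left hb).1.symm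
  have hBc : G.ConnectedOn (insert s₁ B) := connectedOn_of_isClique hB
  -- a vertex of `B` adjacent to neither `s₂` nor `s₃` would form an independent triple with them,
  -- whose complement is connected
  have hB₂₃ : ∀ b ∈ B, G.Adj s₂ b ∨ G.Adj s₃ b := by
    intro b hb
    by_contra! hn
    have hbne := h.symm.ne_of_mem_left hb
    refine hE.not_connectedOn_triple hcf hodd hbne.2.1 hbne.2.2 h.ne₂₃ (fun h' ↦ hn.1 h'.symm)
      (fun h' ↦ hn.2 h'.symm) h.nadj₂₃ ?_
    have hK : G.ConnectedOn (insert s₁ (B \ {b})) := connectedOn_of_isClique (hB.subset (by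
      intro w
      simp only [Finset.coe_insert, Finset.coe_sdiff, Set.mem_insert_iff, Set.mem_sdiff]
      tauto))
    convert hK.union h.connectedOn_left (x := s₁) (by simp) ha (.inr ha₁) using 1
    ext w
    have h1 := h.cover' w
    have h2 : w ∈ A → _ := h.ne_of_mem_left
    have h3 : w ∈ B → _ := h.symm.ne_of_mem_left
    have h4 := h.disjoint w
    have n1 := h.ne₁₂
    have n2 := h.ne₁₃
    simp only [Finset.mem_union, Finset.mem_insert, Finset.mem_sdiff, Finset.mem_singleton,
      Finset.mem_univ, true_and]
    grind only
  have hall := h.not_adj_all hcf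
  obtain ⟨b, hb, hb₂⟩ := h.adj_right₂
  obtain ⟨b₃, hb₃, hs₃⟩ := h.adj_right₃
  obtain ⟨hub, hua⟩ := h.unique_of_adj hE hcf hodd hA h₁₂ hB ha ha₁ ha₂ hb hb₂
  have hbb₃ : b ≠ b₃ := fun h' ↦ hall b ⟨hs₁B b hb, hb₂, h' ▸ hs₃⟩
  obtain ⟨b₄, hb₄, hb₄b, hb₄₃⟩ := exists_third h.odd_right hb hb₃ hbb₃
  have hs₄ : G.Adj s₃ b₄ := (hB₂₃ b₄ hb₄).resolve_left fun h' ↦ hb₄b (hub b₄ hb₄ h')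
  have hno : ∀ a' ∈ A, G.Adj s₁ a' → ¬ G.Adj s₃ a' := fun a' ha' h1 h3 ↦
    hb₄₃ ((h.swap'.unique_of_adj hE hcf hodd hA h₁₃ hB ha' h1 h3 hb₃ hs₃).1 b₄ hb₄ hs₄)
  have hs₂A : ∀ a' ∈ A, G.Adj s₂ a' := fun a' ha' ↦
    (h₁₂ a' ha').elim (fun h1 ↦ (h₂₃ a' ha').resolve_right (hno a' ha' h1)) id
  obtain ⟨a₃, ha₃, hsa₃⟩ := h.adj_left₃
  replace hua := hua.resolve_left fun h' ↦ hno a ha ha₁ (h' a₃ ha₃ (hs₂A a₃ ha₃) ▸ hsa₃)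
  obtain ⟨p, hp⟩ := h.odd_left
  obtain ⟨q, hq⟩ := h.odd_right
  have n1 : ∀ {u v}, ¬ G.Adj u v → ¬ G.Adj v u := fun h h' ↦ h h'.symm
  have hset : ((({s₂, s₁, s₃} : Finset V)) : Set V) = {s₂, s₁, s₃} := by simp
  refine ⟨s₂, s₁, s₃, A, B, p, q, h.ne₁₂.symm, h.ne₂₃, h.ne₁₃, n1 h.nadj₁₂, h.nadj₂₃, h.nadj₁₃,
    ?_, ?_, ⟨hA, ?_⟩, ⟨hB.subset (by simp), ?_⟩, a, ha, b, hb, ?_, ?_, ?_⟩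
  · have := h.swap.isMinimalCutSet (connected_iff_connectedOn_univ.mpr ⟨hc, ⟨a⟩⟩)
      h.connectedOn_left h.connectedOn_right
      (by simpa using ⟨h.adj_left₂, h.adj_left₁, h.adj_left₃⟩)
      (by simpa using ⟨h.adj_right₂, h.adj_right₁, h.adj_right₃⟩)
    rwa [hset] at this
  · have := h.swap.hasTwoComponents h.connectedOn_left h.connectedOn_right
    rwa [hset] at this
  · rw [Set.ncard_coe_finset]; omega
  · rw [Set.ncard_coe_finset]; omega
  · ext w
    simp only [mem_neighborSet, Set.mem_union, Finset.mem_coe, Set.mem_singleton_iff]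
    constructor
    · intro hw
      rcases h.cover' w with rfl | rfl | rfl | h' | h'
      · exact absurd hw.symm h.nadj₁₂
      · exact absurd hw G.irrefl
      · exact absurd hw h.nadj₂₃
      · exact .inl h'
      · exact .inr (hub w h' hw)
    · rintro (h' | rfl)
      · exact hs₂A w h'
      · exact hb₂
  · ext w
    simp only [mem_neighborSet, Set.mem_union, Finset.mem_coe, Set.mem_singleton_iff]
    constructor
    · intro hw
      rcases h.cover' w with rfl | rfl | rfl | h' | h'
      · exact absurd hw G.irrefl
      · exact absurd hw h.nadj₁₂
      · exact absurd hw h.nadj₁₃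
      · exact .inr (hua w h' hw)
      · exact .inl h'
    · rintro (h' | rfl)
      · exact hs₁B w h'
      · exact ha₁
  · ext w
    simp only [mem_neighborSet, Set.mem_union, Finset.mem_coe, Set.mem_singleton_iff,
      Set.mem_sdiff, Set.mem_insert_iff, not_or]
    constructor
    · intro hw
      refine ⟨?_, fun h' ↦ hno a ha ha₁ (h' ▸ hw), fun h' ↦ hall b ⟨hs₁B b hb, hb₂, h' ▸ hw⟩⟩
      rcases h.cover' w with rfl | rfl | rfl | h' | h'
      · exact absurd hw.symm h.nadj₁₃
      · exact absurd hw.symm h.nadj₂₃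
      · exact absurd hw G.irrefl
      · exact .inl h'
      · exact .inr h'
    · rintro ⟨h' | h', hwa, hwb⟩
      · exact (h₁₃ w h').resolve_left fun h1 ↦ hwa (hua w h' h1)
      · exact (hB₂₃ w h').resolve_left fun h1 ↦ hwb (hub w h' h1)

lemma memG3_of_isClique_right (h : G.IsTripleCut s₁ s₂ s₃ A B) (hE : G.LeavesAtMostOne)
    (hc : G.ConnectedOn Finset.univ) (hcf : G.ClawFreeOn Finset.univ)
    (hodd : Odd (Fintype.card V)) (hA : G.IsClique (A : Set V))
    (h₁₂ : ∀ a ∈ A, G.Adj s₁ a ∨ G.Adj s₂ a) (h₁₃ : ∀ a ∈ A, G.Adj s₁ a ∨ G.Adj s₃ a)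
    (h₂₃ : ∀ a ∈ A, G.Adj s₂ a ∨ G.Adj s₃ a)
    (hB : G.IsClique ((insert s₁ B : Finset V) : Set V)) : G.MemG3 := by
  obtain ⟨a, ha, ha₁⟩ := h.adj_left₁
  rcases h₂₃ a ha with ha₂ | ha₃
  · exact h.memG3_of_adj hE hc hcf hodd hA h₁₂ h₁₃ h₂₃ hB ha ha₁ ha₂
  · exact h.swap'.memG3_of_adj hE hc hcf hodd hA h₁₃ h₁₂ (fun a ha ↦ (h₂₃ a ha).symm) hB ha ha₁ ha₃

/-- If all independent triples are cut sets with two odd components, and `A` is the smallest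
of all these components, then each vertex of `A` is adjacent to exactly two vertices of the
triple. Hence `A` is a clique, and the structure of the graph follows. -/
lemma memG3_of_minimal (h : G.IsTripleCut s₁ s₂ s₃ A B) (hE : G.LeavesAtMostOne)
    (hc : G.ConnectedOn Finset.univ) (hcf : G.ClawFreeOn Finset.univ)
    (hodd : Odd (Fintype.card V))
    (htri : ∀ x y z, x ≠ y → x ≠ z → y ≠ z → ¬ G.Adj x y → ¬ G.Adj x z → ¬ G.Adj y z →
      ∃ A B, G.IsTripleCut x y z A B)
    (hmin : ∀ x y z C D, G.IsTripleCut x y z C D → A.card ≤ C.card) : G.MemG3 := by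
  have h₁₂ : ∀ a ∈ A, G.Adj s₁ a ∨ G.Adj s₂ a := fun a ha ↦ h.adj_or_adj htri hmin ha
  have h₁₃ : ∀ a ∈ A, G.Adj s₁ a ∨ G.Adj s₃ a := fun a ha ↦ h.swap'.adj_or_adj htri hmin ha
  have h₂₃ : ∀ a ∈ A, G.Adj s₂ a ∨ G.Adj s₃ a := fun a ha ↦ h.swap.swap'.adj_or_adj htri hmin ha
  have h₂₁ : ∀ a ∈ A, G.Adj s₂ a ∨ G.Adj s₁ a := fun a ha ↦ (h₁₂ a ha).symm
  have h₃₁ : ∀ a ∈ A, G.Adj s₃ a ∨ G.Adj s₁ a := fun a ha ↦ (h₁₃ a ha).symm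
  have h₃₂ : ∀ a ∈ A, G.Adj s₃ a ∨ G.Adj s₂ a := fun a ha ↦ (h₂₃ a ha).symm
  have hA : G.IsClique (A : Set V) := by
    intro x hx y hy hxy
    have h1 := fun h1 h2 ↦ h.clique_left hcf hx hy h1 h2 hxy
    have h2 := fun h1 h2 ↦ h.swap.clique_left hcf hx hy h1 h2 hxy
    have h3 := fun h1 h2 ↦ h.swap'.swap.clique_left hcf hx hy h1 h2 hxy
    rcases h₁₂ x hx with hx' | hx' <;> rcases h₁₂ y hy with hy' | hy' <;>
      rcases h₁₃ x hx with hx'' | hx'' <;> rcases h₁₃ y hy with hy'' | hy'' <;>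
      rcases h₂₃ x hx with hx₃ | hx₃ <;> rcases h₂₃ y hy with hy₃ | hy₃ <;> tauto
  obtain ⟨a, ha, ha₁⟩ := h.adj_left₁
  have hex : G.IsClique ((insert s₁ B : Finset V) : Set V) ∨
      G.IsClique ((insert s₂ B : Finset V) : Set V) ∨
      G.IsClique ((insert s₃ B : Finset V) : Set V) := by
    rcases h₂₃ a ha with ha₂ | ha₃
    · exact h.exists_isClique_right hE hcf hA h₁₂ h₁₃ h₂₃ ha ha₁ ha₂
    · have := h.swap'.exists_isClique_right hE hcf hA h₁₃ h₁₂ h₃₂ ha ha₁ ha₃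
      tauto
  rcases hex with h' | h' | h'
  · exact h.memG3_of_isClique_right hE hc hcf hodd hA h₁₂ h₁₃ h₂₃ h'
  · exact h.swap.memG3_of_isClique_right hE hc hcf hodd hA h₂₁ h₂₃ h₁₃ h'
  · exact h.swap'.swap.memG3_of_isClique_right hE hc hcf hodd hA h₃₁ h₃₂ h₁₂ h'

end IsTripleCut

theorem memG3_of_hasIndepTriple (hE : G.LeavesAtMostOne)
    (hc : G.ConnectedOn Finset.univ) (hcf : G.ClawFreeOn Finset.univ)
    (hodd : Odd (Fintype.card V)) (hN : G.HasNoCutVertex)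
    (hno : ∀ s₁ s₂ z A B, ¬ G.IsTwoCut s₁ s₂ z A B) (hT : G.HasIndepTriple) : G.MemG3 := by
  have htri : ∀ x y z, x ≠ y → x ≠ z → y ≠ z → ¬ G.Adj x y → ¬ G.Adj x z → ¬ G.Adj y z →
      ∃ A B, G.IsTripleCut x y z A B := fun x y z ↦ exists_isTripleCut hE hodd hN hc hcf hno
  obtain ⟨x, y, z, h1, h2, h3, h4, h5, h6⟩ := hT
  obtain ⟨A, B, h⟩ := htri x y z h1 h2 h3 h4 h5 h6
  clear h1 h2 h3 h4 h5 h6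
  -- pass to smaller components as long as possible
  induction hn : A.card using Nat.strong_induction_on generalizing x y z A B with
  | _ n ih =>
    by_cases hmin : ∀ x y z C D, G.IsTripleCut x y z C D → A.card ≤ C.card
    · exact h.memG3_of_minimal hE hc hcf hodd htri hmin
    · push Not at hmin
      obtain ⟨x', y', z', C, D, hCD, hlt⟩ := hmin
      exact ih C.card (hn ▸ hlt) x' y' z' C D hCD rfl

end TripleCut

/-! ### The structure of connected claw-free equimatchable graphs -/

section Forward

variable [Fintype V]

lemma exists_separates_of_not_connectedOn {v : V} (h : ¬ G.ConnectedOn (Finset.univ \ {v})) :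
    ∃ A B, G.Separates {v} A B := by
  obtain ⟨C, D, hC, hD, hdis, hCD, hno⟩ := not_connectedOn_iff.mp h
  have hmem : ∀ w, (w ∈ C ∨ w ∈ D) ↔ w ≠ v := fun w ↦ by
    simpa using Finset.ext_iff.mp hCD w
  exact ⟨C, D,
    { cover := fun w ↦ by
        have := hmem w
        rw [Finset.mem_singleton]
        tauto
      notMem_left := fun w hw hwC ↦ (hmem w).mp (.inl hwC) (Finset.mem_singleton.mp hw)
      notMem_right := fun w hw hwD ↦ (hmem w).mp (.inr hwD) (Finset.mem_singleton.mp hw)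
      disjoint := fun w hwC hwD ↦ Finset.disjoint_left.mp hdis hwC hwD
      not_adj := hno
      nonempty_left := hC
      nonempty_right := hD }⟩

lemma LeavesAtMostOne.randomlyMatchable_univ (hE : G.LeavesAtMostOne)
    (heven : Even (Fintype.card V)) : G.RandomlyMatchable Finset.univ := by
  intro F _ hm hI
  have hI' : ∀ x ∉ F, ∀ y ∉ F, ¬ G.Adj x y := fun x hx y hy ↦
    hI x (by simp [hx]) y (by simp [hy])
  have h1 := hE F hm hI'
  have h2 := hm.even_card
  have h3 := Finset.card_sdiff_add_card_eq_card (Finset.subset_univ F)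
  rw [Finset.card_univ] at h3
  have h4 : (Finset.univ \ F).card ≤ 1 := Finset.card_le_one.mpr fun x hx y hy ↦
    h1 x (Finset.mem_sdiff.mp hx).2 y (Finset.mem_sdiff.mp hy).2
  have h5 : (Finset.univ \ F).card = 0 := by grind only [= Nat.even_iff]
  rw [Finset.card_eq_zero, Finset.sdiff_eq_empty_iff_subset] at h5
  exact Finset.Subset.antisymm (Finset.subset_univ F) h5

lemma hasIndepTriple_of_lt_indepNum (h : 2 < G.indepNum) : G.HasIndepTriple := by
  obtain ⟨s, hs⟩ := G.exists_isNIndepSet_indepNum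
  obtain ⟨t, hts, ht⟩ := Finset.exists_subset_card_eq (s := s) (n := 3) (by rw [hs.2]; omega)
  obtain ⟨x, y, z, hxy, hxz, hyz, rfl⟩ := Finset.card_eq_three.mp ht
  have hx := hts (show x ∈ _ by simp)
  have hy := hts (show y ∈ _ by simp)
  have hz := hts (show z ∈ _ by simp)
  exact ⟨x, y, z, hxy, hxz, hyz, hs.1 hx hy hxy, hs.1 hx hz hxz, hs.1 hy hz hyz⟩

theorem LeavesAtMostOne.classification (hE : G.LeavesAtMostOne)
    (hG : G.Connected) (hcf : G.ClawFreeOn Finset.univ) :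
    Nonempty (G ≃g cycleGraph 4) ∨
      (∃ p : ℕ, 1 ≤ p ∧ Nonempty (G ≃g completeGraph (Fin (2 * p)))) ∨
      (G.Connected ∧ Odd (Nat.card V) ∧ G.indepNum ≤ 2) ∨
      G.MemG1 ∨
      (G.MemG21 ∨ G.MemG22 ∨ G.MemG23 ∨ Nonempty (G ≃g cycleGraph 7)) ∨
      G.MemG3 := by
  obtain ⟨hc, hV⟩ := connected_iff_connectedOn_univ.mp hG
  rcases Nat.even_or_odd (Fintype.card V) with hev | hodd
  · rcases (hE.randomlyMatchable_univ hev).isClique_or_isFourCycle hc hcf with hK | h4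
    · obtain ⟨p, hp⟩ := hev
      have := Fintype.card_pos (α := V)
      refine .inr (.inl ⟨p, by omega, ?_⟩)
      obtain rfl : G = ⊤ := by
        ext x y
        exact ⟨fun h ↦ h.ne, fun h ↦ hK (by simp) (by simp) h⟩
      exact ⟨Iso.completeGraph (Fintype.equivFinOfCardEq (by omega))⟩
    · obtain ⟨f⟩ := isFourCycle_iff_inducesC4.mp h4
      rw [Finset.coe_univ] at f
      exact .inl ⟨(induceUnivIso G).symm.trans f⟩
  rcases Nat.lt_or_ge 2 G.indepNum with hI | hI
  swap
  · exact .inr (.inr (.inl ⟨hG, by rwa [Nat.card_eq_fintype_card], hI⟩))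
  have hT := hasIndepTriple_of_lt_indepNum hI
  by_cases hN : G.HasNoCutVertex
  swap
  · simp only [HasNoCutVertex, not_forall] at hN
    obtain ⟨v, hv⟩ := hN
    obtain ⟨A, B, h⟩ := exists_separates_of_not_connectedOn hv
    exact .inr (.inr (.inr (.inl (memG1_of_separates h hE hc hcf hT hodd))))
  by_cases hno : ∀ s₁ s₂ z A B, ¬ G.IsTwoCut s₁ s₂ z A B
  · exact .inr (.inr (.inr (.inr (.inr (memG3_of_hasIndepTriple hE hc hcf hodd hN hno hT)))))
  · push Not at hno
    obtain ⟨s₁, s₂, z, A, B, h⟩ := hno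
    exact .inr (.inr (.inr (.inr (.inl (h.memG2 hE hN hc hcf)))))

end Forward

/-! ### Criteria for the converse -/

/-- A graph is claw-free if every neighbourhood is covered by two cliques. -/
lemma clawFreeOn_of_two_cliques (h : ∀ x ∈ X, ∃ P : V → Prop, ∀ u w, G.Adj x u → G.Adj x w →
    u ≠ w → (P u ↔ P w) → G.Adj u w) : G.ClawFreeOn X := by
  intro x hx a _ b _ c _ hxa hxb hxc hab hac hbc
  obtain ⟨P, hP⟩ := h x hx
  have h1 := hP a b hxa hxb hab
  have h2 := hP a c hxa hxc hac
  have h3 := hP b c hxb hxc hbc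
  tauto

/-- A set `T` of odd size without edges to the rest of a matchable set `F` is not covered by
`F`. -/
lemma Matchable.exists_notMem_of_odd {F : Finset V} (hF : G.Matchable F)
    (hT : ∀ a ∈ T, ∀ b ∈ F, G.Adj a b → b ∈ T) (hodd : Odd T.card) : ∃ t ∈ T, t ∉ F := by
  by_contra! h
  have := (hF.of_closedPart ⟨h, hT⟩).even_card
  exact (Nat.not_even_iff_odd.mpr hodd) this

lemma randomlyMatchable_of_isClique (h : G.IsClique (X : Set V)) (hev : Even X.card) :
    G.RandomlyMatchable X := by
  intro F hF hm hI
  have h1 : (X \ F).card ≤ 1 := Finset.card_le_one.mpr fun x hx y hy ↦ by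
    by_contra hxy
    exact hI x hx y hy (h (Finset.mem_sdiff.mp hx).1 (Finset.mem_sdiff.mp hy).1 hxy)
  have h2 := hm.even_card
  have h3 := Finset.card_sdiff_add_card_eq_card hF
  have h4 : (X \ F).card = 0 := by grind only [= Nat.even_iff]
  rw [Finset.card_eq_zero, Finset.sdiff_eq_empty_iff_subset] at h4
  exact Finset.Subset.antisymm hF h4

lemma IsFourCycle.card_eq (h : G.IsFourCycle X) : X.card = 4 := by
  obtain ⟨a, b, c, d, rfl, hac, hbd, hab, hbc, hcd, hda, -, -⟩ := h
  have h1 := hab.ne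
  have h2 := hbc.ne
  have h3 := hcd.ne
  have h4 := hda.ne'
  rw [Finset.card_insert_of_notMem (by simp [h1, hac, h4]),
    Finset.card_insert_of_notMem (by simp [h2, hbd]), Finset.card_pair h3]

lemma IsFourCycle.randomlyMatchable (h : G.IsFourCycle X) : G.RandomlyMatchable X := by
  intro F hF hm hI
  by_contra hne
  have h1 := hm.even_card
  have h2 := Finset.card_sdiff_add_card_eq_card hF
  rw [h.card_eq] at h2
  have h3 : F.card < X.card := Finset.card_lt_card (hF.ssubset_of_ne hne)
  rw [h.card_eq] at h3
  -- an uncovered vertex leaves its two neighbours covered, and these are the only covered vertices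
  obtain ⟨x, hx, hxF⟩ : ∃ x ∈ X, x ∉ F := by
    by_contra! h'
    exact hne (Finset.Subset.antisymm hF h')
  obtain ⟨b, c, d, hX, hxc, hbd, hxb, -, -, hdx, -, hnbd⟩ := h.exists_rotation hx
  have hbX : b ∈ X := by rw [hX]; simp
  have hdX : d ∈ X := by rw [hX]; simp
  have hb : b ∈ F := by
    by_contra hb
    exact hI x (by simp [hx, hxF]) b (by simp [hbX, hb]) hxb
  have hd : d ∈ F := by
    by_contra hd
    exact hI d (by simp [hdX, hd]) x (by simp [hx, hxF]) hdx
  have h4 : F.card = 2 := by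
    have : 0 < F.card := Finset.card_pos.mpr ⟨b, hb⟩
    grind only [= Nat.even_iff]
  obtain ⟨y, hy, hby, -⟩ := hm.exists_mate hb
  obtain ⟨u, w, -, huw⟩ := Finset.card_eq_two.mp h4
  rw [huw] at hb hd hy
  simp only [Finset.mem_insert, Finset.mem_singleton] at hb hd hy
  have := hby.ne
  grind only

lemma IsFourCycle.connectedOn (h : G.IsFourCycle X) : G.ConnectedOn X := by
  obtain ⟨a, b, c, d, rfl, -, -, hab, hbc, hcd, -, -, -⟩ := h
  exact (((connectedOn_singleton d).insert_vertex (by simp) hcd).insert_vertex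
    (by simp) hbc).insert_vertex (by simp) hab

section Backward

variable [Fintype V]

lemma RandomlyMatchable.leavesAtMostOne (h : G.RandomlyMatchable Finset.univ) :
    G.LeavesAtMostOne := by
  intro F hm hI x hx
  have := h F (Finset.subset_univ _) hm fun x hx y hy ↦
    hI x (Finset.mem_sdiff.mp hx).2 y (Finset.mem_sdiff.mp hy).2
  exact absurd (this ▸ Finset.mem_univ x) hx

/-- In a graph of odd order, a matching that leaves two vertices uncovered leaves at least three
vertices uncovered. -/
lemma leavesAtMostOne_of_odd (hodd : Odd (Fintype.card V))
    (h : ∀ F, G.Matchable F → (∀ x ∉ F, ∀ y ∉ F, ¬ G.Adj x y) →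
      ∀ x ∉ F, ∀ y ∉ F, ∀ z ∉ F, x ≠ y → x ≠ z → y ≠ z → False) : G.LeavesAtMostOne := by
  intro F hm hI x hx y hy
  by_contra hxy
  have h1 := Finset.card_sdiff_add_card_eq_card (Finset.subset_univ F)
  rw [Finset.card_univ] at h1
  have h2 := hm.even_card
  obtain ⟨z, hz, hzx, hzy⟩ := exists_third (X := Finset.univ \ F) (x := x) (y := y)
    (by grind only [= Nat.even_iff, = Nat.odd_iff]) (by simp [hx]) (by simp [hy]) hxy
  exact h F hm hI x hx y hy z (Finset.mem_sdiff.mp hz).2 hxy (Ne.symm hzx) (Ne.symm hzy)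

/-- In a graph of odd order, it suffices to find a partition of the vertices into two sets such that
no matching with independent complement leaves two vertices of the same set uncovered. -/
lemma leavesAtMostOne_of_two_sets (hodd : Odd (Fintype.card V)) (P : V → Prop)
    (h : ∀ F, G.Matchable F → (∀ x ∉ F, ∀ y ∉ F, ¬ G.Adj x y) →
      ∀ u ∉ F, ∀ w ∉ F, u ≠ w → ¬ (P u ↔ P w)) : G.LeavesAtMostOne := by
  refine leavesAtMostOne_of_odd hodd fun F hF hI x hx y hy z hz hxy hxz hyz ↦ ?_
  have h1 := h F hF hI x hx y hy hxy
  have h2 := h F hF hI x hx z hz hxz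
  have h3 := h F hF hI y hy z hz hyz
  tauto

lemma leavesAtMostOne_of_indepNum_le (hodd : Odd (Fintype.card V)) (h : G.indepNum ≤ 2) :
    G.LeavesAtMostOne := by
  refine leavesAtMostOne_of_odd hodd fun F _ hI x hx y hy z hz hxy hxz hyz ↦ ?_
  have hs : G.IsIndepSet (({x, y, z} : Finset V) : Set V) := by
    intro u hu w hw _
    refine hI u ?_ w ?_ <;> intro h' <;>
      simp only [Finset.coe_insert, Finset.coe_singleton, Set.mem_insert_iff,
        Set.mem_singleton_iff] at hu hw
    · rcases hu with rfl | rfl | rfl <;> contradiction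
    · rcases hw with rfl | rfl | rfl <;> contradiction
  have h1 := hs.card_le_indepNum
  have h2 : ({x, y, z} : Finset V).card = 3 :=
    Finset.card_eq_three.mpr ⟨x, y, z, hxy, hxz, hyz, rfl⟩
  omega

lemma clawFreeOn_of_indepNum_le (h : G.indepNum ≤ 2) : G.ClawFreeOn Finset.univ := by
  intro x _ a _ b _ c _ _ _ _ hab hac hbc
  by_contra! hn
  obtain ⟨n1, n2, n3⟩ := hn
  have n4 : ¬ G.Adj b a := fun h ↦ n1 h.symm
  have n5 : ¬ G.Adj c a := fun h ↦ n2 h.symm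
  have n6 : ¬ G.Adj c b := fun h ↦ n3 h.symm
  have hs : G.IsIndepSet (({a, b, c} : Finset V) : Set V) := by
    intro u hu w hw huw
    simp only [Finset.coe_insert, Finset.coe_singleton, Set.mem_insert_iff,
      Set.mem_singleton_iff] at hu hw
    rcases hu with rfl | rfl | rfl <;> rcases hw with rfl | rfl | rfl <;>
      first | contradiction | assumption
  have h1 := hs.card_le_indepNum
  have h2 : ({a, b, c} : Finset V).card = 3 :=
    Finset.card_eq_three.mpr ⟨a, b, c, hab, hac, hbc, rfl⟩
  omega

lemma HasTwoComponents.separates {A B : Finset V} (h : G.HasTwoComponents S A B) :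
    G.Separates S A B := by
  have hmem : ∀ w, (w ∈ A ∨ w ∈ B) ↔ w ∉ S := fun w ↦ by
    simpa using Set.ext_iff.mp h.union_eq w
  have hl := h.left_connected.nonempty
  have hr := h.right_connected.nonempty
  exact
    { cover := fun w ↦ by
        have := hmem w
        tauto
      notMem_left := fun w hw hwA ↦ (hmem w).mp (.inl hwA) hw
      notMem_right := fun w hw hwB ↦ (hmem w).mp (.inr hwB) hw
      disjoint := fun w hwA hwB ↦ Set.disjoint_left.mp h.disjoint hwA hwB
      not_adj := h.not_adj
      nonempty_left := hl.elim fun x ↦ ⟨x, x.2⟩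
      nonempty_right := hr.elim fun x ↦ ⟨x, x.2⟩ }

/-- The properties that characterise the families, with equimatchability stated for graphs that have
a matching covering all vertices or all vertices but one. -/
abbrev IsAdmissible (G : SimpleGraph V) : Prop :=
  G.Connected ∧ G.ClawFreeOn Finset.univ ∧ G.LeavesAtMostOne

lemma isAdmissible_of_iso_cycleGraph_four (f : G ≃g cycleGraph 4) :
    G.IsAdmissible := by
  have h4 : G.IsFourCycle Finset.univ := by
    rw [isFourCycle_iff_inducesC4, Finset.coe_univ]
    exact ⟨(induceUnivIso G).trans f⟩
  refine ⟨connected_iff_connectedOn_univ.mpr ⟨h4.connectedOn, ⟨f.symm 0⟩⟩, ?_,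
    h4.randomlyMatchable.leavesAtMostOne⟩
  refine clawFreeOn_of_two_cliques fun x hx ↦ ?_
  obtain ⟨b, c, d, hX, hxc, hbd, hxb, -, -, hdx, hnxc, -⟩ := h4.exists_rotation hx
  refine ⟨fun w ↦ w = b, fun u w hu hw huw huw' ↦ ?_⟩
  have key : ∀ u, G.Adj x u → u = b ∨ u = d := by
    intro u hu
    have h1 : u ∈ Finset.univ := Finset.mem_univ u
    rw [hX] at h1
    simp only [Finset.mem_insert, Finset.mem_singleton] at h1
    rcases h1 with rfl | rfl | rfl | rfl
    · exact absurd hu G.irrefl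
    · exact .inl rfl
    · exact absurd hu hnxc
    · exact .inr rfl
  have h1 := key u hu
  have h2 := key w hw
  grind only

lemma isAdmissible_of_iso_completeGraph {p : ℕ} (hp : 1 ≤ p)
    (f : G ≃g completeGraph (Fin (2 * p))) :
    G.IsAdmissible := by
  have hK : G.IsClique ((Finset.univ : Finset V) : Set V) := fun x _ y _ hxy ↦ by
    rw [← f.map_adj_iff]
    exact fun h ↦ hxy (f.injective h)
  refine ⟨connected_iff_connectedOn_univ.mpr ⟨connectedOn_of_isClique hK, ⟨f.symm ⟨0, by omega⟩⟩⟩,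
    fun x _ a _ b _ c _ _ _ _ hab _ _ ↦ .inl (hK (by simp) (by simp) hab), ?_⟩
  refine (randomlyMatchable_of_isClique hK ?_).leavesAtMostOne
  rw [Finset.card_univ, Fintype.card_congr f.toEquiv, Fintype.card_fin]
  exact even_two_mul p

lemma isAdmissible_of_iso_cycleGraph_seven (f : G ≃g cycleGraph 7) :
    G.IsAdmissible := by
  have hadj : ∀ i j : Fin 7, (cycleGraph 7).Adj i j ↔ j = i + 1 ∨ j = i - 1 := by decide
  have hG : ∀ x y, G.Adj x y ↔ f y = f x + 1 ∨ f y = f x - 1 := fun x y ↦ by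
    rw [← hadj, f.map_adj_iff]
  refine ⟨f.connected_iff.mpr cycleGraph_connected, ?_, ?_⟩
  · refine clawFreeOn_of_two_cliques fun x _ ↦
      ⟨fun w ↦ f w = f x + 1, fun u w hu hw huw h ↦ absurd (f.injective ?_) huw⟩
    rw [hG] at hu hw
    grind only
  · refine leavesAtMostOne_of_odd (by rw [Fintype.card_congr f.toEquiv]; decide)
      fun F hF hI x hx y hy z hz hxy hxz hyz ↦ ?_
    -- some vertex has both neighbours among three pairwise nonadjacent vertices
    have key : ∀ i j k : Fin 7, i ≠ j → i ≠ k → j ≠ k → (j ≠ i + 1 ∧ j ≠ i - 1) →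
        (k ≠ i + 1 ∧ k ≠ i - 1) → (k ≠ j + 1 ∧ k ≠ j - 1) →
        ∃ w, (w + 1 = i ∨ w + 1 = j ∨ w + 1 = k) ∧ (w - 1 = i ∨ w - 1 = j ∨ w - 1 = k) := by
      decide
    have hn : ∀ u ∉ F, ∀ w ∉ F, f w ≠ f u + 1 ∧ f w ≠ f u - 1 := fun u hu w hw ↦ by
      have := hI u hu w hw
      rw [hG] at this
      tauto
    obtain ⟨i, h1, h2⟩ := key (f x) (f y) (f z) (f.injective.ne hxy) (f.injective.ne hxz)
      (f.injective.ne hyz) (hn x hx y hy) (hn x hx z hz) (hn y hy z hz)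
    obtain ⟨w, rfl⟩ := f.surjective i
    have hF' : ∀ t, f t = f x ∨ f t = f y ∨ f t = f z → t ∉ F := by
      rintro t (h | h | h) <;> rw [f.injective h] <;> assumption
    have hout : ∀ t, G.Adj w t → t ∉ F := fun t ht ↦ hF' t (by
      rw [hG] at ht
      rcases ht with ht | ht <;> rw [ht]
      · tauto
      · tauto)
    by_cases hw : w ∈ F
    · obtain ⟨t, ht, hwt, -⟩ := hF.exists_mate hw
      exact hout t hwt ht
    · obtain ⟨t, ht⟩ := f.surjective (f w + 1)
      have hwt : G.Adj w t := (hG w t).mpr (.inl ht)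
      exact hI w hw t (hout t hwt) hwt

end Backward

/-! ### The families consist of claw-free equimatchable graphs -/

section Backward

variable [Fintype V]

/-- The properties of a side `A` of the cut vertex `v` in the family `𝒢₁`, where `A` is an even
clique or a four-cycle. -/
structure IsSide (G : SimpleGraph V) (v : V) (A : Finset V) : Prop where
  randomlyMatchable : G.RandomlyMatchable A
  even : Even A.card
  adj_of_triple : ∀ x ∈ A, ∀ y ∈ A, ∀ z ∈ A, x ≠ y → x ≠ z → y ≠ z →
    G.Adj x y ∨ G.Adj x z ∨ G.Adj y z
  clique : ∀ x ∈ A, ∀ y ∈ A, G.Adj v x → G.Adj v y → x ≠ y → G.Adj x y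
  exists_two_cliques : ∀ x ∈ A, ∃ P : V → Prop, ∀ u w, (u ∈ A ∨ u = v) → (w ∈ A ∨ w = v) →
    G.Adj x u → G.Adj x w → u ≠ w → (P u ↔ P w) → G.Adj u w

lemma isSide_of_isClique {v : V} {A : Finset V} (h : G.IsClique (A : Set V)) (hev : Even A.card) :
    G.IsSide v A where
  randomlyMatchable := randomlyMatchable_of_isClique h hev
  even := hev
  adj_of_triple x hx y hy _ _ hxy _ _ := .inl (h hx hy hxy)
  clique x hx y hy _ _ hxy := h hx hy hxy
  exists_two_cliques x _ := ⟨fun w ↦ w ∈ A, fun u w hu hw _ _ huw h' ↦ by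
    by_cases huA : u ∈ A
    · exact h huA (h'.mp huA) huw
    · exact absurd ((hu.resolve_left huA).trans (hw.resolve_left fun h1 ↦ huA (h'.mpr h1)).symm)
        huw⟩

/-- If the neighbours of `v` in a four-cycle are two adjacent vertices `p` and `q`, then one of the
two neighbours in the four-cycle of any of its vertices is adjacent to `v`. -/
lemma IsFourCycle.isSide {v p q : V} {A : Finset V} (h : G.IsFourCycle A) (hpq : G.Adj p q)
    (hN : ∀ w, G.Adj v w ∧ w ∈ A ↔ w = p ∨ w = q) : G.IsSide v A where
  randomlyMatchable := h.randomlyMatchable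
  even := by rw [h.card_eq]; decide
  adj_of_triple x hx y hy z hz hxy hxz hyz := by
    by_contra! hn
    obtain ⟨h1, -⟩ := h.of_not_adj hx hy hz hxy hn.1 hxz.symm hyz.symm
    exact hn.2.1 h1.symm
  clique x hx y hy hvx hvy hxy := by
    have h1 := (hN x).mp ⟨hvx, hx⟩
    have h2 := (hN y).mp ⟨hvy, hy⟩
    rcases h1 with rfl | rfl <;> rcases h2 with rfl | rfl
    exacts [absurd rfl hxy, hpq, hpq.symm, absurd rfl hxy]
  exists_two_cliques x hx := by
    refine ⟨fun w ↦ w = v ∨ G.Adj v w, fun u w hu hw hxu hxw huw huw' ↦ ?_⟩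
    have key : ∀ u ∈ A, ∀ w ∈ A, G.Adj x u → G.Adj x w → u ≠ w → G.Adj v u ∨ G.Adj v w := by
      intro u hu w hw hxu hxw huw
      obtain ⟨b, c, d, hX, -, -, -, -, -, -, hnxc, -⟩ := h.exists_rotation hx
      have hA : ∀ w ∈ A, w = x ∨ w = b ∨ w = c ∨ w = d := fun w hw ↦ by
        rw [hX] at hw
        simpa only [Finset.mem_insert, Finset.mem_singleton] using hw
      have hp := (hN p).mpr (.inl rfl)
      have hq := (hN q).mpr (.inr rfl)
      have e1 := hA u hu
      have e2 := hA w hw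
      have e3 := hA p hp.2
      have e4 := hA q hq.2
      have e5 := hpq.ne
      have e6 := hxu.ne
      have e7 := hxw.ne
      have e8 : ∀ w, G.Adj x w → w ≠ c := fun w hw h' ↦ hnxc (h' ▸ hw)
      have e9 := e8 u hxu
      have e10 := e8 w hxw
      have e11 : ¬ (p = x ∧ q = c) := fun h' ↦ hnxc (h'.1 ▸ h'.2 ▸ hpq)
      have e12 : ¬ (q = x ∧ p = c) := fun h' ↦ hnxc (h'.1 ▸ h'.2 ▸ hpq.symm)
      have h1 : u = p ∨ u = q ∨ w = p ∨ w = q := by grind only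
      rcases h1 with rfl | rfl | rfl | rfl
      exacts [.inl hp.1, .inl hq.1, .inr hp.1, .inr hq.1]
    by_cases huv : u = v
    · subst huv
      exact (huw'.mp (.inl rfl)).resolve_left huw.symm
    by_cases hwv : w = v
    · subst hwv
      exact ((huw'.mpr (.inl rfl)).resolve_left huw).symm
    have huA := hu.resolve_right huv
    have hwA := hw.resolve_right hwv
    have h2 : G.Adj v u ∧ G.Adj v w := by
      have := key u huA w hwA hxu hxw huw
      tauto
    have h3 := (hN u).mp ⟨h2.1, huA⟩
    have h4 := (hN w).mp ⟨h2.2, hwA⟩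
    rcases h3 with rfl | rfl <;> rcases h4 with rfl | rfl
    exacts [absurd rfl huw, hpq, hpq.symm, absurd rfl huw]

lemma MemG1.isAdmissible (h : G.MemG1) : G.IsAdmissible := by
  obtain ⟨v, A, B, hcut, h2, hside, -⟩ := h
  lift A to Finset V using A.toFinite
  lift B to Finset V using B.toFinite
  have hs : G.Separates {v} A B := HasTwoComponents.separates (by simpa using h2)
  have side : ∀ C : Finset V, (C : Set V) = A ∨ (C : Set V) = B → G.IsSide v C := by
    intro C hC
    obtain ⟨h3, h4⟩ := hside C hC
    rcases h3 with ⟨p, -, hK, hp⟩ | h3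
    · rw [Set.ncard_coe_finset] at hp
      exact isSide_of_isClique hK (hp ▸ even_two_mul p)
    · obtain ⟨x, y, hxy, hN⟩ := h4 h3
      exact (isFourCycle_iff_inducesC4.mpr h3).isSide hxy fun w ↦ by
        simpa [neighborsIn] using Set.ext_iff.mp hN w
  have hA := side A (.inl rfl)
  have hB := side B (.inr rfl)
  have hcov : ∀ w, w = v ∨ w ∈ A ∨ w ∈ B := fun w ↦ by simpa using hs.cover w
  have hnbr : ∀ {A B : Finset V}, G.Separates {v} A B → ∀ x ∈ A, ∀ w, G.Adj x w →
      w ∈ A ∨ w = v := by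
    intro A B hs x hx w hxw
    have h1 := hs.cover w
    have h2 := hs.not_adj x hx w
    rw [Finset.mem_singleton] at h1
    tauto
  have hodd : Odd (Fintype.card V) := by
    have h1 := hs.card_add
    rw [Finset.card_singleton] at h1
    have h3 := hA.even
    have h4 := hB.even
    grind only [= Nat.even_iff, = Nat.odd_iff]
  refine ⟨hcut.1.1, clawFreeOn_of_two_cliques fun x _ ↦ ?_, leavesAtMostOne_of_odd hodd ?_⟩
  · rcases hcov x with rfl | hx | hx
    · refine ⟨fun w ↦ w ∈ A, fun u w hu hw huw h' ↦ ?_⟩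
      by_cases huA : u ∈ A
      · exact hA.clique u huA w (h'.mp huA) hu hw huw
      · have huB := ((hcov u).resolve_left hu.ne').resolve_left huA
        have hwB := ((hcov w).resolve_left hw.ne').resolve_left fun h1 ↦ huA (h'.mpr h1)
        exact hB.clique u huB w hwB hu hw huw
    · obtain ⟨P, hP⟩ := hA.exists_two_cliques x hx
      exact ⟨P, fun u w hu hw ↦ hP u w (hnbr hs x hx u hu) (hnbr hs x hx w hw) hu hw⟩
    · obtain ⟨P, hP⟩ := hB.exists_two_cliques x hx
      exact ⟨P, fun u w hu hw ↦ hP u w (hnbr hs.symm x hx u hu) (hnbr hs.symm x hx w hw) hu hw⟩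
  · intro F hF hI x hx y hy z hz hxy hxz hyz
    -- a side without a vertex matched to `v` is covered
    have covered : ∀ {A B : Finset V}, G.Separates {v} A B → G.IsSide v A →
        ∀ F', G.Matchable F' → v ∉ F' → F' ∩ A = F ∩ A → A ⊆ F := by
      intro A B hs hA F' hF' hv heq
      have h1 : G.Matchable (F ∩ A) := by
        rw [← heq]
        refine hF'.of_closedPart ⟨Finset.inter_subset_left, fun a ha b hb hab ↦ ?_⟩
        rw [Finset.mem_inter] at ha ⊢
        exact ⟨hb, (hnbr hs a ha.2 b hab).resolve_right fun h' ↦ hv (h' ▸ hb)⟩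
      have h2 := hA.randomlyMatchable (F ∩ A) Finset.inter_subset_right h1 fun x hx y hy ↦ by
        simp only [Finset.mem_sdiff, Finset.mem_inter, not_and] at hx hy
        exact hI x (fun h ↦ hx.2 h hx.1) y (fun h ↦ hy.2 h hy.1)
      rw [← h2]
      exact Finset.inter_subset_left
    -- the vertices that are not covered are on the side of the mate of `v`
    have matched : ∀ {A B : Finset V}, G.Separates {v} A B → G.IsSide v A → G.IsSide v B →
        ∀ w ∈ A, v ∈ F → G.Matchable (F \ {v, w}) → False := by
      intro A B hs hA hB w hw hv hm
      have hBF := covered hs.symm hB _ hm (by simp) (by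
        ext t
        have h1 : t = w → t ∉ B := fun h' ↦ h' ▸ hs.disjoint w hw
        have h2 : t = v → t ∉ B := fun h' ↦ h' ▸ hs.notMem_right v (by simp)
        simp only [Finset.mem_inter, Finset.mem_sdiff, Finset.mem_insert, Finset.mem_singleton]
        tauto)
      have key : ∀ t ∉ F, t ∈ A := fun t ht ↦ by
        rcases hs.cover t with h1 | h1 | h1
        · exact absurd (Finset.mem_singleton.mp h1 ▸ hv) ht
        · exact h1
        · exact absurd (hBF h1) ht
      have := hA.adj_of_triple x (key x hx) y (key y hy) z (key z hz) hxy hxz hyz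
      have := hI x hx y hy
      have := hI x hx z hz
      have := hI y hy z hz
      tauto
    by_cases hv : v ∈ F
    · obtain ⟨w, hw, hvw, hm⟩ := hF.exists_mate hv
      rcases (hcov w).resolve_left hvw.ne' with hwA | hwB
      · exact matched hs hA hB w hwA hv hm
      · exact matched hs.symm hB hA w hwB hv hm
    · have hAF := covered hs hA F hF hv rfl
      have hBF := covered hs.symm hB F hF hv rfl
      have key : ∀ t ∉ F, t = v := fun t ht ↦
        (hcov t).resolve_right fun h' ↦ ht (h'.elim (@hAF t) (@hBF t))
      exact hxy ((key x hx).trans (key y hy).symm)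

end Backward

section Backward

variable [Fintype V]

lemma MemG21.isAdmissible (h : G.MemG21) : G.IsAdmissible := by
  obtain ⟨A, f, q, hrange, hq, ⟨hK, hcard⟩, hN, hN2, -, hN₂, hN₃⟩ := h
  lift A to Finset V using A.toFinite
  rw [Set.ncard_coe_finset] at hcard
  have hfA : ∀ i, f i ∉ A := fun i hi ↦ by
    have : f i ∈ Set.range f := ⟨i, rfl⟩
    rw [hrange] at this
    exact this (by simpa using hi)
  have hcov : ∀ w, w ∈ A ∨ w = f 0 ∨ w = f 1 ∨ w = f 2 ∨ w = f 3 := fun w ↦ by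
    by_cases hw : w ∈ A
    · exact .inl hw
    · have : w ∈ Set.range f := by rw [hrange]; simpa using hw
      obtain ⟨i, rfl⟩ := this
      fin_cases i <;> simp
  have hadj : ∀ i j, G.Adj (f i) (f j) ↔ (cycleGraph 4).Adj i j := fun i j ↦ f.map_adj_iff
  have h01 : G.Adj (f 0) (f 1) := (hadj 0 1).mpr (by decide)
  have h12 : G.Adj (f 1) (f 2) := (hadj 1 2).mpr (by decide)
  have h23 : G.Adj (f 2) (f 3) := (hadj 2 3).mpr (by decide)
  have h30 : G.Adj (f 3) (f 0) := (hadj 3 0).mpr (by decide)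
  have h02 : ¬ G.Adj (f 0) (f 2) := fun h ↦ absurd ((hadj 0 2).mp h) (by decide)
  have h13 : ¬ G.Adj (f 1) (f 3) := fun h ↦ absurd ((hadj 1 3).mp h) (by decide)
  have hN' : ∀ w ∈ A, G.Adj (f 0) w ↔ G.Adj (f 1) w := fun w hw ↦ by
    simpa [neighborsIn, hw] using Set.ext_iff.mp hN w
  have hN₂' : ∀ w ∈ A, ¬ G.Adj (f 2) w := fun w hw h' ↦ by
    simpa using (Set.ext_iff.mp hN₂ w).mp ⟨h', hw⟩
  have hN₃' : ∀ w ∈ A, ¬ G.Adj (f 3) w := fun w hw h' ↦ by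
    simpa using (Set.ext_iff.mp hN₃ w).mp ⟨h', hw⟩
  obtain ⟨a, ha₀, ha⟩ : (G.neighborsIn A (f 0)).Nonempty := by
    rw [← Set.ncard_pos (Set.toFinite _)]
    omega
  -- the neighbours of the four vertices of the cycle
  have n0 : ∀ w, G.Adj (f 0) w → w ∈ A ∨ w = f 1 ∨ w = f 3 := fun w hw ↦ by
    rcases hcov w with h | rfl | rfl | rfl | rfl
    exacts [.inl h, absurd hw G.irrefl, .inr (.inl rfl), absurd hw h02, .inr (.inr rfl)]
  have n1 : ∀ w, G.Adj (f 1) w → w ∈ A ∨ w = f 0 ∨ w = f 2 := fun w hw ↦ by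
    rcases hcov w with h | rfl | rfl | rfl | rfl
    exacts [.inl h, .inr (.inl rfl), absurd hw G.irrefl, .inr (.inr rfl), absurd hw h13]
  have n2 : ∀ w, G.Adj (f 2) w → w = f 1 ∨ w = f 3 := fun w hw ↦ by
    rcases hcov w with h | rfl | rfl | rfl | rfl
    exacts [absurd hw (hN₂' w h), absurd hw.symm h02, .inl rfl, absurd hw G.irrefl, .inr rfl]
  have n3 : ∀ w, G.Adj (f 3) w → w = f 0 ∨ w = f 2 := fun w hw ↦ by
    rcases hcov w with h | rfl | rfl | rfl | rfl
    exacts [absurd hw (hN₃' w h), .inl rfl, absurd hw.symm h13, .inr rfl, absurd hw G.irrefl]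
  have h4 : G.IsFourCycle {f 0, f 1, f 2, f 3} := ⟨_, _, _, _, rfl,
    f.injective.ne (by decide), f.injective.ne (by decide), h01, h12, h23, h30, h02, h13⟩
  have huniv : A ∪ {f 0, f 1, f 2, f 3} = Finset.univ := by
    ext w
    simpa [or_assoc, or_comm, or_left_comm] using hcov w
  have hodd : Odd (Fintype.card V) := by
    rw [← Finset.card_univ, ← huniv, Finset.card_union_of_disjoint, h4.card_eq, hcard]
    · exact ⟨q + 2, by ring⟩
    · rw [Finset.disjoint_left]
      intro w hw hw'
      simp only [Finset.mem_insert, Finset.mem_singleton] at hw'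
      rcases hw' with rfl | rfl | rfl | rfl <;> exact hfA _ hw
  refine ⟨connected_iff_connectedOn_univ.mpr ⟨?_, ⟨a⟩⟩, clawFreeOn_of_two_cliques fun x _ ↦ ?_,
    leavesAtMostOne_of_two_sets hodd (· ∈ A) ?_⟩
  · rw [← huniv]
    exact (connectedOn_of_isClique hK).union h4.connectedOn ha (y := f 0) (by simp)
      (.inr ha₀.symm)
  · rcases hcov x with hx | rfl | rfl | rfl | rfl
    · refine ⟨fun w ↦ w ∈ A, fun u w hu hw huw h' ↦ ?_⟩
      by_cases huA : u ∈ A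
      · exact hK huA (h'.mp huA) huw
      · have hwA : w ∉ A := fun h ↦ huA (h'.mpr h)
        have key : ∀ w ∉ A, G.Adj x w → w = f 0 ∨ w = f 1 := by
          intro w hwA hw
          rcases hcov w with h | h | h | rfl | rfl
          exacts [absurd h hwA, .inl h, .inr h, absurd hw.symm (hN₂' x hx),
            absurd hw.symm (hN₃' x hx)]
        rcases key u huA hu with rfl | rfl <;> rcases key w hwA hw with rfl | rfl
        exacts [absurd rfl huw, h01, h01.symm, absurd rfl huw]
    · refine ⟨fun w ↦ w = f 3, fun u w hu hw huw h' ↦ ?_⟩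
      rcases n0 u hu with h1 | rfl | rfl <;> rcases n0 w hw with h2 | rfl | rfl
      · exact hK h1 h2 huw
      · exact ((hN' u h1).mp hu).symm
      · exact absurd (h'.mpr rfl ▸ h1) (hfA 3)
      · exact (hN' w h2).mp hw
      · exact absurd rfl huw
      · exact absurd (h'.mpr rfl) huw
      · exact absurd (h'.mp rfl ▸ h2) (hfA 3)
      · exact absurd (h'.mp rfl).symm huw
      · exact absurd rfl huw
    · refine ⟨fun w ↦ w = f 2, fun u w hu hw huw h' ↦ ?_⟩
      rcases n1 u hu with h1 | rfl | rfl <;> rcases n1 w hw with h2 | rfl | rfl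
      · exact hK h1 h2 huw
      · exact ((hN' u h1).mpr hu).symm
      · exact absurd (h'.mpr rfl ▸ h1) (hfA 2)
      · exact (hN' w h2).mpr hw
      · exact absurd rfl huw
      · exact absurd (h'.mpr rfl) huw
      · exact absurd (h'.mp rfl ▸ h2) (hfA 2)
      · exact absurd (h'.mp rfl).symm huw
      · exact absurd rfl huw
    · refine ⟨fun w ↦ w = f 1, fun u w hu hw huw h' ↦ absurd ?_ huw⟩
      have := n2 u hu
      have := n2 w hw
      grind only
    · refine ⟨fun w ↦ w = f 0, fun u w hu hw huw h' ↦ absurd ?_ huw⟩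
      have := n3 u hu
      have := n3 w hw
      grind only
  · intro F hF hI u hu w hw huw huw'
    -- two opposite uncovered vertices of the cycle isolate one of the other two
    have no02 : f 0 ∉ F → f 2 ∉ F → False := by
      intro h0 h2
      by_cases h3 : f 3 ∈ F
      · obtain ⟨t, ht, h3t, -⟩ := hF.exists_mate h3
        rcases n3 t h3t with rfl | rfl <;> contradiction
      · exact hI _ h3 _ h0 h30
    have no13 : f 1 ∉ F → f 3 ∉ F → False := by
      intro h1 h3
      by_cases h2 : f 2 ∈ F
      · obtain ⟨t, ht, h2t, -⟩ := hF.exists_mate h2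
        rcases n2 t h2t with rfl | rfl <;> contradiction
      · exact hI _ h1 _ h2 h12
    have hn := hI u hu w hw
    by_cases huA : u ∈ A
    · exact hn (hK huA (huw'.mp huA) huw)
    rcases (hcov u).resolve_left huA with rfl | rfl | rfl | rfl <;>
      rcases (hcov w).resolve_left fun h ↦ huA (huw'.mpr h) with rfl | rfl | rfl | rfl
    exacts [huw rfl, hn h01, no02 hu hw, hn h30.symm, hn h01.symm, huw rfl, hn h12, no13 hu hw,
      no02 hw hu, hn h12.symm, huw rfl, hn h23, hn h30, no13 hw hu, hn h23.symm, huw rfl]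

lemma MemG22.isAdmissible (h : G.MemG22) : G.IsAdmissible := by
  obtain ⟨s₁, s₂, A, B, p, q, hne, hnadj, hcut, h2, -, ⟨hA, hAc⟩, ⟨hB, hBc⟩, hB₁, hB₂, -, hdis⟩ := h
  lift A to Finset V using A.toFinite
  lift B to Finset V using B.toFinite
  rw [Set.ncard_coe_finset] at hAc hBc
  have hs : G.Separates {s₁, s₂} A B := HasTwoComponents.separates (by simpa using h2)
  have hcov : ∀ w, w = s₁ ∨ w = s₂ ∨ w ∈ A ∨ w ∈ B := fun w ↦ by simpa [or_assoc] using hs.cover w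
  have h₁ : ∀ b ∈ B, G.Adj s₁ b := fun b hb ↦ ((Set.ext_iff.mp hB₁ b).mpr hb).1
  have h₂ : ∀ b ∈ B, G.Adj s₂ b := fun b hb ↦ ((Set.ext_iff.mp hB₂ b).mpr hb).1
  have hA₁₂ : ∀ a ∈ A, G.Adj s₁ a → ¬ G.Adj s₂ a := fun a ha h1 h2 ↦ by
    simpa using (Set.ext_iff.mp hdis a).mp ⟨⟨h1, ha⟩, h2, ha⟩
  have hodd : Odd (Fintype.card V) := by
    rw [← hs.card_add, Finset.card_pair hne, hAc, hBc]
    exact ⟨p + q + 1, by ring⟩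
  -- this applies to `s₁` and `s₂`, whose neighbours lie in `A` and `B`
  have hclique : ∀ s, (∀ w, G.Adj s w → w ∈ A ∨ w ∈ B) →
      ∃ P : V → Prop, ∀ u w, G.Adj s u → G.Adj s w → u ≠ w → (P u ↔ P w) → G.Adj u w := by
    intro s hN
    refine ⟨fun w ↦ w ∈ A, fun u w hu hw huw h' ↦ ?_⟩
    by_cases huA : u ∈ A
    · exact hA huA (h'.mp huA) huw
    · exact hB ((hN u hu).resolve_left huA) ((hN w hw).resolve_left fun h ↦ huA (h'.mpr h)) huw
  refine ⟨hcut.1.1, clawFreeOn_of_two_cliques fun x _ ↦ ?_,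
    leavesAtMostOne_of_two_sets hodd (· ∈ A) ?_⟩
  · rcases hcov x with rfl | rfl | hx | hx
    · refine hclique x fun w hw ↦ ?_
      rcases hcov w with rfl | rfl | h | h
      exacts [absurd hw G.irrefl, absurd hw hnadj, .inl h, .inr h]
    · refine hclique x fun w hw ↦ ?_
      rcases hcov w with rfl | rfl | h | h
      exacts [absurd hw.symm hnadj, absurd hw G.irrefl, .inl h, .inr h]
    · refine ⟨fun w ↦ w ∈ A, fun u w hu hw huw h' ↦ ?_⟩
      by_cases huA : u ∈ A
      · exact hA huA (h'.mp huA) huw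
      · have hwA : w ∉ A := fun h ↦ huA (h'.mpr h)
        have key : ∀ w ∉ A, G.Adj x w → w = s₁ ∨ w = s₂ := by
          intro w hwA hw
          have h1 := hcov w
          have h2 := hs.not_adj x hx w
          tauto
        have hx' := hA₁₂ x hx
        rcases key u huA hu with rfl | rfl <;> rcases key w hwA hw with rfl | rfl
        exacts [absurd rfl huw, absurd hw.symm (hx' hu.symm), absurd hu.symm (hx' hw.symm),
          absurd rfl huw]
    · refine ⟨fun w ↦ w = s₂, fun u w hu hw huw h' ↦ ?_⟩
      have key : ∀ w, G.Adj x w → w = s₁ ∨ w = s₂ ∨ w ∈ B := by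
        intro w hw
        have h1 := hcov w
        have h2 := fun h ↦ hs.not_adj w h x hx hw.symm
        tauto
      rcases key u hu with rfl | rfl | hu' <;> rcases key w hw with rfl | rfl | hw'
      · exact absurd rfl huw
      · exact absurd (h'.mpr rfl) huw
      · exact h₁ w hw'
      · exact absurd (h'.mp rfl).symm huw
      · exact absurd rfl huw
      · exact absurd (h'.mp rfl).symm huw
      · exact (h₁ u hu').symm
      · exact absurd (h'.mpr rfl) huw
      · exact hB hu' hw' huw
  · intro F hF hI u hu w hw huw huw'
    -- if `s₁` and `s₂` are not covered, then no matching covers `B`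
    have no : s₁ ∉ F → s₂ ∉ F → False := by
      intro h1 h2
      obtain ⟨b, hb, hbF⟩ := hF.exists_notMem_of_odd (T := B) (fun b hb w hw hbw ↦ by
        rcases hcov w with rfl | rfl | h | h
        · exact absurd hw h1
        · exact absurd hw h2
        · exact absurd hbw.symm (hs.not_adj w h b hb)
        · exact h) (hBc ▸ odd_two_mul_add_one q)
      exact hI s₁ h1 b hbF (h₁ b hb)
    have hn := hI u hu w hw
    by_cases huA : u ∈ A
    · exact hn (hA huA (huw'.mp huA) huw)
    have hwA : w ∉ A := fun h ↦ huA (huw'.mpr h)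
    rcases hcov u with rfl | rfl | h | h <;> rcases hcov w with rfl | rfl | h' | h'
    exacts [huw rfl, no hu hw, hwA h', hn (h₁ w h'), no hw hu, huw rfl, hwA h', hn (h₂ w h'),
      huA h, huA h, huA h, huA h, hn (h₁ u h).symm, hn (h₂ u h).symm, hwA h', hn (hB h h' huw)]

end Backward

section Backward

variable [Fintype V]

/-- If the nonadjacent vertices `s₁`, `s₂` and the adjacent vertices of `A` induce a path, then the
vertices of `A` are in the middle of it. -/
lemma exists_pair_of_iso_pathGraph {s₁ s₂ : V} {A : Finset V} (hne : s₁ ≠ s₂)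
    (hnadj : ¬ G.Adj s₁ s₂) (h₁ : s₁ ∉ A) (h₂ : s₂ ∉ A) (hA : G.IsClique (A : Set V))
    (hcard : A.card = 2) (f : G.induce ({s₁, s₂} ∪ (A : Set V)) ≃g pathGraph 4) :
    ∃ a₁ a₂, A = {a₁, a₂} ∧ G.Adj a₁ a₂ ∧ G.Adj s₁ a₁ ∧ G.Adj s₂ a₂ ∧ ¬ G.Adj s₁ a₂ ∧
      ¬ G.Adj s₂ a₁ := by
  obtain ⟨p, q, hpq, rfl⟩ := Finset.card_eq_two.mp hcard
  simp only [Finset.mem_insert, Finset.mem_singleton, not_or] at h₁ h₂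
  have hadj : ∀ i j : Fin 4, (pathGraph 4).Adj i j ↔ i.val + 1 = j.val ∨ j.val + 1 = i.val :=
    fun i j ↦ pathGraph_adj
  let W : Set V := {s₁, s₂} ∪ (({p, q} : Finset V) : Set V)
  have hG : ∀ u w : W, G.Adj u w ↔ (f u).val + 1 = (f w).val ∨ (f w).val + 1 = (f u).val :=
    fun u w ↦ by rw [← hadj, f.map_adj_iff]; rfl
  have hf : ∀ u w : W, (u : V) ≠ w → f u ≠ f w := fun u w h h' ↦
    h (congrArg Subtype.val (f.injective h'))
  let t₁ : W := ⟨s₁, by simp [W]⟩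
  let t₂ : W := ⟨s₂, by simp [W]⟩
  let p' : W := ⟨p, by simp [W]⟩
  let q' : W := ⟨q, by simp [W]⟩
  have key : ∀ i j k l : Fin 4, i ≠ j → i ≠ k → i ≠ l → j ≠ k → j ≠ l → k ≠ l →
      ¬ (i.val + 1 = j.val ∨ j.val + 1 = i.val) → (k.val + 1 = l.val ∨ l.val + 1 = k.val) →
      ((i.val + 1 = k.val ∨ k.val + 1 = i.val) ∧ (j.val + 1 = l.val ∨ l.val + 1 = j.val) ∧
        ¬ (i.val + 1 = l.val ∨ l.val + 1 = i.val) ∧ ¬ (j.val + 1 = k.val ∨ k.val + 1 = j.val)) ∨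
      ((i.val + 1 = l.val ∨ l.val + 1 = i.val) ∧ (j.val + 1 = k.val ∨ k.val + 1 = j.val) ∧
        ¬ (i.val + 1 = k.val ∨ k.val + 1 = i.val) ∧ ¬ (j.val + 1 = l.val ∨ l.val + 1 = j.val)) := by
    omega
  have hpq' : G.Adj p q := hA (by simp) (by simp) hpq
  have := key (f t₁) (f t₂) (f p') (f q') (hf t₁ t₂ hne) (hf t₁ p' h₁.1) (hf t₁ q' h₁.2)
    (hf t₂ p' h₂.1) (hf t₂ q' h₂.2) (hf p' q' hpq) (by rwa [← hG]) (by rwa [← hG])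
  rw [← hG, ← hG, ← hG, ← hG] at this
  rcases this with ⟨h1, h2, h3, h4⟩ | ⟨h1, h2, h3, h4⟩
  · exact ⟨p, q, rfl, hpq', h1, h2, h3, h4⟩
  · exact ⟨q, p, Finset.pair_comm p q, hpq'.symm, h1, h2, h3, h4⟩

lemma MemG23.isAdmissible (h : G.MemG23) : G.IsAdmissible := by
  obtain ⟨s₁, s₂, A, B, q, hne, hnadj, hcut, h2, ⟨hA, hAc⟩, ⟨f⟩, -, ⟨hB, hBc⟩, hN⟩ := h
  lift A to Finset V using A.toFinite
  lift B to Finset V using B.toFinite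
  rw [Set.ncard_coe_finset] at hAc hBc
  have hs : G.Separates {s₁, s₂} A B := HasTwoComponents.separates (by simpa using h2)
  obtain ⟨a₁, a₂, rfl, haa, h₁, h₂, h₁', h₂'⟩ := exists_pair_of_iso_pathGraph hne hnadj
    (hs.notMem_left s₁ (by simp)) (hs.notMem_left s₂ (by simp)) hA hAc f
  have hcov : ∀ w, w = s₁ ∨ w = s₂ ∨ w = a₁ ∨ w = a₂ ∨ w ∈ B := fun w ↦ by
    simpa [or_assoc] using hs.cover w
  have hN' : ∀ b ∈ B, G.Adj s₁ b ∨ G.Adj s₂ b := fun b hb ↦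
    ((Set.ext_iff.mp hN b).mpr hb).imp And.left And.left
  have ha₁ : ∀ b ∈ B, ¬ G.Adj a₁ b := hs.not_adj a₁ (by simp)
  have ha₂ : ∀ b ∈ B, ¬ G.Adj a₂ b := hs.not_adj a₂ (by simp)
  have hodd : Odd (Fintype.card V) := by
    rw [← hs.card_add, Finset.card_pair hne, hAc, hBc]
    exact ⟨q + 2, by ring⟩
  have hB₁ : s₁ ∉ B := hs.notMem_right s₁ (by simp)
  have hB₂ : s₂ ∉ B := hs.notMem_right s₂ (by simp)
  -- the neighbourhoods of the vertices
  have ns₁ : ∀ w, G.Adj s₁ w → w = a₁ ∨ w ∈ B := fun w hw ↦ by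
    rcases hcov w with rfl | rfl | rfl | rfl | h
    exacts [absurd hw G.irrefl, absurd hw hnadj, .inl rfl, absurd hw h₁', .inr h]
  have ns₂ : ∀ w, G.Adj s₂ w → w = a₂ ∨ w ∈ B := fun w hw ↦ by
    rcases hcov w with rfl | rfl | rfl | rfl | h
    exacts [absurd hw.symm hnadj, absurd hw G.irrefl, absurd hw h₂', .inl rfl, .inr h]
  have na₁ : ∀ w, G.Adj a₁ w → w = s₁ ∨ w = a₂ := fun w hw ↦ by
    rcases hcov w with rfl | rfl | rfl | rfl | h
    exacts [.inl rfl, absurd hw.symm h₂', absurd hw G.irrefl, .inr rfl, absurd hw (ha₁ w h)]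
  have na₂ : ∀ w, G.Adj a₂ w → w = s₂ ∨ w = a₁ := fun w hw ↦ by
    rcases hcov w with rfl | rfl | rfl | rfl | h
    exacts [absurd hw.symm h₁', .inl rfl, .inr rfl, absurd hw G.irrefl, absurd hw (ha₂ w h)]
  have nB : ∀ b ∈ B, ∀ w, G.Adj b w → w = s₁ ∨ w = s₂ ∨ w ∈ B := fun b hb w hw ↦ by
    rcases hcov w with rfl | rfl | rfl | rfl | h
    exacts [.inl rfl, .inr (.inl rfl), absurd hw.symm (ha₁ b hb), absurd hw.symm (ha₂ b hb),
      .inr (.inr h)]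
  refine ⟨hcut.1.1, clawFreeOn_of_two_cliques fun x _ ↦ ?_,
    leavesAtMostOne_of_two_sets hodd (· ∈ B) ?_⟩
  · have pair : ∀ x s t, (∀ w, G.Adj x w → w = s ∨ w = t) → ∃ P : V → Prop, ∀ u w, G.Adj x u →
        G.Adj x w → u ≠ w → (P u ↔ P w) → G.Adj u w := by
      refine fun x s t hst ↦ ⟨fun w ↦ w = s, fun u w hu hw huw h' ↦ absurd ?_ huw⟩
      have := hst u hu
      have := hst w hw
      grind only
    have cut : ∀ x a, (∀ w, G.Adj x w → w = a ∨ w ∈ B) → ∃ P : V → Prop, ∀ u w, G.Adj x u →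
        G.Adj x w → u ≠ w → (P u ↔ P w) → G.Adj u w := by
      refine fun x a hN ↦ ⟨fun w ↦ w ∈ B, fun u w hu hw huw h' ↦ ?_⟩
      by_cases huB : u ∈ B
      · exact hB huB (h'.mp huB) huw
      · exact absurd (((hN u hu).resolve_right huB).trans
          ((hN w hw).resolve_right fun h ↦ huB (h'.mpr h)).symm) huw
    rcases hcov x with rfl | rfl | rfl | rfl | hx
    · exact cut x a₁ ns₁
    · exact cut x a₂ ns₂
    · exact pair x _ _ na₁
    · exact pair x _ _ na₂
    · refine ⟨fun w ↦ w = s₁ ∨ G.Adj s₁ w, fun u w hu hw huw h' ↦ ?_⟩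
      have key : ∀ w, G.Adj x w → ¬ (w = s₁ ∨ G.Adj s₁ w) → w = s₂ ∨ G.Adj s₂ w := by
        intro w hw hn
        rcases nB x hx w hw with rfl | rfl | hwB
        · exact absurd (.inl rfl) hn
        · exact .inl rfl
        · exact .inr ((hN' w hwB).resolve_left fun h ↦ hn (.inr h))
      have side : ∀ s, (u = s ∨ G.Adj s u) → (w = s ∨ G.Adj s w) → u ∈ B ∨ u = s → w ∈ B ∨ w = s →
          G.Adj u w := by
        rintro s hsu hsw (huB | rfl) (hwB | rfl)
        · exact hB huB hwB huw
        · exact (hsu.resolve_left huw).symm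
        · exact hsw.resolve_left huw.symm
        · exact absurd rfl huw
      have hu' := nB x hx u hu
      have hw' := nB x hx w hw
      by_cases hs₁ : u = s₁ ∨ G.Adj s₁ u
      · have hs₁' := h'.mp hs₁
        have e1 : u ≠ s₂ := fun h ↦
          hs₁.elim (fun h1 ↦ hne (h1.symm.trans h)) fun h1 ↦ hnadj (h ▸ h1)
        have e2 : w ≠ s₂ := fun h ↦
          hs₁'.elim (fun h1 ↦ hne (h1.symm.trans h)) fun h1 ↦ hnadj (h ▸ h1)
        exact side s₁ hs₁ hs₁' (hu'.elim .inr fun h ↦ .inl (h.resolve_left e1))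
          (hw'.elim .inr fun h ↦ .inl (h.resolve_left e2))
      · have hs₁' : ¬ (w = s₁ ∨ G.Adj s₁ w) := fun h ↦ hs₁ (h'.mpr h)
        exact side s₂ (key u hu hs₁) (key w hw hs₁') (hu'.resolve_left fun h ↦ hs₁ (.inl h)).symm
          (hw'.resolve_left fun h ↦ hs₁' (.inl h)).symm
  · intro F hF hI u hu w hw huw huw'
    have hn := hI u hu w hw
    -- two uncovered vertices outside `B` isolate a vertex of `A`, or all of `B`
    have no₁ : s₁ ∉ F → a₂ ∉ F → False := by
      intro h1 h2
      by_cases h3 : a₁ ∈ F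
      · obtain ⟨t, ht, hat, -⟩ := hF.exists_mate h3
        rcases na₁ t hat with rfl | rfl <;> contradiction
      · exact hI _ h3 _ h2 haa
    have no₂ : s₂ ∉ F → a₁ ∉ F → False := by
      intro h1 h2
      by_cases h3 : a₂ ∈ F
      · obtain ⟨t, ht, hat, -⟩ := hF.exists_mate h3
        rcases na₂ t hat with rfl | rfl <;> contradiction
      · exact hI _ h2 _ h3 haa
    have no : s₁ ∉ F → s₂ ∉ F → False := by
      intro h1 h2
      obtain ⟨b, hb, hbF⟩ := hF.exists_notMem_of_odd (T := B) (fun b hb w hw hbw ↦ by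
        rcases nB b hb w hbw with rfl | rfl | h
        exacts [absurd hw h1, absurd hw h2, h]) (hBc ▸ odd_two_mul_add_one q)
      rcases hN' b hb with h | h
      exacts [hI s₁ h1 b hbF h, hI s₂ h2 b hbF h]
    by_cases huB : u ∈ B
    · exact hn (hB huB (huw'.mp huB) huw)
    have hwB : w ∉ B := fun h ↦ huB (huw'.mpr h)
    rcases hcov u with rfl | rfl | rfl | rfl | h <;> rcases hcov w with rfl | rfl | rfl | rfl | h'
    exacts [huw rfl, no hu hw, hn h₁, no₁ hu hw, hwB h', no hw hu, huw rfl, no₂ hu hw, hn h₂,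
      hwB h', hn h₁.symm, no₂ hw hu, huw rfl, hn haa, hwB h', no₁ hw hu, hn h₂.symm, hn haa.symm,
      huw rfl, hwB h', huB h, huB h, huB h, huB h, hwB h']

/-- If each of three classes contains at most one vertex outside `F`, then three vertices outside
`F` are in different classes. -/
lemma exists_of_three_classes {F : Finset V} {P Q : V → Prop} {s x y z : V} (hx : x ∉ F)
    (hy : y ∉ F) (hz : z ∉ F) (hxy : x ≠ y) (hxz : x ≠ z) (hyz : y ≠ z)
    (c : ∀ t, P t ∨ Q t ∨ t = s) (hP : ∀ t ∉ F, ∀ t' ∉ F, t ≠ t' → P t → ¬ P t')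
    (hQ : ∀ t ∉ F, ∀ t' ∉ F, t ≠ t' → Q t → ¬ Q t') :
    s ∉ F ∧ (∃ u ∉ F, P u) ∧ ∃ w ∉ F, Q w := by
  have c₁ := c x
  have c₂ := c y
  have c₃ := c z
  have p₁ := hP x hx y hy hxy
  have p₂ := hP x hx z hz hxz
  have p₃ := hP y hy z hz hyz
  have q₁ := hQ x hx y hy hxy
  have q₂ := hQ x hx z hz hxz
  have q₃ := hQ y hy z hz hyz
  clear c hP hQ
  grind only

lemma MemG3.isAdmissible (h : G.MemG3) : G.IsAdmissible := by
  obtain ⟨s₁, s₂, s₃, A, B, p, q, e₁₂, e₁₃, e₂₃, -, -, -, hcut, h2, ⟨hA, hAc⟩, ⟨hB, hBc⟩, a, ha, b,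
    hb, hN₁, hN₂, hN₃⟩ := h
  lift A to Finset V using A.toFinite
  lift B to Finset V using B.toFinite
  rw [Set.ncard_coe_finset] at hAc hBc
  rw [Finset.mem_coe] at ha hb
  have hs : G.Separates {s₁, s₂, s₃} A B := HasTwoComponents.separates (by simpa using h2)
  have hcov : ∀ w, w = s₁ ∨ w = s₂ ∨ w = s₃ ∨ w ∈ A ∨ w ∈ B := fun w ↦ by
    simpa [or_assoc] using hs.cover w
  have n₁ : ∀ w, G.Adj s₁ w ↔ w = b ∨ w ∈ A := fun w ↦ by simpa using Set.ext_iff.mp hN₁ w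
  have n₂ : ∀ w, G.Adj s₂ w ↔ w = a ∨ w ∈ B := fun w ↦ by simpa using Set.ext_iff.mp hN₂ w
  have n₃ : ∀ w, G.Adj s₃ w ↔ (w ∈ A ∨ w ∈ B) ∧ ¬ (w = a ∨ w = b) := fun w ↦ by
    simpa using Set.ext_iff.mp hN₃ w
  have hs₁ : s₁ ∉ A := hs.notMem_left s₁ (by simp)
  have haB := hs.disjoint a ha
  have hbA : b ∉ A := fun h ↦ hs.disjoint b h hb
  have hodd : Odd (Fintype.card V) := by
    rw [← hs.card_add, Finset.card_eq_three.mpr ⟨s₁, s₂, s₃, e₁₂, e₁₃, e₂₃, rfl⟩, hAc, hBc]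
    exact ⟨p + q + 2, by ring⟩
  -- `A ∪ {s₁}` and `B ∪ {s₂}` are cliques, since `s₁` is adjacent to all of `A`, and `s₂` to
  -- all of `B`
  have k₁ : ∀ u w, (u = s₁ ∨ u ∈ A) → (w = s₁ ∨ w ∈ A) → u ≠ w → G.Adj u w := by
    rintro u w (rfl | hu) (rfl | hw) huw
    exacts [absurd rfl huw, (n₁ w).mpr (.inr hw), ((n₁ u).mpr (.inr hu)).symm, hA hu hw huw]
  have k₂ : ∀ u w, (u = s₂ ∨ u ∈ B) → (w = s₂ ∨ w ∈ B) → u ≠ w → G.Adj u w := by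
    rintro u w (rfl | hu) (rfl | hw) huw
    exacts [absurd rfl huw, (n₂ w).mpr (.inr hw), ((n₂ u).mpr (.inr hu)).symm, hB hu hw huw]
  have xA : ∀ x ∈ A, G.Adj x s₂ → ¬ G.Adj x s₃ := fun x hx h2 h3 ↦
    ((n₃ x).mp h3.symm).2 (.inl (((n₂ x).mp h2.symm).resolve_right (hs.disjoint x hx)))
  have xB : ∀ x ∈ B, G.Adj x s₁ → ¬ G.Adj x s₃ := fun x hx h1 h3 ↦
    ((n₃ x).mp h3.symm).2 (.inr (((n₁ x).mp h1.symm).resolve_right fun h ↦ hs.disjoint x h hx))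
  refine ⟨hcut.1.1, clawFreeOn_of_two_cliques fun x _ ↦ ?_, leavesAtMostOne_of_odd hodd ?_⟩
  · rcases hcov x with rfl | rfl | rfl | hx | hx
    · refine ⟨fun w ↦ w = b, fun u w hu hw huw h' ↦ ?_⟩
      rcases (n₁ u).mp hu with h1 | h1 <;> rcases (n₁ w).mp hw with h2 | h2
      exacts [absurd (h1.trans h2.symm) huw, absurd (h1.trans (h'.mp h1).symm) huw,
        absurd ((h'.mpr h2).trans h2.symm) huw, hA h1 h2 huw]
    · refine ⟨fun w ↦ w = a, fun u w hu hw huw h' ↦ ?_⟩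
      rcases (n₂ u).mp hu with h1 | h1 <;> rcases (n₂ w).mp hw with h2 | h2
      exacts [absurd (h1.trans h2.symm) huw, absurd (h1.trans (h'.mp h1).symm) huw,
        absurd ((h'.mpr h2).trans h2.symm) huw, hB h1 h2 huw]
    · refine ⟨fun w ↦ w ∈ A, fun u w hu hw huw h' ↦ ?_⟩
      by_cases huA : u ∈ A
      · exact hA huA (h'.mp huA) huw
      · exact hB (((n₃ u).mp hu).1.resolve_left huA)
          (((n₃ w).mp hw).1.resolve_left fun h ↦ huA (h'.mpr h)) huw
    · refine ⟨fun w ↦ w = s₁ ∨ w ∈ A, fun u w hu hw huw h' ↦ ?_⟩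
      by_cases huA : u = s₁ ∨ u ∈ A
      · exact k₁ u w huA (h'.mp huA) huw
      · have key : ∀ w, G.Adj x w → ¬ (w = s₁ ∨ w ∈ A) → w = s₂ ∨ w = s₃ := fun w hw hwA ↦ by
          rcases hcov w with h | h | h | h | h
          exacts [absurd (.inl h) hwA, .inl h, .inr h, absurd (.inr h) hwA,
            absurd hw (hs.not_adj x hx w h)]
        rcases key u hu huA with rfl | rfl <;>
          rcases key w hw fun h ↦ huA (h'.mpr h) with rfl | rfl
        exacts [absurd rfl huw, absurd hw (xA x hx hu), absurd hu (xA x hx hw), absurd rfl huw]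
    · refine ⟨fun w ↦ w = s₂ ∨ w ∈ B, fun u w hu hw huw h' ↦ ?_⟩
      by_cases huB : u = s₂ ∨ u ∈ B
      · exact k₂ u w huB (h'.mp huB) huw
      · have key : ∀ w, G.Adj x w → ¬ (w = s₂ ∨ w ∈ B) → w = s₁ ∨ w = s₃ := fun w hw hwB ↦ by
          rcases hcov w with h | h | h | h | h
          exacts [.inl h, absurd (.inl h) hwB, .inr h, absurd hw.symm (hs.not_adj w h x hx),
            absurd (.inr h) hwB]
        rcases key u hu huB with rfl | rfl <;>
          rcases key w hw fun h ↦ huB (h'.mpr h) with rfl | rfl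
        exacts [absurd rfl huw, absurd hw (xB x hx hu), absurd hu (xB x hx hw), absurd rfl huw]
  · intro F hF hI x hx y hy z hz hxy hxz hyz
    -- three uncovered vertices are `s₃` and one vertex of each of the two cliques
    obtain ⟨h₃, ⟨u, hu, huA⟩, w, hw, hwB⟩ : s₃ ∉ F ∧ (∃ u ∉ F, u = s₁ ∨ u ∈ A) ∧
        ∃ w ∉ F, w = s₂ ∨ w ∈ B := by
      have c : ∀ t, (t = s₁ ∨ t ∈ A) ∨ (t = s₂ ∨ t ∈ B) ∨ t = s₃ := fun t ↦ by
        rcases hcov t with h | h | h | h | h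
        exacts [.inl (.inl h), .inr (.inl (.inl h)), .inr (.inr h), .inl (.inr h),
          .inr (.inl (.inr h))]
      exact exists_of_three_classes hx hy hz hxy hxz hyz c
        (fun t ht t' ht' hne h h' ↦ hI t ht t' ht' (k₁ t t' h h' hne))
        fun t ht t' ht' hne h h' ↦ hI t ht t' ht' (k₂ t t' h h' hne)
    have hu' : u = s₁ ∨ u = a := huA.imp_right fun h ↦ by
      by_contra hne
      exact hI s₃ h₃ u hu ((n₃ u).mpr ⟨.inl h, fun h' ↦ h'.elim hne fun h1 ↦ hbA (h1 ▸ h)⟩)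
    have hw' : w = s₂ ∨ w = b := hwB.imp_right fun h ↦ by
      by_contra hne
      exact hI s₃ h₃ w hw ((n₃ w).mpr ⟨.inr h, fun h' ↦ h'.elim (fun h1 ↦ haB (h1 ▸ h)) hne⟩)
    rcases hu' with rfl | rfl <;> rcases hw' with rfl | rfl
    · obtain ⟨t, ht, htF⟩ := hF.exists_notMem_of_odd (T := A) (fun x hx t ht hxt ↦ by
        rcases hcov t with rfl | rfl | rfl | h | h
        exacts [absurd ht hu, absurd ht hw, absurd ht h₃, h, absurd hxt (hs.not_adj x hx t h)])
        (hAc ▸ odd_two_mul_add_one p)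
      exact hI u hu t htF ((n₁ t).mpr (.inr ht))
    · exact hI u hu w hw ((n₁ w).mpr (.inl rfl))
    · exact hI w hw u hu ((n₂ u).mpr (.inl rfl))
    · have hT : ∀ x ∈ insert s₁ (A \ {u}), ∀ t ∈ F, G.Adj x t → t ∈ insert s₁ (A \ {u}) := by
        intro x hx t ht hxt
        have htu : t ≠ u := fun h ↦ hu (h ▸ ht)
        simp only [Finset.mem_insert, Finset.mem_sdiff, Finset.mem_singleton] at hx ⊢
        rcases hx with rfl | hx
        · rcases (n₁ t).mp hxt with rfl | h
          exacts [absurd ht hw, .inr ⟨h, htu⟩]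
        · rcases hcov t with h | rfl | rfl | h | h
          · exact .inl h
          · rcases (n₂ x).mp hxt.symm with h1 | h1
            exacts [absurd h1 hx.2, absurd h1 (hs.disjoint x hx.1)]
          · exact absurd ht h₃
          · exact .inr ⟨h, htu⟩
          · exact absurd hxt (hs.not_adj x hx.1 t h)
      obtain ⟨t, ht, htF⟩ := hF.exists_notMem_of_odd hT (by
        rw [Finset.card_insert_of_notMem (by simp [hs₁]), card_sdiff_single ha, hAc]
        exact odd_two_mul_add_one p)
      simp only [Finset.mem_insert, Finset.mem_sdiff, Finset.mem_singleton] at ht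
      have htu : t ≠ u := fun h ↦ ht.elim (fun h1 ↦ hs₁ (h1 ▸ h ▸ ha)) fun h1 ↦ h1.2 h
      exact hI t htF u hu (k₁ t u (ht.imp_right And.left) (.inr ha) htu)

end Backward

end SimpleGraph

theorem theorem1 {V : Type*} [Finite V] (G : SimpleGraph V) :
    (G.Connected ∧ G.IsClawFree ∧ G.IsEquimatchable) ↔
      (Nonempty (G ≃g SimpleGraph.cycleGraph 4) ∨
        (∃ p : ℕ, 1 ≤ p ∧ Nonempty (G ≃g SimpleGraph.completeGraph (Fin (2 * p)))) ∨
        (G.Connected ∧ Odd (Nat.card V) ∧ G.indepNum ≤ 2) ∨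
        G.MemG1 ∨
        (G.MemG21 ∨ G.MemG22 ∨ G.MemG23 ∨ Nonempty (G ≃g SimpleGraph.cycleGraph 7)) ∨
        G.MemG3) := by
  classical
  have := Fintype.ofFinite V
  constructor
  · rintro ⟨hG, hcf, hE⟩
    have hcf' := SimpleGraph.isClawFree_iff.mp hcf
    have hc := (SimpleGraph.connected_iff_connectedOn_univ.mp hG).1
    exact (hE.leavesAtMostOne hc hcf').classification hG hcf'
  · intro h
    suffices G.IsAdmissible from
      ⟨this.1, SimpleGraph.isClawFree_iff.mpr this.2.1, this.2.2.isEquimatchable⟩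
    rcases h with ⟨⟨f⟩⟩ | ⟨p, hp, ⟨f⟩⟩ | ⟨hG, hodd, hI⟩ | h | (h | h | h | ⟨⟨f⟩⟩) | h
    · exact SimpleGraph.isAdmissible_of_iso_cycleGraph_four f
    · exact SimpleGraph.isAdmissible_of_iso_completeGraph hp f
    · rw [Nat.card_eq_fintype_card] at hodd
      exact ⟨hG, SimpleGraph.clawFreeOn_of_indepNum_le hI,
        SimpleGraph.leavesAtMostOne_of_indepNum_le hodd hI⟩
    · exact h.isAdmissible
    · exact h.isAdmissible
    · exact h.isAdmissible
    · exact h.isAdmissible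
    · exact SimpleGraph.isAdmissible_of_iso_cycleGraph_seven f
    · exact h.isAdmissible
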